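/- An \emph{outerplanar $st$-digraph} is a finite acyclic digraph with exactly one source $s$ and exactly one sink $t$, embedded in the plane without edge crossings so that all its vertices lie on the boundary of the external face (up to equivalence of embeddings: drawn with its vertices in strictly convex position and its edges as straight segments that meet only at common end-vertices). A \emph{strong $st$-polygon} is an outerplanar $st$-digraph that contains the edge from its source to its sink (its \emph{median}), this edge lying in the interior of the drawing, with vertices on both of its sides; a \emph{weak $st$-polygon} is what results from a strong $st$-polygon by deleting its median; an \emph{$st$-polygon} is a strong or a weak one. Let $G$ be an outerplanar $st$-digraph with $n$ vertices. A \emph{maximal $st$-polygon} of $G$ is an embedded subgraph of $G$, induced by its vertex set, that is an $st$-polygon and cannot be extended to another one by adding vertices. A \emph{free vertex} is a vertex that belongs to no maximal $st$-polygon. The \emph{representative} $r(R)$ of a maximal $st$-polygon $R$ is its source, and the representative of a free vertex $v$ is $r(v)=v$. For distinct elements $x,y$ of the set $\mathcal{R}(G)\cup\mathcal{F}(G)$ of all maximal $st$-polygons and free vertices, write $x\prec y$ if $G$ has a directed path (possibly of length $0$) from $r(x)$ to $r(y)$. \textbf{Theorem.} (i) For every outerplanar $st$-digraph $G$, any two distinct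 maximal $st$-polygons of $G$ are area-disjoint (the regions that they occupy have no common interior point), and $\prec$ is a strict total order on $\mathcal{R}(G)\cup\mathcal{F}(G)$. The \emph{$st$-polygon decomposition} $\mathcal{D}(G)$ is the list of the elements of $\mathcal{R}(G)\cup\mathcal{F}(G)$ in this order. (ii) $\mathcal{D}(G)$ can be computed in $O(n)$ time: there are a random access machine program (with addition, subtraction, comparison and indirect addressing as unit-cost operations) and a constant $c$ such that, for every outerplanar $st$-digraph $G$ on the vertex set $\{0,\dots,n-1\}$, when given $n$, the vertices of $G$ in counterclockwise order along the external boundary (starting anywhere), and the edges of $G$ as a list of pairs in arbitrary order, the program halts after at most $cn$ steps, stores no number greater than $cn$, and outputs $\mathcal{D}(G)$ in order, each maximal $st$-polygon being reported by the list of all its vertices counterclockwise along its boundary starting at its source, and each free vertex by itself. -/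

import Mathlib

/-! ## Outerplanar st-digraphs and their drawings

An outerplanar drawing is represented by a straight-line drawing whose vertices are in strictly
convex position, so that every vertex lies on the boundary of the external face. -/

/-- Twice the signed area of the triangle `a b c`; it is positive iff `a`, `b`, `c` is a
counterclockwise turn, that is, iff `c` lies strictly to the left of the line from `a` to `b`. -/
def orient (a b c : ℝ × ℝ) : ℝ :=
  (b.1 - a.1) * (c.2 - a.2) - (b.2 - a.2) * (c.1 - a.1)

section Graphs

variable {V : Type*}

/-- `l` lists the vertices of `W` counterclockwise along the boundary of a strictly convex polygon
(starting anywhere). -/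
structure IsBoundary (p : V → ℝ × ℝ) (W : Finset V) (l : List V) : Prop where
  nodup : l.Nodup
  mem_iff : ∀ v, v ∈ l ↔ v ∈ W
  ccw : l.Triplewise fun a b c => 0 < orient (p a) (p b) (p c)

/-- `v` is a source of the subgraph of `G` induced by `W`. -/
def IsSource (G : Digraph V) (W : Finset V) (v : V) : Prop :=
  v ∈ W ∧ ∀ x ∈ W, ¬ G.Adj x v

/-- `v` is a sink of the subgraph of `G` induced by `W`. -/
def IsSink (G : Digraph V) (W : Finset V) (v : V) : Prop :=
  v ∈ W ∧ ∀ x ∈ W, ¬ G.Adj v x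

/-- The subgraph of `G` induced by `W`, drawn by `p` with straight edges, is an embedded
outerplanar st-digraph with source `s` and sink `t`. -/
structure IsOuterplanarSTDigraph (p : V → ℝ × ℝ) (G : Digraph V) (W : Finset V) (s t : V) :
    Prop where
  /-- distinct vertices are distinct points -/
  injOn : Set.InjOn p (W : Set V)
  /-- all vertices are on the external boundary -/
  convex : ∃ l, IsBoundary p W l
  /-- distinct edges meet only at common end-vertices -/
  planar : ∀ a ∈ W, ∀ b ∈ W, ∀ c ∈ W, ∀ d ∈ W, G.Adj a b → G.Adj c d → (a, b) ≠ (c, d) →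
    segment ℝ (p a) (p b) ∩ segment ℝ (p c) (p d) ⊆ p '' (({a, b} : Set V) ∩ {c, d})
  acyclic : ∀ v, ¬ Relation.TransGen (fun a b => a ∈ W ∧ b ∈ W ∧ G.Adj a b) v v
  /-- `s` is the only source -/
  source : ∀ v, IsSource G W v ↔ v = s
  /-- `t` is the only sink -/
  sink : ∀ v, IsSink G W v ↔ v = t

/-- The digraph `G` with the edge `(u, v)` added. -/
def addEdge (G : Digraph V) (u v : V) : Digraph V where
  Adj a b := G.Adj a b ∨ (a = u ∧ b = v)

/-! ## st-polygons -/

/-- The embedded subgraph of `G` induced by `W` is a strong st-polygon with source `u` and sink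
`v`: an outerplanar st-digraph that contains the edge `(u, v)` (the median), which lies in the
interior of the drawing, i.e. there are vertices on both of its sides. -/
structure IsStrongSTPolygon (p : V → ℝ × ℝ) (G : Digraph V) (W : Finset V) (u v : V) :
    Prop where
  outerplanar : IsOuterplanarSTDigraph p G W u v
  median : G.Adj u v
  left : ∃ a ∈ W, 0 < orient (p u) (p v) (p a)
  right : ∃ b ∈ W, orient (p u) (p v) (p b) < 0

/-- The embedded subgraph of `G` induced by `W` is a weak st-polygon: it results from a strong
st-polygon by the deletion of the median. -/
def IsWeakSTPolygon (p : V → ℝ × ℝ) (G : Digraph V) (W : Finset V) (u v : V) : Prop :=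
  ¬ G.Adj u v ∧ IsStrongSTPolygon p (addEdge G u v) W u v

/-- The embedded subgraph of `G` induced by `W` is an st-polygon. -/
def IsSTPolygon (p : V → ℝ × ℝ) (G : Digraph V) (W : Finset V) : Prop :=
  ∃ u v, IsStrongSTPolygon p G W u v ∨ IsWeakSTPolygon p G W u v

/-- `W` is the vertex set of a maximal st-polygon of `G`: no further vertices can be added to it. -/
def IsMaximalSTPolygon (p : V → ℝ × ℝ) (G : Digraph V) (W : Finset V) : Prop :=
  Maximal (IsSTPolygon p G) W

/-- A free vertex is one that is in no maximal st-polygon. -/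
def IsFreeVertex (p : V → ℝ × ℝ) (G : Digraph V) (v : V) : Prop :=
  ∀ W, IsMaximalSTPolygon p G W → v ∉ W

/-- The regions occupied by the st-polygons on `W` and `W'` have no common interior point.
The region of an st-polygon is bounded by its external boundary, a strictly convex polygon. -/
def AreaDisjoint (p : V → ℝ × ℝ) (W W' : Finset V) : Prop :=
  Disjoint (interior (convexHull ℝ (p '' (W : Set V))))
    (interior (convexHull ℝ (p '' (W' : Set V))))

/-! ## The st-polygon decomposition -/

/-- A vertex set (meant as an st-polygon) or a single vertex (meant as a free vertex). -/
inductive Piece (V : Type*)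
  | polygon (W : Finset V)
  | free (v : V)

/-- The elements of the decomposition: the maximal st-polygons and the free vertices of `G`. -/
def IsPiece (p : V → ℝ × ℝ) (G : Digraph V) : Piece V → Prop
  | .polygon W => IsMaximalSTPolygon p G W
  | .free v => IsFreeVertex p G v

/-- `r` is the representative of a piece: the source of an st-polygon, the free vertex itself. -/
def IsRepresentative (G : Digraph V) : Piece V → V → Prop
  | .polygon W, r => IsSource G W r
  | .free v, r => r = v

/-- `x` and `y` are distinct, and there is a directed path from the representative of `x` to the
representative of `y`. -/
def Precedes (G : Digraph V) (x y : Piece V) : Prop :=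
  x ≠ y ∧ ∃ a b, IsRepresentative G x a ∧ IsRepresentative G y b ∧
    Relation.ReflTransGen G.Adj a b

/-- `L` is the st-polygon decomposition of `G`: the maximal st-polygons and the free vertices,
listed in the order `Precedes`. -/
def IsSTPolygonDecomposition (p : V → ℝ × ℝ) (G : Digraph V) (L : List (Piece V)) : Prop :=
  (∀ x, x ∈ L ↔ IsPiece p G x) ∧ L.Pairwise (Precedes G)

end Graphs

/-! ## Random access machine

A machine has registers and arrays of words, all indexed by natural numbers; a program mentions
only finitely many registers and arrays. A word is a natural number that is at most a given bound
`B`. The operations are addition, truncated subtraction, indirect access and comparison. -/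

/-- Contents of the registers, and of the cells of the arrays. -/
structure MachineState where
  reg : ℕ → ℕ
  arr : ℕ → ℕ → ℕ

inductive Expr
  | const (k : ℕ)
  | reg (r : ℕ)
  | read (a : ℕ) (i : Expr)
  | add (e₁ e₂ : Expr)
  | sub (e₁ e₂ : Expr)

def Expr.eval (σ : MachineState) : Expr → ℕ
  | .const k => k
  | .reg r => σ.reg r
  | .read a i => σ.arr a (i.eval σ)
  | .add e₁ e₂ => e₁.eval σ + e₂.eval σ
  | .sub e₁ e₂ => e₁.eval σ - e₂.eval σ

/-- Number of steps for evaluating an expression: one for each operation. -/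
def Expr.cost : Expr → ℕ
  | .const _ => 1
  | .reg _ => 1
  | .read _ i => i.cost + 1
  | .add e₁ e₂ => e₁.cost + e₂.cost + 1
  | .sub e₁ e₂ => e₁.cost + e₂.cost + 1

inductive Program
  | skip
  /-- assign `e` to register `r` -/
  | assign (r : ℕ) (e : Expr)
  /-- assign `e` to the cell `i` of array `a` -/
  | write (a : ℕ) (i e : Expr)
  | seq (P Q : Program)
  /-- if `e₁ < e₂` then `P` else `Q` -/
  | ifLt (e₁ e₂ : Expr) (P Q : Program)
  /-- while `e₁ < e₂` do `P` -/
  | whileLt (e₁ e₂ : Expr) (P : Program)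

def MachineState.setReg (σ : MachineState) (r x : ℕ) : MachineState :=
  { σ with reg := Function.update σ.reg r x }

def MachineState.setArr (σ : MachineState) (a i x : ℕ) : MachineState :=
  { σ with arr := Function.update σ.arr a (Function.update (σ.arr a) i x) }

/-- `Runs B P σ k τ`: on a machine with word bound `B`, the program `P` started in the state `σ`
halts after exactly `k` steps in the state `τ`. There is no run that stores a number greater
than `B` or writes to an address greater than `B`. -/
inductive Runs (B : ℕ) : Program → MachineState → ℕ → MachineState → Prop
  | skip (σ : MachineState) : Runs B .skip σ 1 σ
  | assign (σ : MachineState) (r : ℕ) (e : Expr) (h : e.eval σ ≤ B) :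
      Runs B (.assign r e) σ (e.cost + 1) (σ.setReg r (e.eval σ))
  | write (σ : MachineState) (a : ℕ) (i e : Expr) (hi : i.eval σ ≤ B) (h : e.eval σ ≤ B) :
      Runs B (.write a i e) σ (i.cost + e.cost + 1) (σ.setArr a (i.eval σ) (e.eval σ))
  | seq {P Q : Program} {σ τ υ : MachineState} {k l : ℕ}
      (hP : Runs B P σ k τ) (hQ : Runs B Q τ l υ) : Runs B (.seq P Q) σ (k + l + 1) υ
  | ifTrue {e₁ e₂ : Expr} {P Q : Program} {σ τ : MachineState} {k : ℕ}
      (h : e₁.eval σ < e₂.eval σ) (hP : Runs B P σ k τ) :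
      Runs B (.ifLt e₁ e₂ P Q) σ (e₁.cost + e₂.cost + k + 1) τ
  | ifFalse {e₁ e₂ : Expr} {P Q : Program} {σ τ : MachineState} {k : ℕ}
      (h : ¬ e₁.eval σ < e₂.eval σ) (hQ : Runs B Q σ k τ) :
      Runs B (.ifLt e₁ e₂ P Q) σ (e₁.cost + e₂.cost + k + 1) τ
  | whileTrue {e₁ e₂ : Expr} {P : Program} {σ τ υ : MachineState} {k l : ℕ}
      (h : e₁.eval σ < e₂.eval σ) (hP : Runs B P σ k τ)
      (hW : Runs B (.whileLt e₁ e₂ P) τ l υ) :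
      Runs B (.whileLt e₁ e₂ P) σ (e₁.cost + e₂.cost + k + l + 1) υ
  | whileFalse {e₁ e₂ : Expr} {P : Program} {σ : MachineState}
      (h : ¬ e₁.eval σ < e₂.eval σ) :
      Runs B (.whileLt e₁ e₂ P) σ (e₁.cost + e₂.cost + 1) σ

/-! ## Input and output -/

/-- The initial state. Register 0 holds the number of vertices and register 1 the number of edges;
array 0 holds the vertices in the order of the external boundary, arrays 1 and 2 hold the tails and
the heads of the edges. Everything else is 0. -/
def inputState {n : ℕ} (b : List (Fin n)) (edges : List (Fin n × Fin n)) : MachineState where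
  reg := fun r => match r with
    | 0 => n
    | 1 => edges.length
    | _ => 0
  arr := fun a i => match a with
    | 0 => (b.map fun v => (v : ℕ)).getD i 0
    | 1 => (edges.map fun e => (e.1 : ℕ)).getD i 0
    | 2 => (edges.map fun e => (e.2 : ℕ)).getD i 0
    | _ => 0

/-- `l` reports a piece: a free vertex is reported by itself, an st-polygon by the list of
all its vertices in counterclockwise order along its boundary, beginning with its source. -/
def Reports {V : Type*} (p : V → ℝ × ℝ) (G : Digraph V) : Piece V → List V → Prop
  | .polygon W, l => IsBoundary p W l ∧ ∃ u, l.head? = some u ∧ IsSource G W u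
  | .free v, l => l = [v]

/-- The final state holds a report of the list `L` of pieces. The report of each piece, preceded by
its length, is a block of words; the concatenation of these blocks in the order of `L` is in
array 3 and its length is in register 0. -/
def IsOutput {n : ℕ} (p : Fin n → ℝ × ℝ) (G : Digraph (Fin n)) (L : List (Piece (Fin n)))
    (τ : MachineState) : Prop :=
  ∃ reports : List (List (Fin n)), List.Forall₂ (Reports p G) L reports ∧
    List.ofFn (fun i : Fin (τ.reg 0) => τ.arr 3 i) =
      reports.flatMap fun l => l.length :: l.map fun v => (v : ℕ)

/-! ## Ladders

The combinatorial structure of an outerplanar st-digraph: its vertices form two chains, indexed by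
`Bool` (`false` for the right one), and are numbered along each chain from the source to the sink. -/

open Relation

/-! Cut the boundary at the source and at the sink. The vertices then form a right and a left chain,
and each vertex gets a side and a height. Each chain is ordered by reachability: for `a` below `b`
on one chain, a path from the source to `b` and a path from `a` to the sink have interleaved ends on
a convex polygon, so they meet, which gives a path from `a` to `b`. Such a path may use the other
chain, and therefore `tot` speaks of reachability. Edges across do not cross, so they are totally
ordered by height, and a vertex strictly under an edge of its own chain has no edge across. `Ladder`
keeps only these facts; the geometry is used once to obtain them (`Drawing.ladder`) and otherwise
only for planarity, convexity and areas.

An st-polygon becomes a box: an interval of heights on each side, without gaps, all of whose edges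
across touch the source or the sink of the box. The source determines the maximal box above it
(`Cand`). Let `y` be the next vertex above the source on its side that has an edge across. That edge
misses the source, so it must touch the sink. If an edge enters `y` from the other side, then `y` is
the sink; otherwise the sink is the lowest out-neighbour of `y` across. It remains to take the full
fans at the source and at the sink. So each box lies in a candidate (`IsBox.exists_cand`), each
st-polygon lies in a box (`IsPoly.exists_box`), and each candidate is an st-polygon
(`Drawing.isStrong_of_isBox`).

Two candidates with different sources lie one above the other on both sides (`Cand.separated`):
otherwise the bottom edge of one would be a chord of the other, hence touch its source or sink, and
a cycle or a second edge to the same head results. So no candidate contains another, the candidates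
are exactly the maximal st-polygons (`Drawing.isMaximal_iff`), and the line through the two top
vertices of the lower one separates their regions.

The order is total because any two sources of candidates are comparable (`Cand.comparable`) and a
vertex that is incomparable to another one lies in a box (`Incomp.exists_box`). For the latter, take
the highest edge across below the pair and the lowest one above it. They bound a box unless an
unattached edge straddles the pair; in that case one vertex of the pair is moved to an end of that
edge, and fewer edges straddle the new pair.

The algorithm computes sides, heights and extreme neighbours across in one pass over the edges, of
which there are at most `2 * n`. It then visits the vertices in a topological order with one pointer
per chain. The candidate of a vertex, if any, is found with constantly many table lookups. A vertex
without one is free exactly if it is not below the covered height of its side. Successive boxes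
overlap in at most one height per side, so the output and the total work are linear. -/

structure Ladder where
  N : Bool → ℕ
  E : Bool × ℕ → Bool × ℕ → Prop
  dom : ∀ {x y}, E x y → x.2 < N x.1 ∧ y.2 < N y.1
  acyclic : ∀ {x y}, E x y → ¬ ReflTransGen E y x
  tot : ∀ {σ i j}, i ≤ j → j < N σ → ReflTransGen E (σ, i) (σ, j)
  nc : ∀ {σ i j k l}, (E (σ, i) (!σ, j) ∨ E (!σ, j) (σ, i)) →
    (E (σ, k) (!σ, l) ∨ E (!σ, l) (σ, k)) → i < k → j ≤ l
  hide : ∀ {σ i j k l}, E (σ, i) (σ, j) → i < k → k < j →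
    ¬ (E (σ, k) (!σ, l) ∨ E (!σ, l) (σ, k))
  root : ∃ s, ∀ x : Bool × ℕ, x.2 < N x.1 → ReflTransGen E s x
  top : ∃ t, ∀ x : Bool × ℕ, x.2 < N x.1 → ReflTransGen E x t

namespace Ladder

variable {L : Ladder}

abbrev Reach (L : Ladder) := ReflTransGen L.E

/-- adjacency across the two chains -/
def X (L : Ladder) (σ : Bool) (i j : ℕ) : Prop := L.E (σ, i) (!σ, j) ∨ L.E (!σ, j) (σ, i)

def con (L : Ladder) (σ : Bool) (k : ℕ) : Prop := L.E (σ, k) (σ, k + 1)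

lemma X_not {σ : Bool} {i j : ℕ} : L.X (!σ) j i ↔ L.X σ i j := by
  simp only [X, Bool.not_not]; exact or_comm

lemma X.dom {σ : Bool} {i j : ℕ} (h : L.X σ i j) : i < L.N σ ∧ j < L.N (!σ) := by
  rcases h with h | h
  · exact L.dom h
  · exact (L.dom h).symm

lemma nc' {σ : Bool} {i j k l : ℕ} (h : L.X σ i j) (h' : L.X σ k l) (hik : i < k) : j ≤ l :=
  L.nc h h' hik

lemma nc'' {σ : Bool} {i j k l : ℕ} (h : L.X σ i j) (h' : L.X σ k l) (hjl : j < l) : i ≤ k := by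
  by_contra hk
  exact absurd (L.nc h' h (not_le.1 hk)) (by omega)

lemma reach_antisymm {x y : Bool × ℕ} (h : L.Reach x y) (h' : L.Reach y x) : x = y := by
  rcases ReflTransGen.cases_head h with h0 | ⟨z, hz, hzy⟩
  · exact h0
  · exact absurd (hzy.trans h') (L.acyclic hz)

lemma le_of_reach {σ : Bool} {i j : ℕ} (h : L.Reach (σ, i) (σ, j)) : i ≤ j := by
  by_contra hji
  rcases ReflTransGen.cases_head h with h0 | ⟨z, hz, hzy⟩
  · simp only [Prod.mk.injEq, true_and] at h0; omega
  · exact L.acyclic hz (hzy.trans (L.tot (by omega) (L.dom hz).1))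

lemma lt_of_E {σ : Bool} {i j : ℕ} (h : L.E (σ, i) (σ, j)) : i < j := by
  by_contra hji
  exact L.acyclic h (L.tot (not_lt.1 hji) (L.dom h).1)

/-- Look at the first edge of a path from height `k` to height `k + 1`. If it stays on the chain it
cannot overshoot, since heights increase along paths between vertices of one chain. `con_or_in`
looks at the last edge instead. -/
lemma con_or_out {σ : Bool} {k : ℕ} (hk : k + 1 < L.N σ) :
    L.con σ k ∨ ∃ l, L.E (σ, k) (!σ, l) ∧ L.Reach (!σ, l) (σ, k + 1) := by
  rcases ReflTransGen.cases_head (L.tot (Nat.le_succ k) hk) with h0 | ⟨⟨τ, m⟩, hz, hzy⟩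
  · simp at h0
  · rcases Bool.eq_or_eq_not τ σ with rfl | rfl
    · have h1 := lt_of_E hz
      have h2 := le_of_reach hzy
      obtain rfl : m = k + 1 := by omega
      exact .inl hz
    · exact .inr ⟨m, hz, hzy⟩

lemma con_or_in {σ : Bool} {k : ℕ} (hk : k + 1 < L.N σ) :
    L.con σ k ∨ ∃ l, L.E (!σ, l) (σ, k + 1) ∧ L.Reach (σ, k) (!σ, l) := by
  rcases ReflTransGen.cases_tail (L.tot (Nat.le_succ k) hk) with h0 | ⟨⟨τ, m⟩, hzy, hz⟩
  · simp at h0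
  · rcases Bool.eq_or_eq_not τ σ with rfl | rfl
    · have h1 := lt_of_E hz
      have h2 := le_of_reach hzy
      obtain rfl : m = k := by omega
      exact .inl hz
    · exact .inr ⟨m, hz, hzy⟩

/-- By `hide` the vertices strictly between `i` and `j` have no edges across, so a path between
neighbours cannot leave the chain at such a vertex. At least one of `k`, `k + 1` is of this kind,
unless the edge itself joins `k` to `k + 1`. -/
lemma con_of_E {σ : Bool} {i j k : ℕ} (h : L.E (σ, i) (σ, j)) (hik : i ≤ k) (hkj : k < j) :
    L.con σ k := by
  have hj := (L.dom h).2
  rcases hik.lt_or_eq with hik | rfl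
  · rcases con_or_out (L := L) (σ := σ) (k := k) (lt_of_le_of_lt hkj hj) with h1 | ⟨l, hl, _⟩
    · exact h1
    · exact absurd (.inl hl) (L.hide h hik hkj)
  · rcases (Nat.succ_le_of_lt hkj).lt_or_eq with hkj | rfl
    · rcases con_or_in (L := L) (σ := σ) (k := i) (hkj.trans hj) with h1 | ⟨l, hl, _⟩
      · exact h1
      · exact absurd (.inr hl) (L.hide h (Nat.lt_succ_self i) hkj)
    · exact h

/-- A gap above `k` would come with an edge from `(σ, k)` to some `(!σ, l)`. Since it does not cross
the edge to `q`, `l ≤ j`, and a cycle through `p` arises. -/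
lemma con_out_fan {σ : Bool} {j p q k : ℕ} (hp : L.E (!σ, j) (σ, p)) (hq : L.E (!σ, j) (σ, q))
    (hpk : p ≤ k) (hkq : k < q) : L.con σ k := by
  rcases con_or_out (L := L) (σ := σ) (k := k) (lt_of_le_of_lt hkq (L.dom hq).2) with
    h1 | ⟨l, hl, _⟩
  · exact h1
  · have hlj : l ≤ j := L.nc (.inl hl) (.inr hq) hkq
    exact absurd (((L.tot hpk (L.dom hl).1).tail hl).trans (L.tot hlj (L.dom hp).1))
      (L.acyclic hp)

lemma con_in_fan {σ : Bool} {j p q k : ℕ} (hp : L.E (σ, p) (!σ, j)) (hq : L.E (σ, q) (!σ, j))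
    (hpk : p ≤ k) (hkq : k < q) : L.con σ k := by
  rcases con_or_in (L := L) (σ := σ) (k := k) (lt_of_le_of_lt hkq (L.dom hq).1) with
    h1 | ⟨l, hl, _⟩
  · exact h1
  · have hlj : j ≤ l := L.nc (.inl hp) (.inr hl) (by omega)
    exact absurd ((L.tot hlj (L.dom hl).1).tail hl |>.trans (L.tot hkq (L.dom hq).1))
      (L.acyclic hq)

lemma reach_of_con {σ : Bool} {i j : ℕ} (hij : i ≤ j) (h : ∀ k, i ≤ k → k < j → L.con σ k) :
    L.Reach (σ, i) (σ, j) := by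
  induction j, hij using Nat.le_induction with
  | base => exact .refl
  | succ j hj ih => exact (ih fun k h1 h2 => h k h1 (by omega)).tail (h j hj (by omega))

/-! ### Boxes -/

/-- The combinatorial counterpart of an st-polygon: its vertices are those of heights `lo ρ` to
`hi ρ` on each side `ρ`, its source is `(σ, lo σ)` and its sink is `(τ, hi τ)`. -/
structure IsBox (L : Ladder) (lo hi : Bool → ℕ) (σ τ : Bool) : Prop where
  bot : L.E (σ, lo σ) (!σ, lo !σ)
  top : L.E (!τ, hi !τ) (τ, hi τ)
  le : ∀ ρ, lo ρ ≤ hi ρ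
  con : ∀ ρ k, lo ρ ≤ k → k < hi ρ → L.con ρ k
  chord : ∀ k l, L.X σ k l → lo σ ≤ k → k ≤ hi σ → lo (!σ) ≤ l → l ≤ hi (!σ) →
    k = lo σ ∨ (τ = σ ∧ k = hi σ) ∨ (τ = !σ ∧ l = hi (!σ))
  same : τ = σ → lo σ + 2 ≤ hi σ
  opp : τ = !σ → lo σ < hi σ ∧ lo (!σ) < hi (!σ)

/-- `(σ, i)` is the source of the maximal box between `lo` and `hi`, whose sink is `(τ, hi τ)`. -/
inductive Cand (L : Ladder) (σ : Bool) (i : ℕ) (lo hi : Bool → ℕ) : Bool → Prop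
  -- The sink is on the side of the source: `y` has an edge entering from the other side. Of the
  -- stretch between the fans, only the gap at `x` has to be excluded; `con_between` gives the rest.
  | mk_same (x y z : ℕ) (con : L.con σ i) (lo_eq : lo σ = i)
      (hx : L.E (σ, i) (!σ, x)) (max_x : ∀ j, L.E (σ, i) (!σ, j) → j ≤ x)
      (hlo : L.E (σ, i) (!σ, lo !σ)) (min_lo : ∀ j, L.E (σ, i) (!σ, j) → lo (!σ) ≤ j)
      (hiy : i < y) (next : ∀ k l, i < k → k < y → ¬ L.X σ k l)
      (con_x : x < z → L.con (!σ) x)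
      (hz : L.E (!σ, z) (σ, y)) (min_z : ∀ j, L.E (!σ, j) (σ, y) → z ≤ j)
      (hi_eq : hi σ = y) (len : i + 2 ≤ y)
      (htop : L.E (!σ, hi !σ) (σ, y)) (max_top : ∀ j, L.E (!σ, j) (σ, y) → j ≤ hi !σ) :
      Cand L σ i lo hi σ
  -- The sink is on the other side: no edge across enters `y`, and `z` is its lowest out-neighbour
  -- there.
  | mk_opp (x y z : ℕ) (con : L.con σ i) (lo_eq : lo σ = i)
      (hx : L.E (σ, i) (!σ, x)) (max_x : ∀ j, L.E (σ, i) (!σ, j) → j ≤ x)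
      (hlo : L.E (σ, i) (!σ, lo !σ)) (min_lo : ∀ j, L.E (σ, i) (!σ, j) → lo (!σ) ≤ j)
      (hiy : i < y) (next : ∀ k l, i < k → k < y → ¬ L.X σ k l)
      (con_x : x < z → L.con (!σ) x)
      (no_in : ∀ j, ¬ L.E (!σ, j) (σ, y))
      (hz : L.E (σ, y) (!σ, z)) (min_z : ∀ j, L.E (σ, y) (!σ, j) → z ≤ j)
      (hi_eq : hi (!σ) = z) (len : lo (!σ) < z)
      (htop : L.E (σ, hi σ) (!σ, z)) (max_top : ∀ j, L.E (σ, j) (!σ, z) → j ≤ hi σ) :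
      Cand L σ i lo hi (!σ)

lemma Cand.lo_eq {σ τ : Bool} {i : ℕ} {lo hi : Bool → ℕ} (h : L.Cand σ i lo hi τ) : lo σ = i := by
  cases h <;> assumption

lemma con_of_no_X {σ : Bool} {k : ℕ} (hk : k + 1 < L.N σ) (h : ∀ l, ¬ L.X σ k l) : L.con σ k := by
  rcases con_or_out (L := L) hk with h1 | ⟨l, hl, _⟩
  · exact h1
  · exact absurd (.inl hl) (h l)

/-- Along the side opposite to the source of a candidate, between its last out-edge and the next
edge across, there are no gaps. -/
lemma con_between {σ : Bool} {i x y z : ℕ} (hx : L.E (σ, i) (!σ, x))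
    (max_x : ∀ j, L.E (σ, i) (!σ, j) → j ≤ x) (next : ∀ k l, i < k → k < y → ¬ L.X σ k l)
    (con_x : x < z → L.con (!σ) x) (hz : L.X σ y z) (min_z : ∀ j, L.X σ y j → z ≤ j)
    {k : ℕ} (hxk : x ≤ k) (hkz : k < z) : L.con (!σ) k := by
  rcases hxk.lt_or_eq with hxk | rfl
  · refine con_of_no_X (lt_of_le_of_lt hkz hz.dom.2) fun c hc => ?_
    rw [X_not] at hc
    have h1 : i ≤ c := nc'' (.inl hx) hc hxk
    have h2 : c ≤ y := nc'' hc hz hkz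
    rcases h1.lt_or_eq with h1 | rfl
    · rcases h2.lt_or_eq with h2 | rfl
      · exact next _ _ h1 h2 hc
      · exact absurd (min_z _ hc) (by omega)
    · rcases hc with hc | hc
      · exact absurd (max_x _ hc) (by omega)
      · exact L.acyclic hx ((L.tot hxk.le (L.dom hc).1).tail hc)
  · exact con_x hkz

lemma con_below_next {σ : Bool} {i y : ℕ} (con : L.con σ i) (hy : y < L.N σ)
    (next : ∀ k l, i < k → k < y → ¬ L.X σ k l) {k : ℕ} (hik : i ≤ k) (hky : k < y) :
    L.con σ k := by
  rcases hik.lt_or_eq with hik | rfl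
  · exact con_of_no_X (lt_of_le_of_lt hky hy) fun l => next k l hik hky
  · exact con

lemma in_lt_out {σ : Bool} {y j l : ℕ} (hj : L.E (!σ, j) (σ, y)) (hl : L.E (σ, y) (!σ, l)) :
    j < l := by
  by_contra h
  exact L.acyclic hj (.head hl (L.tot (not_lt.1 h) (L.dom hj).1))

/-- The side of the source has no gaps up to `y` because nothing crosses in between. The other side
is made of the out-fan of the source, the stretch of `con_between` and, if the sink is on the
source's side, its in-fan. If the sink is opposite, its in-fan continues the source's side above
`y`. -/
lemma Cand.isBox {σ τ : Bool} {i : ℕ} {lo hi : Bool → ℕ} (h : L.Cand σ i lo hi τ) :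
    L.IsBox lo hi σ τ := by
  cases h with
  | mk_same x y z con lo_eq hx max_x hlo min_lo hiy next con_x hz min_z hi_eq len htop max_top =>
    have hy := (L.dom hz).2
    have hxz : x ≤ z := L.nc (.inl hx) (.inr hz) hiy
    have hlx := min_lo _ hx
    have hzt := max_top _ hz
    -- By acyclicity the in-neighbours of `y` across are below its out-neighbours, so `z` is lowest
    -- among both.
    have min_z' : ∀ j, L.X σ y j → z ≤ j := by
      rintro j (h | h)
      · exact (in_lt_out hz h).le
      · exact min_z _ h
    refine ⟨by rwa [lo_eq], by rwa [hi_eq], ?_, ?_, ?_, fun _ => by omega, fun h => by simp at h⟩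
    · intro ρ
      rcases Bool.eq_or_eq_not ρ σ with rfl | rfl <;> omega
    · intro ρ k hk1 hk2
      rcases Bool.eq_or_eq_not ρ σ with rfl | rfl
      · exact con_below_next con hy next (by omega) (by omega)
      · rcases lt_or_ge k x with h1 | h1
        · exact con_out_fan (by simpa using hlo) (by simpa using hx) hk1 h1
        · rcases lt_or_ge k z with h2 | h2
          · exact con_between hx max_x next con_x (.inr hz) min_z' h1 h2
          · exact con_in_fan (by simpa using hz) (by simpa using htop) h2 hk2
    · intro k l hX h1 h2 h3 h4
      by_contra hne
      refine next k l (by omega) ?_ hX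
      simp only [true_and] at hne
      omega
  | mk_opp x y z con lo_eq hx max_x hlo min_lo hiy next con_x no_in hz min_z hi_eq len htop
      max_top =>
    have hy := (L.dom hz).1
    have hxz : x ≤ z := L.nc (.inl hx) (.inl hz) hiy
    have hlx := min_lo _ hx
    have hzt := max_top _ hz
    have min_z' : ∀ j, L.X σ y j → z ≤ j := by
      rintro j (h | h)
      · exact min_z _ h
      · exact absurd h (no_in _)
    refine ⟨by rwa [lo_eq], by rw [Bool.not_not, hi_eq]; exact htop, ?_, ?_, ?_,
      fun h => by simp at h, fun _ => by omega⟩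
    · intro ρ
      rcases Bool.eq_or_eq_not ρ σ with rfl | rfl <;> omega
    · intro ρ k hk1 hk2
      rcases Bool.eq_or_eq_not ρ σ with rfl | rfl
      · rcases lt_or_ge k y with h1 | h1
        · exact con_below_next con hy next (by omega) (by omega)
        · exact con_in_fan hz htop h1 hk2
      · rcases lt_or_ge k x with h1 | h1
        · exact con_out_fan (by simpa using hlo) (by simpa using hx) hk1 h1
        · exact con_between hx max_x next con_x (.inl hz) min_z' h1 (by omega)
    · intro k l hX h1 h2 h3 h4
      by_contra hne
      have hlz : l ≠ z := by
        rintro rfl; exact hne (.inr (.inr ⟨rfl, hi_eq.symm⟩))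
      have hky : y ≤ k := by
        by_contra h; exact next k l (by omega) (by omega) hX
      rcases hky.lt_or_eq with h | rfl
      · exact absurd (L.nc (.inl hz) hX h) (by omega)
      · exact absurd (min_z' _ hX) (by omega)

end Ladder

/-! ### Extension of boxes to candidates, and the relative position of candidates. -/

namespace Ladder
variable {L : Ladder}

lemma _root_.Nat.exists_max_of_bounded {P : ℕ → Prop} {M : ℕ} (h : ∃ k, P k)
    (hM : ∀ k, P k → k < M) : ∃ m, P m ∧ ∀ k, P k → k ≤ m := by
  classical
  obtain ⟨k, hk⟩ := h
  exact ⟨Nat.findGreatest P M, Nat.findGreatest_spec (hM k hk).le hk,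
    fun l hl => Nat.le_findGreatest (hM l hl).le hl⟩

lemma _root_.Nat.exists_min {P : ℕ → Prop} (h : ∃ k, P k) : ∃ m, P m ∧ ∀ k, P k → m ≤ k := by
  classical
  exact ⟨Nat.find h, Nat.find_spec h, fun k hk => Nat.find_min' h hk⟩

/-- the function on `Bool` with the value `a` at `σ` and `b` at the other point -/
def sides (σ : Bool) (a b : ℕ) : Bool → ℕ := fun ρ => if ρ = σ then a else b

@[simp] lemma sides_self (σ : Bool) (a b : ℕ) : sides σ a b σ = a := by simp [sides]
@[simp] lemma sides_not (σ : Bool) (a b : ℕ) : sides σ a b (!σ) = b := by simp [sides]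

/-- The first edge across above the source lies between the bottom and the top edge, hence in the
box, so `chord` puts one of its ends at the sink. This identifies the sink as the one prescribed by
`Cand`. Taking the extreme neighbours of source and sink only enlarges the box. -/
lemma IsBox.exists_cand {σ τ : Bool} {lo hi : Bool → ℕ} (h : L.IsBox lo hi σ τ) :
    ∃ lo' hi', L.Cand σ (lo σ) lo' hi' τ ∧ ∀ ρ, lo' ρ ≤ lo ρ ∧ hi ρ ≤ hi' ρ := by
  have hbot := h.bot
  have htop := h.top
  have hle := h.le
  obtain ⟨x, hx, max_x⟩ := Nat.exists_max_of_bounded (M := L.N (!σ))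
    (P := fun j => L.E (σ, lo σ) (!σ, j)) ⟨_, hbot⟩ fun k hk => (L.dom hk).2
  obtain ⟨a, ha, min_a⟩ := Nat.exists_min (P := fun j => L.E (σ, lo σ) (!σ, j)) ⟨_, hbot⟩
  have hlx := max_x _ hbot
  have hal := min_a _ hbot
  rcases Bool.eq_or_eq_not τ σ with rfl | rfl
  · have hlen := h.same rfl
    obtain ⟨y, ⟨⟨hiy, l0, hl0⟩, ymin⟩⟩ := Nat.exists_min
      (P := fun y => lo τ < y ∧ ∃ l, L.X τ y l) ⟨hi τ, by omega, _, .inr htop⟩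
    have hyh : y ≤ hi τ := ymin _ ⟨by omega, _, .inr htop⟩
    have hy : y = hi τ := by
      by_contra hne
      have h1 := L.nc (.inl hbot) hl0 hiy
      have h2 := L.nc hl0 (.inr htop) (by omega)
      rcases h.chord y l0 hl0 (by omega) hyh h1 h2 with h | ⟨_, h⟩ | ⟨h, _⟩
      · omega
      · omega
      · simp at h
    subst hy
    obtain ⟨z, hz, min_z⟩ := Nat.exists_min (P := fun j => L.E (!τ, j) (τ, hi τ)) ⟨_, htop⟩
    obtain ⟨w, hw, max_w⟩ := Nat.exists_max_of_bounded (M := L.N (!τ))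
      (P := fun j => L.E (!τ, j) (τ, hi τ)) ⟨_, htop⟩ fun k hk => (L.dom hk).1
    have hzt := min_z _ htop
    have htw := max_w _ htop
    refine ⟨sides τ (lo τ) a, sides τ (hi τ) w,
      .mk_same x (hi τ) z (h.con _ _ le_rfl hiy) (by simp) hx max_x (by simpa)
        (by simpa) hiy (fun k l h1 h2 h3 => absurd (ymin k ⟨h1, l, h3⟩) (by omega))
        (fun hxz => h.con _ _ hlx (by omega)) hz min_z (by simp) hlen (by simpa) (by simpa), ?_⟩
    intro ρ
    rcases Bool.eq_or_eq_not ρ τ with rfl | rfl <;> simp [hal, htw]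
  · have hlen := h.opp rfl
    rw [Bool.not_not] at htop
    obtain ⟨y, ⟨⟨hiy, l0, hl0⟩, ymin⟩⟩ := Nat.exists_min
      (P := fun y => lo σ < y ∧ ∃ l, L.X σ y l) ⟨hi σ, by omega, _, .inl htop⟩
    have hyh : y ≤ hi σ := ymin _ ⟨by omega, _, .inl htop⟩
    obtain ⟨z, hz, min_z⟩ := Nat.exists_min (P := fun j => L.X σ y j) ⟨_, hl0⟩
    have h1 := L.nc (.inl hbot) hz hiy
    have h2 : z ≤ hi (!σ) := by
      rcases hyh.lt_or_eq with h | rfl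
      · exact L.nc hz (.inl htop) h
      · exact min_z _ (.inl htop)
    have hzj : z = hi (!σ) := by
      rcases h.chord y z hz hiy.le hyh h1 h2 with h | ⟨h, _⟩ | ⟨_, h⟩
      · omega
      · simp at h
      · exact h
    -- Such a `j` is at least as high as the sink, which is reachable from `y` along the side and
    -- the top edge: a cycle.
    have no_in : ∀ j, ¬ L.E (!σ, j) (σ, y) := by
      intro j hj
      have h3 := min_z _ (.inr hj)
      exact L.acyclic hj (((reach_of_con hyh fun k h1 h2 => h.con σ k (by omega) h2).tail
        htop).trans (L.tot (by omega) (L.dom hj).1))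
    subst hzj
    obtain ⟨w, hw, max_w⟩ := Nat.exists_max_of_bounded (M := L.N σ)
      (P := fun j => L.E (σ, j) (!σ, hi !σ)) ⟨_, htop⟩ fun k hk => (L.dom hk).1
    have htw := max_w _ htop
    refine ⟨sides σ (lo σ) a, sides σ w (hi !σ),
      .mk_opp x y (hi !σ) (h.con _ _ le_rfl hlen.1) (by simp) hx max_x (by simpa)
        (by simpa) hiy (fun k l h1 h2 h3 => absurd (ymin k ⟨h1, l, h3⟩) (by omega))
        (fun hxz => h.con _ _ hlx hxz) no_in (hz.resolve_right (no_in _))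
        (fun j hj => min_z _ (.inl hj)) (by simp) (by simpa using by omega) (by simpa)
        (by simpa), ?_⟩
    intro ρ
    rcases Bool.eq_or_eq_not ρ σ with rfl | rfl <;> simp [hal, htw]

/-- The bottom edge of a candidate is the last edge to its head. -/
lemma Cand.no_in_fan {σ τ : Bool} {i m : ℕ} {lo hi : Bool → ℕ} (h : L.Cand σ i lo hi τ)
    (him : i < m) (hm : L.E (σ, m) (!σ, lo !σ)) : False := by
  cases h with
  | mk_same x y z con lo_eq hx max_x hlo min_lo hiy next con_x hz min_z hi_eq len htop max_top =>
    have h1 := L.nc (.inl hx) (.inl hm) him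
    have h2 := L.nc (.inl hx) (.inr hz) hiy
    have h3 := min_lo _ hx
    have hym : y ≤ m := by
      by_contra h; exact next m _ him (by omega) (.inl hm)
    rcases hym.lt_or_eq with hym | rfl
    · have h4 := L.nc (.inr hz) (.inl hm) hym
      obtain rfl : z = lo !σ := by omega
      exact L.acyclic hz ((L.tot hym.le (L.dom hm).1).tail hm)
    · have := in_lt_out hz hm
      omega
  | mk_opp x y z con lo_eq hx max_x hlo min_lo hiy next con_x no_in hz min_z hi_eq len htop
      max_top =>
    have hym : y ≤ m := by
      by_contra h; exact next m _ him (by omega) (.inl hm)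
    rcases hym.lt_or_eq with hym | rfl
    · have h4 := L.nc (.inl hz) (.inl hm) hym
      omega
    · have := min_z _ hm
      omega

lemma X.le_or_le {σ : Bool} {i j k l : ℕ} (h : L.X σ i j) (h' : L.X σ k l) :
    (i ≤ k ∧ j ≤ l) ∨ (k ≤ i ∧ l ≤ j) := by
  rcases lt_trichotomy i k with h1 | h1 | h1
  · exact .inl ⟨h1.le, nc' h h' h1⟩
  · omega
  · exact .inr ⟨h1.le, nc' h' h h1⟩

lemma forall_side {P : Bool → Prop} (σ : Bool) (h : P σ) (h' : P (!σ)) (ρ : Bool) : P ρ := by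
  rcases Bool.eq_or_eq_not ρ σ with rfl | rfl <;> assumption

/-- Edges across are ordered, so either the top edge of the first box is below the bottom edge of
the second, which is the claim, or that bottom edge is a chord of the first box and touches its
source or its sink. At the source, it either starts there, and the sources agree, or ends there and
closes a cycle. At the sink, it cannot start there without closing a cycle. -/
lemma Cand.separated_aux {σ τ σ' τ' : Bool} {i i' : ℕ} {lo hi lo' hi' : Bool → ℕ}
    (h : L.Cand σ i lo hi τ) (h' : L.Cand σ' i' lo' hi' τ') (hne : (σ, i) ≠ (σ', i'))
    (hle : ∀ ρ, lo ρ ≤ lo' ρ) (ρ : Bool) : hi ρ ≤ lo' ρ := by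
  have hb := h.isBox
  have hb' := h'.isBox
  have e := h.lo_eq
  have e' := h'.lo_eq
  subst e e'
  have hX' : L.X σ (lo' σ) (lo' !σ) := by
    rcases Bool.eq_or_eq_not σ' σ with rfl | rfl
    · exact .inl hb'.bot
    · exact .inr (by simpa using hb'.bot)
  have hT : L.X σ (hi σ) (hi !σ) := by
    rcases Bool.eq_or_eq_not τ σ with rfl | rfl
    · exact .inr hb.top
    · exact .inl (by simpa using hb.top)
  rcases hT.le_or_le hX' with h1 | h1
  · exact forall_side (P := fun ρ => hi ρ ≤ lo' ρ) σ h1.1 h1.2 ρ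
  · by_cases hneq : lo' σ = hi σ ∧ lo' (!σ) = hi (!σ)
    · exact forall_side (P := fun ρ => hi ρ ≤ lo' ρ) σ hneq.1.ge hneq.2.ge ρ
    exfalso
    have reach_bot : L.Reach (σ, lo σ) (!σ, lo' !σ) :=
      .head hb.bot (reach_of_con (hle _) fun k h2 h3 => hb.con _ k h2 (by omega))
    have reach_top : ∀ ρ, L.Reach (ρ, lo' ρ) (ρ, hi ρ) := fun ρ =>
      reach_of_con (forall_side (P := fun ρ => lo' ρ ≤ hi ρ) σ h1.1 h1.2 ρ)
        fun k h2 h3 => hb.con _ k ((hle ρ).trans h2) h3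
    have htop := hb.top
    have hbot' := hb'.bot
    rcases hb.chord _ _ hX' (hle _) h1.1 (hle _) h1.2 with h2 | ⟨rfl, h2⟩ | ⟨rfl, h2⟩
    · rcases Bool.eq_or_eq_not σ' σ with rfl | rfl
      · exact hne (by rw [h2])
      · rw [Bool.not_not, h2] at hbot'
        exact L.acyclic hbot' reach_bot
    · rcases Bool.eq_or_eq_not σ' τ with rfl | rfl
      · exact L.acyclic hbot' ((reach_top _).trans (by rw [h2]; exact .single htop))
      -- The remaining possibility: the bottom edge of the second box ends at the sink of the first,
      -- and the top edge of the first is a higher edge to the same head.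
      · refine h'.no_in_fan (m := hi !τ) ?_ (by simpa [h2] using htop)
        omega
    · rcases Bool.eq_or_eq_not σ' σ with rfl | rfl
      · refine h'.no_in_fan (m := hi σ') ?_ (by simpa [h2] using htop)
        omega
      · rw [Bool.not_not] at htop hbot'
        exact L.acyclic hbot' ((reach_top _).trans (by rw [h2]; exact .single htop))

lemma IsBox.bot_X {σ τ : Bool} {lo hi : Bool → ℕ} (h : L.IsBox lo hi σ τ) (ρ : Bool) :
    L.X ρ (lo ρ) (lo !ρ) := by
  rcases Bool.eq_or_eq_not ρ σ with rfl | rfl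
  · exact .inl h.bot
  · exact .inr (by simpa using h.bot)

lemma Cand.separated {σ τ σ' τ' : Bool} {i i' : ℕ} {lo hi lo' hi' : Bool → ℕ}
    (h : L.Cand σ i lo hi τ) (h' : L.Cand σ' i' lo' hi' τ') (hne : (σ, i) ≠ (σ', i')) :
    (∀ ρ, hi ρ ≤ lo' ρ) ∨ ∀ ρ, hi' ρ ≤ lo ρ := by
  rcases (h.isBox.bot_X σ).le_or_le (h'.isBox.bot_X σ) with h1 | h1
  · exact .inl (h.separated_aux h' hne
      (forall_side (P := fun ρ => lo ρ ≤ lo' ρ) σ h1.1 h1.2))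
  · exact .inr (h'.separated_aux h hne.symm
      (forall_side (P := fun ρ => lo' ρ ≤ lo ρ) σ h1.1 h1.2))

lemma IsBox.source_reach {σ τ : Bool} {lo hi : Bool → ℕ} (h : L.IsBox lo hi σ τ) {ρ : Bool}
    {k : ℕ} (h1 : lo ρ ≤ k) (h2 : k ≤ hi ρ) : L.Reach (σ, lo σ) (ρ, k) := by
  have := reach_of_con h1 fun k h3 h4 => h.con ρ k h3 (h4.trans_le h2)
  rcases Bool.eq_or_eq_not ρ σ with rfl | rfl
  · exact this
  · exact .head h.bot this

lemma IsBox.reach_sink {σ τ : Bool} {lo hi : Bool → ℕ} (h : L.IsBox lo hi σ τ) {ρ : Bool}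
    {k : ℕ} (h1 : lo ρ ≤ k) (h2 : k ≤ hi ρ) : L.Reach (ρ, k) (τ, hi τ) := by
  have := reach_of_con h2 fun k h3 h4 => h.con ρ k (h1.trans h3) h4
  rcases Bool.eq_or_eq_not ρ τ with rfl | rfl
  · exact this
  · exact this.tail h.top

lemma IsBox.hi_lt {σ τ : Bool} {lo hi : Bool → ℕ} (h : L.IsBox lo hi σ τ) (ρ : Bool) :
    hi ρ < L.N ρ := by
  have := L.dom h.top
  rcases Bool.eq_or_eq_not ρ τ with rfl | rfl
  · exact this.2
  · exact this.1

/-- The sources of two candidates are comparable. -/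
lemma Cand.comparable {σ τ σ' τ' : Bool} {i i' : ℕ} {lo hi lo' hi' : Bool → ℕ}
    (h : L.Cand σ i lo hi τ) (h' : L.Cand σ' i' lo' hi' τ') :
    L.Reach (σ, i) (σ', i') ∨ L.Reach (σ', i') (σ, i) := by
  have hb := h.isBox.bot
  have hb' := h'.isBox.bot
  rw [h.lo_eq] at hb
  rw [h'.lo_eq] at hb'
  rcases Bool.eq_or_eq_not σ' σ with rfl | rfl
  · rcases le_total i i' with h1 | h1
    · exact .inl (L.tot h1 (L.dom hb').1)
    · exact .inr (L.tot h1 (L.dom hb).1)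
  · rw [Bool.not_not] at hb'
    rcases le_or_gt (lo !σ) i' with h1 | h1
    · exact .inl (.head hb (L.tot h1 (L.dom hb').1))
    · exact .inr (.head hb' (L.tot (L.nc (σ := !σ) (k := lo !σ) (l := i) (j := lo' σ) (i := i') (.inl (by simpa using hb'))
        (.inr (by simpa using hb)) h1) (L.dom hb).1))

/-! ### Incomparable vertices -/

/-- Take the first edge of the path that leaves side `ρ`. Heights bound its ends because the path
stays on `ρ` before it and ends at `l` after it. -/
lemma exists_cross {ρ : Bool} {k l : ℕ} (h : L.Reach (ρ, k) (!ρ, l)) :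
    ∃ a b, k ≤ a ∧ L.E (ρ, a) (!ρ, b) ∧ b ≤ l := by
  suffices ∀ x : Bool × ℕ, L.Reach x (!ρ, l) → x.1 = ρ →
      ∃ a b, x.2 ≤ a ∧ L.E (ρ, a) (!ρ, b) ∧ b ≤ l from this _ h rfl
  intro x hx
  induction hx using ReflTransGen.head_induction_on with
  | refl => intro h; simp at h
  | @head x y hxy hy ih =>
    obtain ⟨x1, x2⟩ := x
    obtain ⟨y1, y2⟩ := y
    rintro rfl
    rcases Bool.eq_or_eq_not y1 x1 with rfl | rfl
    · obtain ⟨a, b, h1, h2⟩ := ih rfl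
      exact ⟨a, b, (lt_of_E hxy).le.trans h1, h2⟩
    · exact ⟨x2, y2, le_rfl, hxy, le_of_reach hy⟩

/-- Neither vertex reaches the other one. -/
structure Incomp (L : Ladder) (σ : Bool) (i j : ℕ) : Prop where
  left : i < L.N σ
  right : j < L.N !σ
  not_lr : ¬ L.Reach (σ, i) (!σ, j)
  not_rl : ¬ L.Reach (!σ, j) (σ, i)

namespace Incomp
variable {σ : Bool} {i j : ℕ} (h : L.Incomp σ i j)
include h

/-- An edge across that starts at or above one vertex of the pair must end above the other, as it
would otherwise complete a path between them. The next three lemmas are the contrapositive and the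
mirror images. -/
lemma out_gt {a b : ℕ} (hab : L.E (σ, a) (!σ, b)) (hia : i ≤ a) : j < b := by
  by_contra hb
  exact h.not_lr ((L.tot hia (L.dom hab).1).trans (.head hab (L.tot (not_lt.1 hb) h.right)))

lemma in_lt {a b : ℕ} (hab : L.E (σ, a) (!σ, b)) (hbj : b ≤ j) : a < i := by
  by_contra hb
  exact absurd (h.out_gt hab (not_lt.1 hb)) (by omega)

lemma out_gt' {a b : ℕ} (hab : L.E (!σ, b) (σ, a)) (hia : j ≤ b) : i < a := by
  by_contra hb
  exact h.not_rl ((L.tot hia (L.dom hab).1).trans (.head hab (L.tot (not_lt.1 hb) h.left)))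

lemma in_lt' {a b : ℕ} (hab : L.E (!σ, b) (σ, a)) (hai : a ≤ i) : b < j := by
  by_contra hb
  exact absurd (h.out_gt' hab (not_lt.1 hb)) (by omega)

/-- The root reaches the vertex of the pair that is on the other side, and the edge by which the
path leaves the root's side lies below the pair. -/
lemma exists_lower : ∃ a b, L.X σ a b ∧ a ≤ i ∧ b ≤ j := by
  obtain ⟨⟨ρ, k⟩, hs⟩ := L.root
  rcases Bool.eq_or_eq_not ρ σ with rfl | rfl
  · obtain ⟨a, b, h1, h2, h3⟩ := exists_cross (hs (!ρ, j) h.right)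
    exact ⟨a, b, .inl h2, (h.in_lt h2 h3).le, h3⟩
  · obtain ⟨b, a, h1, h2, h3⟩ := exists_cross (ρ := !σ) (l := i) (by simpa using hs (σ, i) h.left)
    rw [Bool.not_not] at h2
    exact ⟨a, b, .inr h2, h3, (h.in_lt' h2 h3).le⟩

lemma exists_upper : ∃ a b, L.X σ a b ∧ i ≤ a ∧ j ≤ b := by
  obtain ⟨⟨ρ, k⟩, hs⟩ := L.top
  rcases Bool.eq_or_eq_not ρ σ with rfl | rfl
  · obtain ⟨b, a, h1, h2, h3⟩ := exists_cross (ρ := !ρ) (l := k) (by simpa using hs (!ρ, j) h.right)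
    rw [Bool.not_not] at h2
    exact ⟨a, b, .inr h2, (h.out_gt' h2 h1).le, h1⟩
  · obtain ⟨a, b, h1, h2, h3⟩ := exists_cross (ρ := σ) (hs (σ, i) h.left)
    exact ⟨a, b, .inl h2, h1, (h.out_gt h2 h1).le⟩

omit h in
-- Maximize the sum of the two heights: since edges across are totally ordered, this maximizes both.
lemma exists_max_lower (h : ∃ a b, L.X σ a b ∧ a ≤ i ∧ b ≤ j) :
    ∃ a b, L.X σ a b ∧ a ≤ i ∧ b ≤ j ∧ ∀ k l, L.X σ k l → k ≤ i → l ≤ j → k ≤ a ∧ l ≤ b := by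
  obtain ⟨m, ⟨a, b, h1, h2, h3, rfl⟩, hm⟩ := Nat.exists_max_of_bounded (M := i + j + 1)
    (P := fun m => ∃ a b, L.X σ a b ∧ a ≤ i ∧ b ≤ j ∧ m = a + b)
    (by obtain ⟨a, b, h⟩ := h; exact ⟨a + b, a, b, h.1, h.2.1, h.2.2, rfl⟩)
    (by rintro _ ⟨a, b, h⟩; omega)
  refine ⟨a, b, h1, h2, h3, fun k l h4 h5 h6 => ?_⟩
  have := hm _ ⟨k, l, h4, h5, h6, rfl⟩
  rcases h1.le_or_le h4 with h | h <;> omega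

omit h in
lemma exists_min_upper (h : ∃ a b, L.X σ a b ∧ i ≤ a ∧ j ≤ b) :
    ∃ a b, L.X σ a b ∧ i ≤ a ∧ j ≤ b ∧ ∀ k l, L.X σ k l → i ≤ k → j ≤ l → a ≤ k ∧ b ≤ l := by
  obtain ⟨m, ⟨a, b, h1, h2, h3, rfl⟩, hm⟩ := Nat.exists_min
    (P := fun m => ∃ a b, L.X σ a b ∧ i ≤ a ∧ j ≤ b ∧ m = a + b)
    (by obtain ⟨a, b, h⟩ := h; exact ⟨a + b, a, b, h.1, h.2.1, h.2.2, rfl⟩)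
  refine ⟨a, b, h1, h2, h3, fun k l h4 h5 h6 => ?_⟩
  have := hm _ ⟨k, l, h4, h5, h6, rfl⟩
  rcases h1.le_or_le h4 with h | h <;> omega

/-- If all edges that straddle the pair are attached to it, then there is a box. -/
lemma exists_box_of_straddle
    (hA : ∀ a b, L.E (σ, a) (!σ, b) → a < i → j < b → L.Reach (σ, i) (!σ, b))
    (hB : ∀ a b, L.E (!σ, b) (σ, a) → i < a → b < j → L.Reach (!σ, b) (σ, i)) :
    ∃ lo hi σ' τ', L.IsBox lo hi σ' τ' ∧ lo σ ≤ i ∧ i ≤ hi σ := by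
  obtain ⟨a, b, hab, hai, hbj, hlow⟩ := exists_max_lower h.exists_lower
  obtain ⟨c, d, hcd, hic, hjd, hup⟩ := exists_min_upper h.exists_upper
  -- A gap at `k` yields an out-edge across at `k`, or an in-edge across at `k + 1`. For `k ≥ i` the
  -- former lies above the pair and hence not below `(c, d)`; for `k < i` the latter lies below the
  -- pair and hence not above `(a, b)`.
  have hconσ : ∀ k, a ≤ k → k < c → L.con σ k := by
    intro k h1 h2
    have hk : k + 1 < L.N σ := lt_of_le_of_lt h2 hcd.dom.1
    rcases le_or_gt i k with h3 | h3
    · rcases con_or_out hk with h4 | ⟨l, h4, _⟩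
      · exact h4
      · have := hup _ _ (.inl h4) h3 (h.out_gt h4 h3).le
        omega
    · rcases con_or_in hk with h4 | ⟨l, h4, _⟩
      · exact h4
      · have := hlow _ _ (.inr h4) h3 (h.in_lt' h4 h3).le
        omega
  have hconτ : ∀ k, b ≤ k → k < d → L.con (!σ) k := by
    intro k h1 h2
    have hk : k + 1 < L.N (!σ) := lt_of_le_of_lt h2 hcd.dom.2
    rcases le_or_gt j k with h3 | h3
    · rcases con_or_out hk with h4 | ⟨l, h4, _⟩
      · exact h4
      · rw [Bool.not_not] at h4
        have := hup _ _ (.inr h4) (h.out_gt' h4 h3).le h3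
        omega
    · rcases con_or_in hk with h4 | ⟨l, h4, _⟩
      · exact h4
      · rw [Bool.not_not] at h4
        have := hlow _ _ (.inl h4) (h.in_lt h4 h3).le h3
        omega
  -- An edge that does not straddle the pair is an extreme one. For a straddling edge, the path of
  -- `hA` or `hB` contains an edge across above or below the pair, and comparison with the extreme
  -- edges places the head of the straddling edge at the head of the upper edge, or its tail at the
  -- tail of the lower edge.
  have hchord : ∀ k l, L.X σ k l → a ≤ k → k ≤ c → b ≤ l → l ≤ d →
      (k = a ∧ l = b) ∨ (k = c ∧ l = d) ∨ (L.E (σ, c) (!σ, d) ∧ l = d) ∨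
      (L.E (!σ, b) (σ, a) ∧ l = b) := by
    intro k l hkl h1 h2 h3 h4
    by_cases h5 : k ≤ i <;> by_cases h6 : l ≤ j
    · have := hlow _ _ hkl h5 h6
      omega
    · rcases hkl with hkl | hkl
      · rcases eq_or_lt_of_le h5 with rfl | h5
        · have := hup _ _ (.inl hkl) le_rfl (by omega)
          omega
        obtain ⟨c', b', h7, h8, h9⟩ := exists_cross (hA _ _ hkl h5 (by omega))
        have := hup _ _ (.inl h8) h7 (h.out_gt h8 h7).le
        obtain rfl : l = d := by omega
        obtain rfl : b' = l := by omega
        refine .inr (.inr (.inl ⟨hcd.resolve_right fun h10 => ?_, rfl⟩))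
        exact L.acyclic h10 ((L.tot this.1 (L.dom h8).1).tail h8)
      · exact absurd (h.out_gt' hkl (by omega)) (by omega)
    · rcases hkl with hkl | hkl
      · exact absurd (h.out_gt hkl (by omega)) (by omega)
      · rcases eq_or_lt_of_le h6 with rfl | h6
        · have := hup _ _ (.inr hkl) (by omega) le_rfl
          omega
        obtain ⟨b', a', h7, h8, h9⟩ := exists_cross (ρ := !σ) (l := i)
          (by simpa using hB _ _ hkl (by omega) h6)
        rw [Bool.not_not] at h8
        have := hlow _ _ (.inr h8) h9 (h.in_lt' h8 h9).le
        obtain rfl : l = b := by omega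
        obtain rfl : b' = l := by omega
        refine .inr (.inr (.inr ⟨hab.resolve_left fun h10 => ?_, rfl⟩))
        exact L.acyclic h10 (.head h8 (L.tot this.1 (L.dom h10).1))
    · have := hup _ _ hkl (by omega) (by omega)
      omega
  have hle : ∀ ρ, sides σ a b ρ ≤ sides σ c d ρ := fun ρ => by
    rcases Bool.eq_or_eq_not ρ σ with rfl | rfl <;> simp <;> omega
  have hcon : ∀ ρ k, sides σ a b ρ ≤ k → k < sides σ c d ρ → L.con ρ k := fun ρ => by
    rcases Bool.eq_or_eq_not ρ σ with rfl | rfl <;> simpa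
  have contra1 : L.E (σ, c) (!σ, d) → ¬ L.E (!σ, d) (σ, c) := fun h1 h2 =>
    L.acyclic h1 (.single h2)
  have contra2 : L.E (σ, a) (!σ, b) → ¬ L.E (!σ, b) (σ, a) := fun h1 h2 =>
    L.acyclic h1 (.single h2)
  have fin : ∀ k l, L.X σ k l → a ≤ k → k ≤ c → b ≤ l → l ≤ d →
      ((L.E (σ, a) (!σ, b) ∧ k = a) ∨ (L.E (!σ, b) (σ, a) ∧ l = b)) ∨
      ((L.E (σ, c) (!σ, d) ∧ l = d) ∨ (L.E (!σ, d) (σ, c) ∧ k = c)) := by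
    intro k l h0 h1 h2 h3 h4
    rcases hchord k l h0 h1 h2 h3 h4 with h5 | h5 | h5 | h5
    · rcases hab with h6 | h6 <;> simp [h5, h6]
    · rcases hcd with h6 | h6 <;> simp [h5, h6]
    · exact .inr (.inl h5)
    · exact .inl (.inr h5)
  -- The tail of the lower edge is the source and the head of the upper edge is the sink; the four
  -- combinations of directions give the four kinds of boxes.
  rcases hab with hab | hab <;> rcases hcd with hcd | hcd
  · have h1 := h.in_lt hab hbj
    have h2 := h.out_gt hcd hic
    refine ⟨sides σ a b, sides σ c d, σ, !σ, ⟨by simpa, by simpa, hle, hcon, ?_, by simp, ?_⟩, by simpa, by simpa⟩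
    · intro k l h0; simp only [sides_self, sides_not]; intro h1 h2 h3 h4
      have := fin k l h0 h1 h2 h3 h4
      have := contra1 hcd; have := contra2 hab
      simp; tauto
    · simp; omega
  · have h1 := h.in_lt hab hbj
    have h2 := h.out_gt' hcd hjd
    refine ⟨sides σ a b, sides σ c d, σ, σ, ⟨by simpa, by simpa, hle, hcon, ?_, ?_, by simp⟩, by simpa, by simpa⟩
    · intro k l h0; simp only [sides_self, sides_not]; intro h1 h2 h3 h4
      have := fin k l h0 h1 h2 h3 h4
      have := mt contra1 (not_not.2 hcd); have := contra2 hab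
      simp; tauto
    · simp; omega
  · have h1 := h.in_lt' hab hai
    have h2 := h.out_gt hcd hic
    refine ⟨sides σ a b, sides σ c d, !σ, !σ, ⟨by simpa, by simpa, hle, hcon, ?_, ?_, by simp⟩, by simpa, by simpa⟩
    · intro l k h0; simp only [sides_self, sides_not, Bool.not_not]; intro h1 h2 h3 h4
      have := fin k l (X_not.1 h0) h3 h4 h1 h2
      have := contra1 hcd; have := mt contra2 (not_not.2 hab)
      simp; tauto
    · simp; omega
  · have h1 := h.in_lt' hab hai
    have h2 := h.out_gt' hcd hjd
    refine ⟨sides σ a b, sides σ c d, !σ, σ, ⟨by simpa, by simpa, hle, hcon, ?_, by simp, ?_⟩, by simpa, by simpa⟩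
    · intro l k h0; simp only [sides_self, sides_not, Bool.not_not]; intro h1 h2 h3 h4
      have := fin k l (X_not.1 h0) h3 h4 h1 h2
      have := mt contra1 (not_not.2 hcd); have := mt contra2 (not_not.2 hab)
      simp; tauto
    · simp; omega

end Incomp

open Classical in
/-- the edges across that straddle the pair -/
noncomputable def straddlers (L : Ladder) (σ : Bool) (i j : ℕ) : Finset (ℕ × ℕ) :=
  (Finset.range (L.N σ) ×ˢ Finset.range (L.N !σ)).filter fun e =>
    L.X σ e.1 e.2 ∧ ((e.1 < i ∧ j < e.2) ∨ (i < e.1 ∧ e.2 < j))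

lemma mem_straddlers {σ : Bool} {i j : ℕ} {e : ℕ × ℕ} : e ∈ L.straddlers σ i j ↔
    L.X σ e.1 e.2 ∧ ((e.1 < i ∧ j < e.2) ∨ (i < e.1 ∧ e.2 < j)) := by
  simp only [straddlers, Finset.mem_filter, Finset.mem_product, Finset.mem_range,
    and_iff_right_iff_imp]
  exact fun h => h.1.dom

/-- A vertex that is incomparable to some vertex is in a box. -/
lemma Incomp.exists_box {σ : Bool} {i j : ℕ} (h : L.Incomp σ i j) :
    ∃ lo hi σ' τ', L.IsBox lo hi σ' τ' ∧ lo σ ≤ i ∧ i ≤ hi σ := by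
  induction hm : (L.straddlers σ i j).card using Nat.strong_induction_on generalizing j with
  | _ m ih =>
    by_contra hno
    refine hno (h.exists_box_of_straddle ?_ ?_)
    · intro a b hab hai hjb
      by_contra hr
      -- Moving `j` up to `b` keeps the pair incomparable. The edge from `a` to `b` no longer
      -- straddles it, and by noncrossing no new edge does.
      have h' : L.Incomp σ i b := ⟨h.left, (L.dom hab).2, hr, fun h1 =>
        h.not_rl ((L.tot hjb.le (L.dom hab).2).trans h1)⟩
      refine hno (ih _ ?_ h' rfl)
      rw [← hm]
      refine Finset.card_lt_card (Finset.ssubset_iff_of_subset ?_ |>.2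
        ⟨(a, b), mem_straddlers.2 ⟨.inl hab, .inl ⟨hai, hjb⟩⟩, fun h1 => ?_⟩)
      · intro e he
        rw [mem_straddlers] at he ⊢
        refine ⟨he.1, he.2.imp (fun h1 => by omega) fun h1 => ?_⟩
        have := L.nc (.inl hab) he.1 (by omega)
        omega
      · have := (mem_straddlers.1 h1).2
        simp at this
    · intro a b hab hai hjb
      by_contra hr
      have h' : L.Incomp σ i b := ⟨h.left, (L.dom hab).1, fun h1 =>
        h.not_lr (h1.trans (L.tot hjb.le h.right)), hr⟩
      refine hno (ih _ ?_ h' rfl)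
      rw [← hm]
      refine Finset.card_lt_card (Finset.ssubset_iff_of_subset ?_ |>.2
        ⟨(a, b), mem_straddlers.2 ⟨.inr hab, .inr ⟨hai, hjb⟩⟩, fun h1 => ?_⟩)
      · intro e he
        rw [mem_straddlers] at he ⊢
        refine ⟨he.1, he.2.imp (fun h1 => ?_) fun h1 => by omega⟩
        have := L.nc he.1 (.inr hab) (by omega)
        omega
      · have := (mem_straddlers.1 h1).2
        simp at this

/-- A vertex in no candidate is comparable to every other vertex. -/
lemma comparable_of_not_cand {x y : Bool × ℕ} (hx : x.2 < L.N x.1) (hy : y.2 < L.N y.1)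
    (h : ∀ σ i lo hi τ, L.Cand σ i lo hi τ → ¬ (lo x.1 ≤ x.2 ∧ x.2 ≤ hi x.1)) :
    L.Reach x y ∨ L.Reach y x := by
  obtain ⟨σ, i⟩ := x
  obtain ⟨σ', j⟩ := y
  rcases Bool.eq_or_eq_not σ' σ with rfl | rfl
  · exact (le_total i j).imp (fun h1 => L.tot h1 hy) fun h1 => L.tot h1 hx
  · by_contra! hno
    obtain ⟨lo, hi, σ', τ', hb, h1, h2⟩ := Incomp.exists_box ⟨hx, hy, hno.1, hno.2⟩
    obtain ⟨lo', hi', hc, h3⟩ := hb.exists_cand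
    exact h _ _ _ _ _ hc ⟨(h3 σ).1.trans h1, h2.trans (h3 σ).2⟩

end Ladder

/-! ## Drawings in convex position -/

lemma orient_rotate (a b c : ℝ × ℝ) : orient b c a = orient a b c := by unfold orient; ring

lemma orient_swap (a b c : ℝ × ℝ) : orient b a c = -orient a b c := by unfold orient; ring

lemma orient_self_left (a b : ℝ × ℝ) : orient a b a = 0 := by unfold orient; ring

lemma orient_self_right (a b : ℝ × ℝ) : orient a b b = 0 := by unfold orient; ring

lemma orient_combo (a b c d : ℝ × ℝ) {α β : ℝ} (h : α + β = 1) :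
    orient a b (α • c + β • d) = α * orient a b c + β * orient a b d := by
  obtain rfl : α = 1 - β := by linarith
  simp only [orient, Prod.fst_add, Prod.snd_add, Prod.smul_fst, Prod.smul_snd, smul_eq_mul]
  ring

/-- The weights are those with which the affine function `orient c d` vanishes on the first segment,
and `orient a b` on the second. By `hS` they have a common denominator. -/
lemma segments_meet {a b c d : ℝ × ℝ} (h1 : 0 < orient a b c) (h2 : orient a b d < 0)
    (h3 : 0 < orient c d b) (h4 : orient c d a < 0) :
    (segment ℝ a b ∩ segment ℝ c d).Nonempty := by
  have hS : orient a b c - orient a b d = orient c d b - orient c d a := by unfold orient; ring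
  have hS0 : 0 < orient a b c - orient a b d := by linarith
  refine ⟨(orient c d b / (orient a b c - orient a b d)) • a +
    (-orient c d a / (orient a b c - orient a b d)) • b, ⟨_, _, ?_, ?_, ?_, rfl⟩,
    (-orient a b d / (orient a b c - orient a b d)),
    (orient a b c / (orient a b c - orient a b d)), ?_, ?_, ?_, ?_⟩
  · positivity
  · exact div_nonneg (by linarith) hS0.le
  · rw [← add_div, div_eq_one_iff_eq hS0.ne']; linarith
  · exact div_nonneg (by linarith) hS0.le
  · positivity
  · rw [← add_div, div_eq_one_iff_eq hS0.ne']; linarith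
  · ext
    · simp only [Prod.fst_add, Prod.smul_fst, smul_eq_mul]
      field_simp
      unfold orient; ring
    · simp only [Prod.snd_add, Prod.smul_snd, smul_eq_mul]
      field_simp
      unfold orient; ring

/-- `pt 0, …, pt (n - 1)` are all vertices, in counterclockwise order along the boundary of a
strictly convex polygon. -/
structure Placement {V : Type*} (p : V → ℝ × ℝ) (n : ℕ) (pt : ℕ → V) : Prop where
  inj : ∀ {i j}, i < n → j < n → pt i = pt j → i = j
  surj : ∀ v, ∃ i < n, pt i = v
  ori : ∀ {i j k}, i < j → j < k → k < n → 0 < orient (p (pt i)) (p (pt j)) (p (pt k))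

namespace Placement
variable {V : Type*} {p : V → ℝ × ℝ} {n : ℕ} {pt : ℕ → V}

/-- adjacency in the undirected graph -/
def U (H : V → V → Prop) (a b : V) : Prop := H a b ∨ H b a

lemma U.symm {H : V → V → Prop} {a b : V} (h : U H a b) : U H b a := Or.symm h

lemma not_cross (hp : Placement p n pt) {H : Digraph V} {W : Finset V}
    (planar : ∀ a ∈ W, ∀ b ∈ W, ∀ c ∈ W, ∀ d ∈ W, H.Adj a b → H.Adj c d → (a, b) ≠ (c, d) →
      segment ℝ (p a) (p b) ∩ segment ℝ (p c) (p d) ⊆ p '' (({a, b} : Set V) ∩ {c, d}))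
    {i j k l : ℕ} (hik : i < k) (hkj : k < j) (hjl : j < l) (hl : l < n)
    (hi : pt i ∈ W) (hj : pt j ∈ W) (hk : pt k ∈ W) (hl' : pt l ∈ W)
    (h : U H.Adj (pt i) (pt j)) (h' : U H.Adj (pt k) (pt l)) : False := by
  have hne : ∀ {x y}, x < y → y < n → pt x ≠ pt y := fun hxy hy h =>
    hxy.ne (hp.inj (hxy.trans hy) hy h)
  have meet : (segment ℝ (p (pt i)) (p (pt j)) ∩ segment ℝ (p (pt k)) (p (pt l))).Nonempty := by
    have h1 := hp.ori hik hkj (hjl.trans hl)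
    have h2 := hp.ori (hik.trans hkj) hjl hl
    have h3 := hp.ori hkj hjl hl
    have h4 := hp.ori hik (hkj.trans hjl) hl
    rw [segment_symm ℝ (p (pt i))]
    apply segments_meet
    · rw [orient_swap, ← orient_rotate, orient_swap]; rw [orient_rotate]; linarith
    · rw [orient_swap]; linarith
    · rw [orient_rotate]; linarith
    · have := orient_swap (p (pt l)) (p (pt k)) (p (pt j))
      have := orient_rotate (p (pt k)) (p (pt j)) (p (pt l))
      have := orient_rotate  (p (pt j)) (p (pt l))  (p (pt k))
      linarith
  obtain ⟨x, hx⟩ := meet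
  have d1 := hne hik (hkj.trans (hjl.trans hl))
  have d2 := hne ((hik.trans hkj).trans hjl) hl
  have d3 := hne hkj (hjl.trans hl)
  have d4 := hne hjl hl
  have disj : (({pt i, pt j} : Set V) ∩ {pt k, pt l}) = ∅ := by
    ext y
    simp only [Set.mem_inter_iff, Set.mem_insert_iff, Set.mem_singleton_iff, Set.mem_empty_iff_false,
      iff_false]
    rintro ⟨rfl | rfl, h | h⟩
    · exact d1 h
    · exact d2 h
    · exact d3 h.symm
    · exact d4 h
  rcases h with h | h <;> rcases h' with h' | h'
  · have := planar _ hi _ hj _ hk _ hl' h h' (by simp [d1]) hx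
    simp [disj] at this
  · have := planar _ hi _ hj _ hl' _ hk h h' (by simp [d2]) (by rwa [segment_symm ℝ (p (pt l))])
    simp [Set.pair_comm (pt l), disj] at this
  · have := planar _ hj _ hi _ hk _ hl' h h' (by simp [d3.symm]) (by rwa [segment_symm ℝ (p (pt j))])
    simp [Set.pair_comm (pt j), disj] at this
  · have := planar _ hj _ hi _ hl' _ hk h h' (by simp [d4])
      (by rwa [segment_symm ℝ (p (pt j)), segment_symm ℝ (p (pt l))])
    simp [Set.pair_comm (pt j), Set.pair_comm (pt l), disj] at this

end Placement

/-! ### Walks that are separated by a chord -/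

section Walks

variable {R : ℕ → ℕ → Prop}

/-- The edges of `R`, drawn as chords of a convex polygon, do not cross. -/
def Noncrossing (R : ℕ → ℕ → Prop) : Prop :=
  ∀ i k j l, i < k → k < j → j < l → Placement.U R i j → Placement.U R k l → False

/-- The chord `x y` separates the positions `a` and `b`. -/
def Separates (x y a b : ℕ) : Prop :=
  a ≠ x ∧ a ≠ y ∧ b ≠ x ∧ b ≠ y ∧ ((min x y < a ∧ a < max x y) ↔ ¬ (min x y < b ∧ b < max x y))

lemma Separates.comm {x y a b : ℕ} (h : Separates x y a b) : Separates a b x y := by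
  unfold Separates at *
  omega

lemma Noncrossing.not_separates (h : Noncrossing R) {x y a b : ℕ} (hxy : Placement.U R x y)
    (hab : Placement.U R a b) : ¬ Separates x y a b := by
  intro hs
  unfold Separates at hs
  rcases le_total x y with h1 | h1 <;> rcases le_total a b with h2 | h2 <;>
    simp only [h1, min_eq_left, min_eq_right, max_eq_left, max_eq_right] at hs
  · by_cases h3 : x < a
    · exact h x a y b h3 (by omega) (by omega) hxy hab
    · exact h a x b y (by omega) (by omega) (by omega) hab hxy
  · by_cases h3 : x < b
    · exact h x b y a h3 (by omega) (by omega) hxy hab.symm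
    · exact h b x a y (by omega) (by omega) (by omega) hab.symm hxy
  · by_cases h3 : y < a
    · exact h y a x b h3 (by omega) (by omega) hxy.symm hab
    · exact h a y b x (by omega) (by omega) (by omega) hab hxy.symm
  · by_cases h3 : y < b
    · exact h y b x a h3 (by omega) (by omega) hxy.symm hab.symm
    · exact h b y a x (by omega) (by omega) (by omega) hab.symm hxy.symm

/-- A walk between positions separated by an edge passes through an end of that edge. -/
lemma Noncrossing.walk_hits (h : Noncrossing R) {x y a c : ℕ} (hxy : Placement.U R x y)
    (hs : Separates x y a c) (hac : ReflTransGen R a c) :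
    ∃ w, (w = x ∨ w = y) ∧ ReflTransGen R a w ∧ ReflTransGen R w c := by
  induction hac using ReflTransGen.head_induction_on with
  | refl => unfold Separates at hs; omega
  | @head a b hab hbc ih =>
    by_cases hb : b = x ∨ b = y
    · exact ⟨b, hb, .single hab, hbc⟩
    · have h1 := h.not_separates hxy (.inl hab)
      obtain ⟨w, h2, h3, h4⟩ := ih (by unfold Separates at *; omega)
      exact ⟨w, h2, .head hab h3, h4⟩

/-- Two walks with interleaved ends meet. -/
lemma Noncrossing.walks_meet (h : Noncrossing R) {a b c d : ℕ} (hs : Separates a c b d)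
    (hac : ReflTransGen R a c) (hbd : ReflTransGen R b d) :
    ∃ w, ReflTransGen R a w ∧ ReflTransGen R w c ∧ ReflTransGen R b w ∧ ReflTransGen R w d := by
  induction hbd using ReflTransGen.head_induction_on with
  | refl => unfold Separates at hs; omega
  | @head b b' hbb' hb'd ih =>
    by_cases hb : b' = a ∨ b' = c
    · rcases hb with rfl | rfl
      · exact ⟨b', .refl, hac, .single hbb', hb'd⟩
      · exact ⟨b', hac, .refl, .single hbb', hb'd⟩
    -- Either the edge from `b` to `b'` separates `a` from `c`, and the first walk passes one of its
    -- ends, or `b'` is on the same side of `a c` as `b`.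
    · by_cases h1 : Separates a c b b'
      · obtain ⟨w, hw, h2, h3⟩ := h.walk_hits (.inl hbb') h1.comm hac
        rcases hw with rfl | rfl
        · exact ⟨w, h2, h3, .refl, .head hbb' hb'd⟩
        · exact ⟨w, h2, h3, .single hbb', hb'd⟩
      · obtain ⟨w, h2, h3, h4, h5⟩ := ih (by unfold Separates at *; omega)
        exact ⟨w, h2, h3, .head hbb' h4, h5⟩

end Walks

/-- In a finite acyclic digraph with a single source, every vertex is reachable from it. -/
lemma reach_of_unique_source {V : Type*} [Finite V] {r : V → V → Prop} {W : Finset V} {s : V}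
    (hr : ∀ v, ¬ TransGen r v v) (hW : ∀ a b, r a b → a ∈ W)
    (hs : ∀ x ∈ W, (∀ y, ¬ r y x) → x = s) : ∀ x ∈ W, ReflTransGen r s x := by
  have hwf : WellFounded (TransGen r) := by
    have : Std.Irrefl (TransGen r) := ⟨hr⟩
    exact Finite.wellFounded_of_trans_of_irrefl _
  intro x
  induction x using hwf.induction with
  | _ x ih =>
    intro hx
    by_cases h : ∀ y, ¬ r y x
    · rw [hs x hx h]
    · push Not at h
      obtain ⟨y, hy⟩ := h
      exact (ih y (.single hy) (hW _ _ hy)).tail hy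

/-- An outerplanar st-digraph whose vertices are `pt 0, …, pt (n - 1)` in counterclockwise order,
beginning with the source; the sink is `pt T`. -/
structure Drawing {V : Type*} [Fintype V] (p : V → ℝ × ℝ) (G : Digraph V) (n T : ℕ)
    (pt : ℕ → V) : Prop extends Placement p n pt where
  lt : T < n
  outerplanar : IsOuterplanarSTDigraph p G Finset.univ (pt 0) (pt T)

/-! ### The ladder of a drawing. -/

namespace Drawing

/-- the position on the external boundary of a vertex given by its side and height -/
def pos (n : ℕ) (x : Bool × ℕ) : ℕ := if x.1 then n - 1 - x.2 else x.2

/-- The right chain occupies the positions `0, …, T - 1`, the left one the positions `n - 1, …, T`,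
both read upwards. So the sink always counts as the top of the left chain, and the source as the
bottom of the right one if `T > 0`. -/
def coord (n T q : ℕ) : Bool × ℕ := if q < T then (false, q) else (true, n - 1 - q)

def len (n T : ℕ) (ρ : Bool) : ℕ := if ρ then n - T else T

@[simp] lemma pos_true (n i : ℕ) : pos n (true, i) = n - 1 - i := rfl
@[simp] lemma pos_false (n i : ℕ) : pos n (false, i) = i := rfl
@[simp] lemma len_true (n T : ℕ) : len n T true = n - T := rfl
@[simp] lemma len_false (n T : ℕ) : len n T false = T := rfl

variable {V : Type*} [Fintype V] {p : V → ℝ × ℝ} {G : Digraph V} {n T : ℕ} {pt : ℕ → V}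

lemma pos_lt (hT : T < n) {x : Bool × ℕ} (hx : x.2 < len n T x.1) : pos n x < n := by
  obtain ⟨_ | _, i⟩ := x <;> simp at * <;> omega

lemma coord_pos (hT : T < n) {x : Bool × ℕ} (hx : x.2 < len n T x.1) :
    coord n T (pos n x) = x := by
  obtain ⟨_ | _, i⟩ := x
  · exact if_pos hx
  · simp only [len_true] at hx
    rw [coord, pos_true, if_neg (by omega)]
    congr 1
    omega

lemma pos_coord {q : ℕ} (hq : q < n) : pos n (coord n T q) = q := by
  unfold coord
  split_ifs <;> simp
  omega

lemma coord_dom {q : ℕ} (hq : q < n) : (coord n T q).2 < len n T (coord n T q).1 := by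
  unfold coord
  split_ifs <;> simp <;> omega

lemma pos_inj (hT : T < n) {x y : Bool × ℕ} (hx : x.2 < len n T x.1) (hy : y.2 < len n T y.1)
    (h : pos n x = pos n y) : x = y := by
  rw [← coord_pos hT hx, h, coord_pos hT hy]

/-- the edges, as a relation on positions -/
def posAdj (G : Digraph V) (n : ℕ) (pt : ℕ → V) (i j : ℕ) : Prop :=
  i < n ∧ j < n ∧ G.Adj (pt i) (pt j)

variable (D : Drawing p G n T pt)
include D

lemma noncrossing : Noncrossing (posAdj G n pt) := by
  intro i k j l hik hkj hjl h h'
  have hl : l < n := by rcases h' with h' | h' <;> [exact h'.2.1; exact h'.1]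
  refine D.not_cross D.outerplanar.planar hik hkj hjl hl (Finset.mem_univ _) (Finset.mem_univ _)
    (Finset.mem_univ _) (Finset.mem_univ _) (h.imp (·.2.2) (·.2.2)) (h'.imp (·.2.2) (·.2.2))

omit D in
lemma transGen_univ {a b : V} (h : TransGen G.Adj a b) :
    TransGen (fun a b => a ∈ Finset.univ ∧ b ∈ Finset.univ ∧ G.Adj a b) a b :=
  TransGen.mono (r := G.Adj) (fun _ _ h => ⟨Finset.mem_univ _, Finset.mem_univ _, h⟩) _ _ h

lemma acyclic {a b : V} (h : G.Adj a b) : ¬ ReflTransGen G.Adj b a := fun h' =>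
  D.outerplanar.acyclic a (transGen_univ (TransGen.head' h h'))

lemma exists_posAdj {i : ℕ} {b : V} (h : G.Adj (pt i) b) (hi : i < n) :
    ∃ j, pt j = b ∧ posAdj G n pt i j := by
  obtain ⟨j, hj, rfl⟩ := D.surj b
  exact ⟨j, rfl, hi, hj, h⟩

lemma posAdj_of_reach {i j : ℕ} (hi : i < n) (hj : j < n)
    (h : ReflTransGen G.Adj (pt i) (pt j)) : ReflTransGen (posAdj G n pt) i j := by
  suffices ∀ a, ReflTransGen G.Adj a (pt j) → ∀ i < n, pt i = a →
      ReflTransGen (posAdj G n pt) i j from this _ h i hi rfl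
  intro a ha
  induction ha using ReflTransGen.head_induction_on with
  | refl => intro i hi h; rw [D.inj hi hj h]
  | @head a b hab hb ih =>
    rintro i hi rfl
    obtain ⟨k, rfl, hk⟩ := D.exists_posAdj hab hi
    exact .head hk (ih k hk.2.1 rfl)

lemma source_reach (v : V) : ReflTransGen G.Adj (pt 0) v := by
  refine reach_of_unique_source (r := G.Adj) (W := Finset.univ) (fun v hv => ?_)
    (fun _ _ _ => Finset.mem_univ _) (fun x _ hx => ?_) v (Finset.mem_univ _)
  · exact D.outerplanar.acyclic v (transGen_univ hv)
  · exact (D.outerplanar.source x).1 ⟨Finset.mem_univ _, fun y _ => hx y⟩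

lemma reach_sink (v : V) : ReflTransGen G.Adj v (pt T) := by
  refine reflTransGen_swap.1 (reach_of_unique_source (r := Function.swap G.Adj) (W := Finset.univ)
    (fun v hv => ?_) (fun _ _ _ => Finset.mem_univ _) (fun x _ hx => ?_) v (Finset.mem_univ _))
  · exact D.outerplanar.acyclic v (transGen_univ (transGen_swap.1 hv))
  · exact (D.outerplanar.sink x).1 ⟨Finset.mem_univ _, fun y _ => hx y⟩

lemma antisymm {a b : V} (h : ReflTransGen G.Adj a b) (h' : ReflTransGen G.Adj b a) : a = b := by
  rcases ReflTransGen.cases_head h with h0 | ⟨z, hz, hzy⟩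
  · exact h0
  · exact absurd (hzy.trans h') (D.acyclic hz)

/-- If the source is also the sink, any further vertex would be on a cycle through it. -/
lemma eq_one_of_eq_zero (hT : T = 0) : n = 1 := by
  have h1 := D.lt
  by_contra hn
  have h2 := D.reach_sink (pt 1)
  rw [hT] at h2
  exact absurd (D.inj (by omega) (by omega) (D.antisymm h2 (D.source_reach _))) one_ne_zero

/-- Let `a` be below `b` on a chain. Walks from the source to `b` and from `a` to the sink have
interleaved ends, so they share a vertex, and switching walks there leads from `a` to `b`. -/
lemma chain_reach {ρ : Bool} {i j : ℕ} (hij : i ≤ j) (hj : j < len n T ρ) :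
    ReflTransGen (posAdj G n pt) (pos n (ρ, i)) (pos n (ρ, j)) := by
  have hT := D.lt
  have hT0 := D.eq_one_of_eq_zero
  have h0 : ∀ q < n, ReflTransGen (posAdj G n pt) 0 q := fun q hq =>
    D.posAdj_of_reach (by omega) hq (D.source_reach _)
  have hs : ∀ q < n, ReflTransGen (posAdj G n pt) q T := fun q hq =>
    D.posAdj_of_reach hq hT (D.reach_sink _)
  rcases hij.lt_or_eq with hij | rfl
  swap
  · exact .refl
  have key : ∀ a b, a < n → b < n → (a = 0 ∨ b = T ∨ Separates 0 b a T) →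
      ReflTransGen (posAdj G n pt) a b := by
    rintro a b ha hb (rfl | rfl | h)
    · exact h0 _ hb
    · exact hs _ ha
    · obtain ⟨w, _, h2, h3, _⟩ := D.noncrossing.walks_meet h (h0 b hb) (hs a ha)
      exact h3.trans h2
  cases ρ
  · simp only [pos_false, len_false] at *
    exact key _ _ (by omega) (by omega) (by unfold Separates; omega)
  · simp only [pos_true, len_true] at *
    exact key _ _ (by omega) (by omega) (by unfold Separates; omega)

omit [Fintype V] D in
lemma reach_coord {i j : ℕ} (h : ReflTransGen (posAdj G n pt) i j) :
    ReflTransGen (fun x y : Bool × ℕ => x.2 < len n T x.1 ∧ y.2 < len n T y.1 ∧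
      G.Adj (pt (pos n x)) (pt (pos n y))) (coord n T i) (coord n T j) :=
  h.lift _ fun a b h => ⟨coord_dom h.1, coord_dom h.2.1, by
    rw [pos_coord h.1, pos_coord h.2.1]; exact h.2.2⟩

/-- the ladder of a drawing -/
def ladder : Ladder where
  N := len n T
  E x y := x.2 < len n T x.1 ∧ y.2 < len n T y.1 ∧ G.Adj (pt (pos n x)) (pt (pos n y))
  dom h := ⟨h.1, h.2.1⟩
  acyclic h h' := D.acyclic h.2.2 (h'.lift (fun x => pt (pos n x)) fun _ _ h => h.2.2)
  tot {ρ i j} hij hj := by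
    have h := reach_coord (T := T) (D.chain_reach hij hj)
    rwa [coord_pos D.lt (x := (ρ, i)) (lt_of_le_of_lt hij hj), coord_pos D.lt (x := (ρ, j)) hj] at h
  nc {ρ i j k l} h h' hik := by
    by_contra hlj
    have hT := D.lt
    have hX : Placement.U (posAdj G n pt) (pos n (ρ, i)) (pos n (!ρ, j)) :=
      h.imp (fun h => ⟨pos_lt hT h.1, pos_lt hT h.2.1, h.2.2⟩)
        (fun h => ⟨pos_lt hT h.1, pos_lt hT h.2.1, h.2.2⟩)
    have hX' : Placement.U (posAdj G n pt) (pos n (ρ, k)) (pos n (!ρ, l)) :=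
      h'.imp (fun h => ⟨pos_lt hT h.1, pos_lt hT h.2.1, h.2.2⟩)
        (fun h => ⟨pos_lt hT h.1, pos_lt hT h.2.1, h.2.2⟩)
    have h1 : i < len n T ρ ∧ j < len n T (!ρ) := by
      rcases h with h | h
      · exact ⟨h.1, h.2.1⟩
      · exact ⟨h.2.1, h.1⟩
    have h2 : k < len n T ρ ∧ l < len n T (!ρ) := by
      rcases h' with h | h
      · exact ⟨h.1, h.2.1⟩
      · exact ⟨h.2.1, h.1⟩
    refine D.noncrossing.not_separates hX hX' ?_
    cases ρ <;> simp only [Bool.not_false, Bool.not_true, pos_true, pos_false, len_true,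
      len_false] at * <;> unfold Separates <;> omega
  hide {ρ i j k l} h hik hkj h' := by
    have hT := D.lt
    have hX' : Placement.U (posAdj G n pt) (pos n (ρ, k)) (pos n (!ρ, l)) :=
      h'.imp (fun h => ⟨pos_lt hT h.1, pos_lt hT h.2.1, h.2.2⟩)
        (fun h => ⟨pos_lt hT h.1, pos_lt hT h.2.1, h.2.2⟩)
    have h2 : k < len n T ρ ∧ l < len n T (!ρ) := by
      rcases h' with h | h
      · exact ⟨h.1, h.2.1⟩
      · exact ⟨h.2.1, h.1⟩
    obtain ⟨h3, h4, h5⟩ := h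
    refine D.noncrossing.not_separates (.inl ⟨pos_lt hT h3, pos_lt hT h4, h5⟩) hX' ?_
    cases ρ <;> simp only [Bool.not_false, Bool.not_true, pos_true, pos_false, len_true,
      len_false] at * <;> unfold Separates <;> omega
  root := by
    have hT := D.lt
    refine ⟨coord n T 0, fun x hx => ?_⟩
    have := reach_coord (T := T) (D.posAdj_of_reach (by omega) (pos_lt hT hx) (D.source_reach _))
    rwa [coord_pos hT hx] at this
  top := by
    have hT := D.lt
    refine ⟨coord n T T, fun x hx => ?_⟩
    have := reach_coord (T := T) (D.posAdj_of_reach (pos_lt hT hx) hT (D.reach_sink _))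
    rwa [coord_pos hT hx] at this

/-- the vertex of given side and height -/
def _root_.Drawing.vt (n : ℕ) (pt : ℕ → V) (x : Bool × ℕ) : V := pt (pos n x)

lemma E_of_adj {x y : Bool × ℕ} (hx : x.2 < len n T x.1) (hy : y.2 < len n T y.1)
    (h : G.Adj (vt n pt x) (vt n pt y)) : D.ladder.E x y := ⟨hx, hy, h⟩

lemma vt_inj {x y : Bool × ℕ} (hx : x.2 < len n T x.1) (hy : y.2 < len n T y.1)
    (h : vt n pt x = vt n pt y) : x = y :=
  pos_inj D.lt hx hy (D.inj (pos_lt D.lt hx) (pos_lt D.lt hy) h)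

lemma exists_vt (v : V) : ∃ x : Bool × ℕ, x.2 < len n T x.1 ∧ vt n pt x = v := by
  obtain ⟨i, hi, rfl⟩ := D.surj v
  exact ⟨coord n T i, coord_dom hi, by rw [vt, pos_coord hi]⟩

lemma reach_iff {x y : Bool × ℕ} (hx : x.2 < len n T x.1) (hy : y.2 < len n T y.1) :
    D.ladder.Reach x y ↔ ReflTransGen G.Adj (vt n pt x) (vt n pt y) := by
  refine ⟨fun h => h.lift _ fun _ _ h => h.2.2, fun h => ?_⟩
  have := reach_coord (T := T) (D.posAdj_of_reach (pos_lt D.lt hx) (pos_lt D.lt hy) h)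
  rwa [coord_pos D.lt hx, coord_pos D.lt hy] at this

end Drawing

/-! ### Chords and vertex subsets of a convex polygon. -/

namespace Placement
variable {V : Type*} {p : V → ℝ × ℝ} {n : ℕ} {pt : ℕ → V} (hp : Placement p n pt)

lemma isBoundary_of_rotate {W : Finset V} {a : V} {l : List V} (h : IsBoundary p W (l ++ [a])) :
    IsBoundary p W (a :: l) := by
  refine ⟨?_, fun v => ?_, ?_⟩
  · have := h.nodup
    rw [List.nodup_append_comm] at this
    exact this
  · rw [← h.mem_iff v]; simp [or_comm]
  · have := h.ccw
    rw [List.triplewise_append] at this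
    rw [List.triplewise_cons]
    refine ⟨?_, this.1⟩
    exact (this.2.2.2 a (by simp)).imp fun {x y} h => by rwa [← orient_rotate]

include hp

lemma isBoundary {W : Finset V} {l : List ℕ} (hl : l.Pairwise (· < ·)) (hn : ∀ q ∈ l, q < n)
    (hmem : ∀ v, v ∈ l.map pt ↔ v ∈ W) : IsBoundary p W (l.map pt) := by
  refine ⟨?_, hmem, ?_⟩
  · refine List.Nodup.map_on (fun x hx y hy h => hp.inj (hn x hx) (hn y hy) h) ?_
    exact hl.imp fun h => h.ne
  · rw [List.triplewise_iff_getElem]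
    intro i j k hij hjk hk
    rw [List.pairwise_iff_getElem] at hl
    simp only [List.getElem_map]
    exact hp.ori (hl _ _ _ _ hij) (hl _ _ _ _ hjk) (hn _ (List.getElem_mem _))

lemma exists_isBoundary (W : Finset V) : ∃ l, IsBoundary p W l := by
  classical
  refine ⟨_, hp.isBoundary (l := (List.range n).filter fun q => pt q ∈ W) ?_ ?_ ?_⟩
  · exact List.Pairwise.filter _ List.pairwise_lt_range
  · intro q hq; simp at hq; exact hq.1
  · intro v
    simp only [List.mem_map, List.mem_filter, List.mem_range, decide_eq_true_eq]
    constructor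
    · rintro ⟨q, ⟨_, h⟩, rfl⟩; exact h
    · intro h
      obtain ⟨q, hq, rfl⟩ := hp.surj v
      exact ⟨q, ⟨hq, h⟩, rfl⟩

lemma orient_neg_of_between {i j k : ℕ} (h1 : i < k) (h2 : k < j) (h3 : j < n) :
    orient (p (pt i)) (p (pt j)) (p (pt k)) < 0 := by
  have := hp.ori h1 h2 h3
  have := orient_swap (p (pt j)) (p (pt i)) (p (pt k))
  have := orient_rotate (p (pt j)) (p (pt i)) (p (pt k))
  linarith

lemma orient_pos_of_not_between {i j k : ℕ} (hij : i < j) (h : k < i ∨ j < k) (hj : j < n)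
    (hk : k < n) : 0 < orient (p (pt i)) (p (pt j)) (p (pt k)) := by
  rcases h with h | h
  · rw [orient_rotate (p (pt k))]; exact hp.ori h hij hj
  · exact hp.ori hij h hk

lemma orient_of_separates {i j k l : ℕ} (hi : i < n) (hj : j < n) (hk : k < n) (hl : l < n)
    (hij : i ≠ j) (h : Separates i j k l) :
    (0 < orient (p (pt i)) (p (pt j)) (p (pt k)) ∧
      orient (p (pt i)) (p (pt j)) (p (pt l)) < 0) ∨
    (orient (p (pt i)) (p (pt j)) (p (pt k)) < 0 ∧
      0 < orient (p (pt i)) (p (pt j)) (p (pt l))) := by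
  unfold Separates at h
  rcases lt_or_gt_of_ne hij with h1 | h1
  · by_cases h2 : i < k ∧ k < j
    · exact .inr ⟨hp.orient_neg_of_between h2.1 h2.2 hj,
        hp.orient_pos_of_not_between h1 (by omega) hj hl⟩
    · exact .inl ⟨hp.orient_pos_of_not_between h1 (by omega) hj hk,
        hp.orient_neg_of_between (by omega) (by omega) hj⟩
  · rw [orient_swap _ _ (p (pt k)), orient_swap _ _ (p (pt l))]
    simp only [Left.neg_pos_iff, Left.neg_neg_iff]
    by_cases h2 : j < k ∧ k < i
    · exact .inl ⟨hp.orient_neg_of_between h2.1 h2.2 hi,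
        hp.orient_pos_of_not_between h1 (by omega) hi hl⟩
    · exact .inr ⟨hp.orient_pos_of_not_between h1 (by omega) hi hk,
        hp.orient_neg_of_between (by omega) (by omega) hi⟩

lemma orient_of_not_separates {i j k l : ℕ} (hi : i < n) (hj : j < n) (hk : k < n) (hl : l < n)
    (hij : i ≠ j) (hki : k ≠ i) (hkj : k ≠ j) (hli : l ≠ i) (hlj : l ≠ j)
    (h : ¬ Separates i j k l) :
    (0 < orient (p (pt i)) (p (pt j)) (p (pt k)) ∧
      0 < orient (p (pt i)) (p (pt j)) (p (pt l))) ∨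
    (orient (p (pt i)) (p (pt j)) (p (pt k)) < 0 ∧
      orient (p (pt i)) (p (pt j)) (p (pt l)) < 0) := by
  unfold Separates at h
  rcases lt_or_gt_of_ne hij with h1 | h1
  · by_cases h2 : i < k ∧ k < j
    · exact .inr ⟨hp.orient_neg_of_between h2.1 h2.2 hj,
        hp.orient_neg_of_between (by omega) (by omega) hj⟩
    · exact .inl ⟨hp.orient_pos_of_not_between h1 (by omega) hj hk,
        hp.orient_pos_of_not_between h1 (by omega) hj hl⟩
  · rw [orient_swap _ _ (p (pt k)), orient_swap _ _ (p (pt l))]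
    simp only [Left.neg_pos_iff, Left.neg_neg_iff]
    by_cases h2 : j < k ∧ k < i
    · exact .inl ⟨hp.orient_neg_of_between h2.1 h2.2 hi,
        hp.orient_neg_of_between (by omega) (by omega) hi⟩
    · exact .inr ⟨hp.orient_pos_of_not_between h1 (by omega) hi hk,
        hp.orient_pos_of_not_between h1 (by omega) hi hl⟩

lemma orient_ne_zero {i j k : ℕ} (hi : i < n) (hj : j < n) (hk : k < n)
    (hij : i ≠ j) (hki : k ≠ i) (hkj : k ≠ j) :
    orient (p (pt i)) (p (pt j)) (p (pt k)) ≠ 0 := by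
  rcases hp.orient_of_not_separates hi hj hk hk hij hki hkj hki hkj (by unfold Separates; omega)
    with h | h
  · exact h.1.ne'
  · exact h.1.ne

/-- Evaluate `orient` with respect to the first chord at a common point: it vanishes, and it is the
average of the values at `k` and `l` with weights `c` and `d`. If neither is an end of the first
chord, both values have the same nonzero sign, which is impossible. If one of them is, the other has
weight `0`. -/
lemma segment_inter_subset {i j k l : ℕ} (hi : i < n) (hj : j < n) (hk : k < n) (hl : l < n)
    (hij : i ≠ j) (hkl : k ≠ l) (h : ¬ Separates i j k l) (h1 : ¬ (k = i ∧ l = j))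
    (h2 : ¬ (k = j ∧ l = i)) :
    segment ℝ (p (pt i)) (p (pt j)) ∩ segment ℝ (p (pt k)) (p (pt l)) ⊆
      p '' (({pt i, pt j} : Set V) ∩ {pt k, pt l}) := by
  rintro _ ⟨⟨a, b, _, _, hab, rfl⟩, c, d, hc, hd, hcd, hx⟩
  have e := orient_combo (p (pt i)) (p (pt j)) (p (pt i)) (p (pt j)) hab
  rw [orient_self_left, orient_self_right, ← hx, orient_combo _ _ _ _ hcd] at e
  simp only [mul_zero, add_zero] at e
  rw [← hx]
  by_cases hk' : k = i ∨ k = j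
  · have hd0 : d = 0 := by
      have h3 : orient (p (pt i)) (p (pt j)) (p (pt k)) = 0 := by
        rcases hk' with rfl | rfl
        · exact orient_self_left _ _
        · exact orient_self_right _ _
      rw [h3, mul_zero, zero_add] at e
      exact (mul_eq_zero.1 e).resolve_right
        (hp.orient_ne_zero hi hj hl hij (by omega) (by omega))
    obtain rfl : c = 1 := by linarith
    refine ⟨pt k, ⟨?_, by simp⟩, by simp [hd0]⟩
    rcases hk' with rfl | rfl <;> simp
  · by_cases hl' : l = i ∨ l = j
    · have hc0 : c = 0 := by
        have h3 : orient (p (pt i)) (p (pt j)) (p (pt l)) = 0 := by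
          rcases hl' with rfl | rfl
          · exact orient_self_left _ _
          · exact orient_self_right _ _
        rw [h3, mul_zero, add_zero] at e
        exact (mul_eq_zero.1 e).resolve_right
          (hp.orient_ne_zero hi hj hk hij (by omega) (by omega))
      obtain rfl : d = 1 := by linarith
      refine ⟨pt l, ⟨?_, by simp⟩, by simp [hc0]⟩
      rcases hl' with rfl | rfl <;> simp
    · exfalso
      rcases hp.orient_of_not_separates hi hj hk hl hij (by tauto) (by tauto) (by tauto)
        (by tauto) h with h3 | h3
      · rcases hc.lt_or_eq with h4 | rfl
        · nlinarith [mul_pos h4 h3.1, mul_nonneg hd h3.2.le]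
        · obtain rfl : d = 1 := by linarith
          linarith
      · rcases hc.lt_or_eq with h4 | rfl
        · nlinarith [mul_pos h4 (neg_pos.2 h3.1), mul_nonneg hd (neg_pos.2 h3.2).le]
        · obtain rfl : d = 1 := by linarith
          linarith

end Placement

/-- With this lemma and the next, strong and weak polygons are treated alike: adding the median to a
strong one changes nothing. -/
lemma isSTPolygon_of_addEdge {V : Type*} {p : V → ℝ × ℝ} {G : Digraph V} {W : Finset V} {u v : V}
    (h : IsStrongSTPolygon p (addEdge G u v) W u v) : IsSTPolygon p G W := by
  refine ⟨u, v, ?_⟩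
  by_cases huv : G.Adj u v
  · left
    have : addEdge G u v = G := by
      ext a b
      simp only [addEdge, or_iff_left_iff_imp]
      rintro ⟨rfl, rfl⟩; exact huv
    rwa [this] at h
  · exact .inr ⟨huv, h⟩

lemma exists_addEdge_of_isSTPolygon {V : Type*} {p : V → ℝ × ℝ} {G : Digraph V} {W : Finset V}
    (h : IsSTPolygon p G W) : ∃ u v, IsStrongSTPolygon p (addEdge G u v) W u v := by
  obtain ⟨u, v, h | h⟩ := h
  · refine ⟨u, v, ?_⟩
    have : addEdge G u v = G := by
      ext a b
      simp only [addEdge, or_iff_left_iff_imp]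
      rintro ⟨rfl, rfl⟩; exact h.median
    rwa [this]
  · exact ⟨u, v, h.2⟩

/-! ### Boxes are st-polygons. -/

namespace Drawing
variable {V : Type*} [Fintype V] {p : V → ℝ × ℝ} {G : Digraph V} {n T : ℕ} {pt : ℕ → V}

open Classical in
/-- the vertices of heights `lo ρ` to `hi ρ` on each side `ρ` -/
noncomputable def boxSet (n T : ℕ) (pt : ℕ → V) (lo hi : Bool → ℕ) : Finset V :=
  Finset.univ.filter fun v =>
    ∃ x : Bool × ℕ, x.2 < len n T x.1 ∧ vt n pt x = v ∧ lo x.1 ≤ x.2 ∧ x.2 ≤ hi x.1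

variable (D : Drawing p G n T pt)

lemma mem_boxSet {lo hi : Bool → ℕ} {v : V} : v ∈ boxSet n T pt lo hi ↔
    ∃ x : Bool × ℕ, x.2 < len n T x.1 ∧ vt n pt x = v ∧ lo x.1 ≤ x.2 ∧ x.2 ≤ hi x.1 := by
  simp [boxSet]

include D

lemma vt_mem_boxSet {lo hi : Bool → ℕ} {x : Bool × ℕ} (hx : x.2 < len n T x.1) :
    vt n pt x ∈ boxSet n T pt lo hi ↔ lo x.1 ≤ x.2 ∧ x.2 ≤ hi x.1 := by
  rw [mem_boxSet]
  refine ⟨?_, fun h => ⟨x, hx, rfl, h⟩⟩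
  rintro ⟨y, hy, hyx, h⟩
  obtain rfl := D.vt_inj hy hx hyx
  exact h

/-- Edges of a box do not cross the line from its source to its sink. -/
lemma box_not_separates {lo hi : Bool → ℕ} {σ τ : Bool} (h : D.ladder.IsBox lo hi σ τ)
    {x y : Bool × ℕ} (hxy : D.ladder.E x y) (hx : lo x.1 ≤ x.2 ∧ x.2 ≤ hi x.1)
    (hy : lo y.1 ≤ y.2 ∧ y.2 ≤ hi y.1) :
    ¬ Separates (pos n (σ, lo σ)) (pos n (τ, hi τ)) (pos n x) (pos n y) := by
  have hT := D.lt
  have hhi := h.hi_lt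
  have hle := h.le
  obtain ⟨x1, i⟩ := x
  obtain ⟨y1, j⟩ := y
  have hdom := D.ladder.dom hxy
  have key : ∀ k l, D.ladder.X σ k l → lo σ ≤ k ∧ k ≤ hi σ → lo (!σ) ≤ l ∧ l ≤ hi (!σ) →
      ¬ Separates (pos n (σ, lo σ)) (pos n (τ, hi τ)) (pos n (σ, k)) (pos n (!σ, l)) := by
    intro k l hkl hk hl hs
    unfold Separates at hs
    rcases h.chord k l hkl hk.1 hk.2 hl.1 hl.2 with rfl | ⟨rfl, rfl⟩ | ⟨rfl, rfl⟩
    · exact hs.1 rfl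
    · exact hs.2.1 rfl
    · exact hs.2.2.2.1 rfl
  -- For an edge within one side this is a matter of positions only, as the box reaches from source
  -- to sink; an edge across touches one of them by `chord`.
  rcases Bool.eq_or_eq_not y1 x1 with rfl | rfl
  · simp only at *
    have h1 := hhi σ; have h2 := hle σ
    have h3 := hhi (!σ); have h4 := hle (!σ)
    change _ < len n T _ at h1
    change _ < len n T _ at h3
    have h5 := h.same
    have h6 := h.opp
    cases σ <;> cases τ <;> cases y1 <;>
      simp only [Bool.not_true, Bool.not_false, pos_true, pos_false, len_true, len_false,
        reduceCtorEq, false_imp_iff, true_imp_iff] at * <;>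
      unfold Separates <;> omega
  · rcases Bool.eq_or_eq_not x1 σ with rfl | rfl
    · exact key _ _ (.inl hxy) hx hy
    · rw [Bool.not_not] at hxy hy ⊢
      intro hs
      refine key _ _ (.inr hxy) hy hx ?_
      unfold Separates at *; omega

/-- The source of a box is its only source. -/
lemma isSource_boxSet {lo hi : Bool → ℕ} {σ τ : Bool} (h : D.ladder.IsBox lo hi σ τ) {w : V} :
    IsSource G (boxSet n T pt lo hi) w ↔ w = vt n pt (σ, lo σ) := by
  have hhi : ∀ ρ, hi ρ < len n T ρ := h.hi_lt
  have hle := h.le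
  have hlo : ∀ ρ, lo ρ < len n T ρ := fun ρ => (hle ρ).trans_lt (hhi ρ)
  have hu : vt n pt (σ, lo σ) ∈ boxSet n T pt lo hi := (D.vt_mem_boxSet (hlo σ)).2 ⟨le_rfl, hle _⟩
  constructor
  · rintro ⟨hw, h1⟩
    obtain ⟨⟨ρ, k⟩, hk, rfl, h2, h3⟩ := mem_boxSet.1 hw
    simp only at hk h2 h3
    rcases h2.lt_or_eq with h2 | rfl
    · obtain ⟨k, rfl⟩ := Nat.exists_eq_succ_of_ne_zero (by omega : k ≠ 0)
      refine absurd (h.con ρ k (by omega) (by omega)).2.2 (h1 (vt n pt (ρ, k)) ?_)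
      exact (D.vt_mem_boxSet (by simp only; omega)).2 ⟨by simp only; omega, by simp only; omega⟩
    · rcases Bool.eq_or_eq_not ρ σ with rfl | rfl
      · rfl
      · exact absurd h.bot.2.2 (h1 _ hu)
  · rintro rfl
    refine ⟨hu, fun y hy h1 => ?_⟩
    obtain ⟨⟨ρ, k⟩, hk, rfl, h2, h3⟩ := mem_boxSet.1 hy
    exact D.ladder.acyclic (D.E_of_adj hk (hlo _) h1) (h.source_reach h2 h3)

/-- A box is an st-polygon. -/
lemma isStrong_of_isBox {lo hi : Bool → ℕ} {σ τ : Bool} (h : D.ladder.IsBox lo hi σ τ) :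
    IsStrongSTPolygon p (addEdge G (vt n pt (σ, lo σ)) (vt n pt (τ, hi τ)))
      (boxSet n T pt lo hi) (vt n pt (σ, lo σ)) (vt n pt (τ, hi τ)) := by
  have hT := D.lt
  have hhi : ∀ ρ, hi ρ < len n T ρ := h.hi_lt
  have hle := h.le
  have hlo : ∀ ρ, lo ρ < len n T ρ := fun ρ => (hle ρ).trans_lt (hhi ρ)
  have hdom : ∀ x : Bool × ℕ, x.2 ≤ hi x.1 → x.2 < len n T x.1 := fun x hx =>
    hx.trans_lt (hhi _)
  have hu : vt n pt (σ, lo σ) ∈ boxSet n T pt lo hi := (D.vt_mem_boxSet (hlo σ)).2 ⟨le_rfl, hle _⟩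
  have hv : vt n pt (τ, hi τ) ∈ boxSet n T pt lo hi := (D.vt_mem_boxSet (hhi τ)).2 ⟨hle _, le_rfl⟩
  have huv' : ((σ, lo σ) : Bool × ℕ) ≠ (τ, hi τ) := by
    intro h1
    simp only [Prod.mk.injEq] at h1
    obtain ⟨rfl, h1⟩ := h1
    have := h.same rfl
    omega
  have huv : vt n pt (σ, lo σ) ≠ vt n pt (τ, hi τ) := fun h1 =>
    huv' (D.vt_inj (hlo _) (hhi _) h1)
  have reach_u : ∀ w ∈ boxSet n T pt lo hi, ReflTransGen G.Adj (vt n pt (σ, lo σ)) w := by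
    intro w hw
    obtain ⟨⟨ρ, k⟩, h1, rfl, h2, h3⟩ := mem_boxSet.1 hw
    exact (D.reach_iff (hlo σ) h1).1 (h.source_reach h2 h3)
  have reach_v : ∀ w ∈ boxSet n T pt lo hi, ReflTransGen G.Adj w (vt n pt (τ, hi τ)) := by
    intro w hw
    obtain ⟨⟨ρ, k⟩, h1, rfl, h2, h3⟩ := mem_boxSet.1 hw
    exact (D.reach_iff h1 (hhi τ)).1 (h.reach_sink h2 h3)
  -- These two vertices of the box witness that the median has vertices on both sides; `same` and
  -- `opp` ensure that neither is the sink.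
  have hsep : Separates (pos n (σ, lo σ)) (pos n (τ, hi τ)) (pos n (σ, lo σ + 1))
      (pos n (!σ, lo (!σ))) ∧ lo σ + 1 ≤ hi σ := by
    have h1 := hhi σ; have h2 := hle σ
    have h3 := hhi (!σ); have h4 := hle (!σ)
    have h5 := h.same
    have h6 := h.opp
    cases σ <;> cases τ <;>
      simp only [Bool.not_true, Bool.not_false, pos_true, pos_false, len_true, len_false,
        reduceCtorEq, false_imp_iff, true_imp_iff] at * <;>
      unfold Separates <;> omega
  have hw1 : vt n pt (σ, lo σ + 1) ∈ boxSet n T pt lo hi :=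
    (D.vt_mem_boxSet (hdom (σ, _) hsep.2)).2 ⟨Nat.le_succ _, hsep.2⟩
  have hw2 : vt n pt (!σ, lo (!σ)) ∈ boxSet n T pt lo hi :=
    (D.vt_mem_boxSet (hlo _)).2 ⟨le_rfl, hle _⟩
  have hori := D.orient_of_separates (pos_lt hT (hlo _)) (pos_lt hT (hhi _))
    (pos_lt hT (hdom (σ, _) hsep.2)) (pos_lt hT (hlo _))
    (fun h1 => huv' (pos_inj hT (hlo _) (hhi _) h1)) hsep.1
  have planar_uv : ∀ c ∈ boxSet n T pt lo hi, ∀ d ∈ boxSet n T pt lo hi, G.Adj c d →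
      (c, d) ≠ (vt n pt (σ, lo σ), vt n pt (τ, hi τ)) →
      segment ℝ (p (vt n pt (σ, lo σ))) (p (vt n pt (τ, hi τ))) ∩ segment ℝ (p c) (p d) ⊆
        p '' (({vt n pt (σ, lo σ), vt n pt (τ, hi τ)} : Set V) ∩ {c, d}) := by
    intro c hc d hd hcd hne
    obtain ⟨x, hx, rfl, hx'⟩ := mem_boxSet.1 hc
    obtain ⟨y, hy, rfl, hy'⟩ := mem_boxSet.1 hd
    refine D.segment_inter_subset (pos_lt hT (hlo _)) (pos_lt hT (hhi _)) (pos_lt hT hx)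
      (pos_lt hT hy) (fun h1 => huv' (pos_inj hT (hlo _) (hhi _) h1)) ?_
      (D.box_not_separates h ⟨hx, hy, hcd⟩ hx' hy') ?_ ?_
    · intro h1
      rw [pos_inj hT hx hy h1] at hcd
      exact D.acyclic hcd .refl
    · rintro ⟨h1, h2⟩
      refine hne ?_
      rw [vt, vt, h1, h2]; rfl
    · rintro ⟨h1, h2⟩
      rw [pos_inj hT hx (hhi _) h1, pos_inj hT hy (hlo _) h2] at hcd
      exact D.acyclic hcd (reach_u _ hv)
  refine ⟨⟨?_, D.exists_isBoundary _, ?_, ?_, ?_, ?_⟩, .inr ⟨rfl, rfl⟩, ?_, ?_⟩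
  · exact D.outerplanar.injOn.mono (Set.subset_univ _ |>.trans (by simp))
  · rintro a ha b hb c hc d hd (h1 | ⟨rfl, rfl⟩) (h2 | ⟨rfl, rfl⟩) hne
    · exact D.outerplanar.planar _ (Finset.mem_univ _) _ (Finset.mem_univ _) _ (Finset.mem_univ _)
        _ (Finset.mem_univ _) h1 h2 hne
    · rw [Set.inter_comm, Set.inter_comm {a, b}]
      exact planar_uv _ ha _ hb h1 hne
    · exact planar_uv _ hc _ hd h2 hne.symm
    · exact absurd rfl hne
  · intro w hw
    -- A path of `G` from source to sink can replace the median, so adding the median creates no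
    -- cycle.
    have : TransGen G.Adj w w := by
      refine TransGen.closed (p := G.Adj) ?_ _ _ hw
      rintro a b ⟨-, -, h1 | ⟨rfl, rfl⟩⟩
      · exact .single h1
      · rcases reflTransGen_iff_eq_or_transGen.1 (reach_u _ hv) with h1 | h1
        · exact absurd h1.symm huv
        · exact h1
    exact D.outerplanar.acyclic w (transGen_univ this)
  · intro w
    constructor
    · rintro ⟨hw, h1⟩
      exact (D.isSource_boxSet h).1 ⟨hw, fun y hy h2 => h1 y hy (.inl h2)⟩
    · rintro rfl
      refine ⟨hu, ?_⟩
      rintro y hy (h1 | ⟨_, h1⟩)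
      · exact D.acyclic h1 (reach_u _ hy)
      · exact huv h1
  · intro w
    constructor
    · rintro ⟨hw, h1⟩
      obtain ⟨⟨ρ, k⟩, hk, rfl, h2, h3⟩ := mem_boxSet.1 hw
      simp only at hk h2 h3
      rcases h3.lt_or_eq with h3 | rfl
      · refine absurd (.inl (h.con ρ k (by omega) (by omega)).2.2) (h1 (vt n pt (ρ, k + 1)) ?_)
        exact (D.vt_mem_boxSet (lt_of_le_of_lt (by simp only; omega) (hhi ρ))).2
          ⟨by simp only; omega, by simp only; omega⟩
      · rcases Bool.eq_or_eq_not ρ τ with rfl | rfl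
        · rfl
        · exact absurd (.inl h.top.2.2) (h1 _ hv)
    · rintro rfl
      refine ⟨hv, ?_⟩
      rintro y hy (h1 | ⟨h1, _⟩)
      · exact D.acyclic h1 (reach_v _ hy)
      · exact huv h1.symm
  · rcases hori with h1 | h1
    · exact ⟨_, hw1, h1.1⟩
    · exact ⟨_, hw2, h1.2⟩
  · rcases hori with h1 | h1
    · exact ⟨_, hw2, h1.2⟩
    · exact ⟨_, hw1, h1.1⟩

end Drawing

/-! ### Every st-polygon lies in a box. -/

namespace Ladder
variable {L : Ladder}

/-- The properties of the vertex set of an st-polygon with source `(σ, i)` and sink `(τ, j)` that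
make it part of a box. -/
structure IsPoly (L : Ladder) (W : Bool × ℕ → Prop) (σ : Bool) (i : ℕ) (τ : Bool) (j : ℕ) :
    Prop where
  dom : ∀ x, W x → x.2 < L.N x.1
  source : W (σ, i)
  sink : W (τ, j)
  ge : ∀ k, W (σ, k) → i ≤ k
  le : ∀ k, W (τ, k) → k ≤ j
  exists_in : ∀ x, W x → x ≠ (σ, i) → x ≠ (τ, j) → ∃ y, W y ∧ L.E y x
  exists_out : ∀ x, W x → x ≠ (σ, i) → x ≠ (τ, j) → ∃ y, W y ∧ L.E x y
  no_in : ∀ y, W y → ¬ L.E y (σ, i)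
  no_out : ∀ y, W y → ¬ L.E (τ, j) y
  chord : ∀ k l, L.X σ k l → W (σ, k) → W (!σ, l) →
    k = i ∨ (τ = σ ∧ k = j) ∨ (τ = !σ ∧ l = j)
  inner : ∃ k l, W (σ, k) ∧ W (!σ, l) ∧ i < k ∧ (τ = σ → k < j) ∧ (τ = !σ → l < j)

namespace IsPoly

variable {W : Bool × ℕ → Prop} {σ τ : Bool} {i j : ℕ} (h : L.IsPoly W σ i τ j)
include h

/-- Unless they are source or sink, `k₁` has an out-neighbour and `k₂` an in-neighbour in `W`. If
such a neighbour is on the same side, its edge spans the interval, as `W` has nothing in between. An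
edge across would have to touch the source or the sink by `chord`, and the case distinction on their
sides excludes this for a suitable choice of `k₁` or `k₂`. -/
lemma exists_span {ρ : Bool} {k₁ k₂ : ℕ} (h1 : W (ρ, k₁)) (h2 : W (ρ, k₂)) (h12 : k₁ < k₂)
    (hno : ∀ k, k₁ < k → k < k₂ → ¬ W (ρ, k)) : ∃ a b, a ≤ k₁ ∧ k₂ ≤ b ∧ L.E (ρ, a) (ρ, b) := by
  have out : (ρ, k₁) ≠ (σ, i) → (ρ, k₁) ≠ (τ, j) →
      (∃ a b, a ≤ k₁ ∧ k₂ ≤ b ∧ L.E (ρ, a) (ρ, b)) ∨ ∃ l, W (!ρ, l) ∧ L.E (ρ, k₁) (!ρ, l) := by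
    intro h3 h4
    obtain ⟨⟨ρ', k⟩, h5, h6⟩ := h.exists_out _ h1 h3 h4
    rcases Bool.eq_or_eq_not ρ' ρ with rfl | rfl
    · refine .inl ⟨k₁, k, le_rfl, ?_, h6⟩
      by_contra h7
      exact hno k (lt_of_E h6) (not_le.1 h7) h5
    · exact .inr ⟨k, h5, h6⟩
  have inn : (ρ, k₂) ≠ (σ, i) → (ρ, k₂) ≠ (τ, j) →
      (∃ a b, a ≤ k₁ ∧ k₂ ≤ b ∧ L.E (ρ, a) (ρ, b)) ∨ ∃ l, W (!ρ, l) ∧ L.E (!ρ, l) (ρ, k₂) := by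
    intro h3 h4
    obtain ⟨⟨ρ', k⟩, h5, h6⟩ := h.exists_in _ h2 h3 h4
    rcases Bool.eq_or_eq_not ρ' ρ with rfl | rfl
    · refine .inl ⟨k, k₂, ?_, le_rfl, h6⟩
      by_contra h7
      exact hno k (not_le.1 h7) (lt_of_E h6) h5
    · exact .inr ⟨k, h5, h6⟩
  obtain ⟨k, l, hk, hl, hik, hsame, hopp⟩ := h.inner
  rcases Bool.eq_or_eq_not τ σ with rfl | rfl
  · have hkj := hsame rfl
    rcases Bool.eq_or_eq_not ρ τ with rfl | rfl
    · have hi1 := h.ge _ h1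
      have hj2 := h.le _ h2
      rcases hi1.lt_or_eq with hi1 | rfl
      · refine (out (by simp; omega) (by simp; omega)).resolve_right ?_
        rintro ⟨l, h3, h4⟩
        rcases h.chord _ _ (.inl h4) h1 h3 with h5 | h5 | h5
        · omega
        · omega
        · simp at h5
      · have hk2 : k₂ ≤ k := by
          by_contra h3; exact hno k hik (not_le.1 h3) hk
        refine (inn (by simp; omega) (by simp; omega)).resolve_right ?_
        rintro ⟨l, h3, h4⟩
        rcases h.chord _ _ (.inr h4) h2 h3 with h5 | h5 | h5
        · omega
        · omega
        · simp at h5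
    · rcases out (by simp) (by simp) with h3 | ⟨c, h3, h4⟩
      · exact h3
      rcases inn (by simp) (by simp) with h5 | ⟨d, h5, h6⟩
      · exact h5
      exfalso
      rw [Bool.not_not] at h3 h4 h5 h6
      rcases h.chord _ _ (.inr h4) h3 h1 with rfl | ⟨-, rfl⟩ | h7
      · exact h.no_in _ h1 h4
      · rcases h.chord _ _ (.inl h6) h5 h2 with rfl | ⟨-, rfl⟩ | h7
        -- Source and sink are both on the other side: an edge from the source to `k₂` would cross
        -- an edge from `k₁` to the sink.
        · have := L.nc (.inl h6) (.inr h4) (hik.trans hkj)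
          omega
        · exact h.no_out _ h2 h6
        · simp at h7
      · simp at h7
  · have hlj := hopp rfl
    rcases Bool.eq_or_eq_not ρ σ with rfl | rfl
    · have hi1 := h.ge _ h1
      refine (inn (by simp; omega) (by simp)).resolve_right ?_
      rintro ⟨l, h3, h4⟩
      rcases h.chord _ _ (.inr h4) h2 h3 with h5 | h5 | ⟨-, rfl⟩
      · omega
      · simp at h5
      · exact h.no_out _ h2 h4
    · have hj2 := h.le _ h2
      refine (out (by simp) (by simp; omega)).resolve_right ?_
      rintro ⟨l, h3, h4⟩
      rw [Bool.not_not] at h3 h4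
      rcases h.chord _ _ (.inr h4) h3 h1 with rfl | h5 | h5
      · exact h.no_in _ h1 h4
      · simp at h5
      · omega

omit h in
lemma exists_consecutive {ρ : Bool} {a b k : ℕ} (ha : W (ρ, a)) (hb : W (ρ, b)) (hak : a ≤ k)
    (hkb : k < b) : ∃ k₁ k₂, W (ρ, k₁) ∧ W (ρ, k₂) ∧ k₁ ≤ k ∧ k < k₂ ∧
      ∀ m, k₁ < m → m < k₂ → ¬ W (ρ, m) := by
  obtain ⟨k₁, ⟨h1, h2⟩, h3⟩ := Nat.exists_max_of_bounded (P := fun m => W (ρ, m) ∧ m ≤ k)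
    (M := k + 1) ⟨a, ha, hak⟩ (fun m hm => by omega)
  obtain ⟨k₂, ⟨h4, h5⟩, h6⟩ := Nat.exists_min (P := fun m => W (ρ, m) ∧ k < m) ⟨b, hb, hkb⟩
  refine ⟨k₁, k₂, h1, h4, h2, h5, fun m hm hm' hW => ?_⟩
  rcases le_or_gt m k with h7 | h7
  · have := h3 _ ⟨hW, h7⟩; omega
  · have := h6 _ ⟨hW, h7⟩; omega

lemma con {ρ : Bool} {a b k : ℕ} (ha : W (ρ, a)) (hb : W (ρ, b)) (hak : a ≤ k)
    (hkb : k < b) : L.con ρ k := by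
  obtain ⟨k₁, k₂, h1, h2, h3, h4, h5⟩ := exists_consecutive ha hb hak hkb
  obtain ⟨c, d, h6, h7, h8⟩ := h.exists_span h1 h2 (by omega) h5
  exact con_of_E h8 (by omega) (by omega)

/-- A vertex that `W` skips lies strictly under a spanning edge, so `hide` forbids edges across at
it. Hence filling up the skipped vertices adds no chords. -/
lemma mem_of_X {ρ : Bool} {a b k l : ℕ} (ha : W (ρ, a)) (hb : W (ρ, b)) (hak : a ≤ k)
    (hkb : k ≤ b) (hX : L.X ρ k l) : W (ρ, k) := by
  rcases hkb.lt_or_eq with hkb | rfl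
  · obtain ⟨k₁, k₂, h1, h2, h3, h4, h5⟩ := exists_consecutive ha hb hak hkb
    obtain ⟨c, d, h6, h7, h8⟩ := h.exists_span h1 h2 (by omega) h5
    rcases h3.lt_or_eq with h3 | rfl
    · exact absurd hX (L.hide h8 (by omega) (by omega))
    · exact h1
  · exact hb

/-- Such a vertex set is part of a box with the same source and the same sink. -/
lemma exists_box : ∃ lo hi, lo σ = i ∧ hi τ = j ∧ L.IsBox lo hi σ τ ∧
    ∀ x, W x → lo x.1 ≤ x.2 ∧ x.2 ≤ hi x.1 := by
  obtain ⟨k, l, hk, hl, hik, hsame, hopp⟩ := h.inner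
  have hne : ∀ ρ, ∃ m, W (ρ, m) := forall_side (P := fun ρ => ∃ m, W (ρ, m)) σ ⟨k, hk⟩ ⟨l, hl⟩
  choose lo hlo hlo' using fun ρ => Nat.exists_min (hne ρ)
  choose hi hhi hhi' using fun ρ => Nat.exists_max_of_bounded (hne ρ) (M := L.N ρ)
    fun k hk => h.dom _ hk
  have e1 : lo σ = i := le_antisymm (hlo' _ _ h.source) (h.ge _ (hlo _))
  have e2 : hi τ = j := le_antisymm (h.le _ (hhi _)) (hhi' _ _ h.sink)
  have hle : ∀ ρ, lo ρ ≤ hi ρ := fun ρ => hlo' _ _ (hhi ρ)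
  -- The lowest vertex of the other side has an in-neighbour in `W`, which is not on its own side.
  -- By `chord` the edge touches source or sink, and only the source can be its tail.
  have hbot : ((!σ, lo (!σ)) : Bool × ℕ) ≠ (τ, j) → L.E (σ, lo σ) (!σ, lo (!σ)) := by
    intro hne'
    obtain ⟨⟨ρ, c⟩, h3, h4⟩ := h.exists_in _ (hlo (!σ)) (by simp) hne'
    rcases Bool.eq_or_eq_not ρ σ with rfl | rfl
    · rcases h.chord _ _ (.inl h4) h3 (hlo _) with rfl | ⟨rfl, rfl⟩ | ⟨rfl, h5⟩
      · rwa [e1]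
      · exact absurd h4 (h.no_out _ (hlo _))
      · exact absurd (by rw [h5]) hne'
    · exact absurd (hlo' _ _ h3) (not_le.2 (lt_of_E h4))
  have htop : ((!τ, hi (!τ)) : Bool × ℕ) ≠ (σ, i) → L.E (!τ, hi (!τ)) (τ, hi τ) := by
    intro hne'
    obtain ⟨⟨ρ, c⟩, h3, h4⟩ := h.exists_out _ (hhi (!τ)) hne' (by simp)
    rcases Bool.eq_or_eq_not ρ τ with rfl | rfl
    · rcases Bool.eq_or_eq_not ρ σ with rfl | rfl
      · rcases h.chord _ _ (.inr h4) h3 (hhi _) with rfl | ⟨-, rfl⟩ | h5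
        · exact absurd h4 (h.no_in _ (hhi _))
        · rwa [e2]
        · simp at h5
      · rw [Bool.not_not] at hne' h4 ⊢
        have := hhi (!!σ)
        rw [Bool.not_not] at this
        rcases h.chord _ _ (.inl h4) this h3 with h5 | h5 | ⟨-, rfl⟩
        · exact absurd (by rw [h5]) hne'
        · simp at h5
        · rwa [e2]
    · exact absurd (hhi' _ _ h3) (not_le.2 (lt_of_E h4))
  refine ⟨lo, hi, e1, e2, ⟨hbot ?_, htop ?_, hle, fun ρ m h1 h2 => h.con (hlo ρ) (hhi ρ) h1 h2,
    ?_, ?_, ?_⟩, fun x hx => ⟨hlo' x.1 _ hx, hhi' x.1 _ hx⟩⟩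
  · rintro h3
    simp only [Prod.mk.injEq] at h3
    obtain ⟨rfl, h3⟩ := h3
    have := hopp rfl
    have := hlo' _ _ hl
    omega
  · rintro h3
    simp only [Prod.mk.injEq] at h3
    obtain ⟨rfl, h3⟩ := h3
    have := hhi' _ _ hk
    omega
  · intro m q hX h1 h2 h3 h4
    have h5 := h.mem_of_X (hlo σ) (hhi σ) h1 h2 hX
    have h6 := h.mem_of_X (hlo (!σ)) (hhi (!σ)) h3 h4 (X_not.2 hX)
    rcases h.chord _ _ hX h5 h6 with h7 | ⟨rfl, h7⟩ | ⟨rfl, h7⟩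
    · exact .inl (by omega)
    · exact .inr (.inl ⟨rfl, by omega⟩)
    · exact .inr (.inr ⟨rfl, by omega⟩)
  · rintro rfl
    have := hsame rfl
    omega
  · rintro rfl
    have := hopp rfl
    have := hhi' _ _ hk
    have := hlo' _ _ hl
    omega

end IsPoly
end Ladder

/-! ### From the vertex set of an st-polygon to a box of the ladder. -/

namespace Drawing
variable {V : Type*} [Fintype V] {p : V → ℝ × ℝ} {G : Digraph V} {n T : ℕ} {pt : ℕ → V}
  (D : Drawing p G n T pt)
include D

/-- An st-polygon is part of a box with the same source. -/
lemma exists_box_of_isStrong {W : Finset V} {u v : V}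
    (h : IsStrongSTPolygon p (addEdge G u v) W u v) :
    ∃ lo hi σ τ, D.ladder.IsBox lo hi σ τ ∧ vt n pt (σ, lo σ) = u ∧
      W ⊆ boxSet n T pt lo hi := by
  have hT := D.lt
  have ho := h.outerplanar
  have huW : u ∈ W := ((ho.source u).2 rfl).1
  have hvW : v ∈ W := ((ho.sink v).2 rfl).1
  have no_in : ∀ y ∈ W, ¬ G.Adj y u := fun y hy h1 => ((ho.source u).2 rfl).2 y hy (.inl h1)
  have no_out : ∀ y ∈ W, ¬ G.Adj v y := fun y hy h1 => ((ho.sink v).2 rfl).2 y hy (.inl h1)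
  have huv : u ≠ v := by
    rintro rfl
    exact ho.acyclic u (.single ⟨huW, huW, h.median⟩)
  have exists_in : ∀ x ∈ W, x ≠ u → x ≠ v → ∃ y ∈ W, G.Adj y x := by
    intro x hx h1 h2
    by_contra! h3
    refine h1 ((ho.source x).1 ⟨hx, fun y hy h4 => ?_⟩)
    rcases h4 with h4 | ⟨_, h4⟩
    · exact h3 y hy h4
    · exact h2 h4
  have exists_out : ∀ x ∈ W, x ≠ u → x ≠ v → ∃ y ∈ W, G.Adj x y := by
    intro x hx h1 h2
    by_contra! h3
    refine h2 ((ho.sink x).1 ⟨hx, fun y hy h4 => ?_⟩)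
    rcases h4 with h4 | ⟨h4, _⟩
    · exact h3 y hy h4
    · exact h1 h4
  -- The median, which may be missing in `G`, is not needed: remove `v`, which is the tail of no
  -- edge in the polygon. Then `u` is still the only source, and only edges of `G` remain.
  have reach_u : ∀ x ∈ W, x ≠ v → ReflTransGen G.Adj u x := by
    intro x hx hxv
    classical
    have := reach_of_unique_source (r := fun a b => a ∈ W ∧ a ≠ v ∧ G.Adj a b) (W := W.erase v)
      (s := u) (fun w hw => D.outerplanar.acyclic w (transGen_univ
        (TransGen.mono (p := G.Adj) (fun _ _ h => h.2.2) _ _ hw)))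
      (fun a b h => Finset.mem_erase.2 ⟨h.2.1, h.1⟩) ?_ x (Finset.mem_erase.2 ⟨hxv, hx⟩)
    · exact ReflTransGen.mono (p := G.Adj) (fun _ _ h => h.2.2) _ _ this
    · intro y hy h1
      by_contra h2
      obtain ⟨hyv, hyW⟩ := Finset.mem_erase.1 hy
      obtain ⟨z, hz, hzy⟩ := exists_in y hyW h2 hyv
      refine h1 z ⟨hz, ?_, hzy⟩
      rintro rfl
      exact no_out _ hyW hzy
  have reach_v : ∀ x ∈ W, x ≠ u → ReflTransGen G.Adj x v := by
    intro x hx hxv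
    classical
    have := reach_of_unique_source (r := fun b a => b ∈ W ∧ b ≠ u ∧ G.Adj a b) (W := W.erase u)
      (s := v) (fun w hw => D.outerplanar.acyclic w (transGen_univ (transGen_swap.1
        (TransGen.mono (p := Function.swap G.Adj) (fun _ _ h => h.2.2) _ _ hw))))
      (fun a b h => Finset.mem_erase.2 ⟨h.2.1, h.1⟩) ?_ x (Finset.mem_erase.2 ⟨hxv, hx⟩)
    · exact reflTransGen_swap.1
        (ReflTransGen.mono (p := Function.swap G.Adj) (fun _ _ h => h.2.2) _ _ this)
    · intro y hy h1
      by_contra h2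
      obtain ⟨hyv, hyW⟩ := Finset.mem_erase.1 hy
      obtain ⟨z, hz, hzy⟩ := exists_out y hyW hyv h2
      refine h1 z ⟨hz, ?_, hzy⟩
      rintro rfl
      exact no_in _ hyW hzy
  obtain ⟨a, ha, ha'⟩ := h.left
  obtain ⟨b, hb, hb'⟩ := h.right
  obtain ⟨⟨σ, i⟩, hi, rfl⟩ := D.exists_vt u
  obtain ⟨⟨τ, j⟩, hj, rfl⟩ := D.exists_vt v
  obtain ⟨x, hx, rfl⟩ := D.exists_vt a
  obtain ⟨y, hy, rfl⟩ := D.exists_vt b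
  have reach_uv : ReflTransGen G.Adj (vt n pt (σ, i)) (vt n pt (τ, j)) := by
    refine (reach_u _ ha ?_).trans (reach_v _ ha ?_)
    · intro h1; rw [h1, orient_self_right] at ha'; exact ha'.false
    · intro h1; rw [h1, orient_self_left] at ha'; exact ha'.false
  have ge : ∀ k < len n T σ, vt n pt (σ, k) ∈ W → i ≤ k := by
    intro k hk hkW
    by_cases hkv : vt n pt (σ, k) = vt n pt (τ, j)
    · exact Ladder.le_of_reach ((D.reach_iff hi hk).2 (by rw [hkv]; exact reach_uv))
    · exact Ladder.le_of_reach ((D.reach_iff hi hk).2 (reach_u _ hkW hkv))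
  have le : ∀ k < len n T τ, vt n pt (τ, k) ∈ W → k ≤ j := by
    intro k hk hkW
    by_cases hku : vt n pt (τ, k) = vt n pt (σ, i)
    · exact Ladder.le_of_reach ((D.reach_iff hk hj).2 (by rw [hku]; exact reach_uv))
    · exact Ladder.le_of_reach ((D.reach_iff hk hj).2 (reach_v _ hkW hku))
  have hij : pos n (σ, i) ≠ pos n (τ, j) := fun h1 => huv (by rw [vt, h1]; rfl)
  have hsep : Separates (pos n (σ, i)) (pos n (τ, j)) (pos n x) (pos n y) := by
    have h0 : ∀ z : Bool × ℕ, orient (p (vt n pt (σ, i))) (p (vt n pt (τ, j))) (p (vt n pt z)) ≠ 0 →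
        pos n z ≠ pos n (σ, i) ∧ pos n z ≠ pos n (τ, j) := by
      intro z hz
      constructor <;> intro h1 <;> apply hz
      · rw [vt, vt, vt, h1, orient_self_left]
      · rw [vt, vt, vt, h1, orient_self_right]
    have h1 := h0 x ha'.ne'
    have h2 := h0 y hb'.ne
    by_contra hno
    rcases D.orient_of_not_separates (pos_lt hT hi) (pos_lt hT hj) (pos_lt hT hx) (pos_lt hT hy)
      hij h1.1 h1.2 h2.1 h2.2 hno with h3 | h3
    · exact lt_asymm h3.2 hb'
    · exact lt_asymm h3.1 ha'
  -- the edges of the polygon do not cross its median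
  have nc : Noncrossing (fun a b => a < n ∧ b < n ∧ pt a ∈ W ∧ pt b ∈ W ∧
      (addEdge G (vt n pt (σ, i)) (vt n pt (τ, j))).Adj (pt a) (pt b)) := by
    intro a c b d hac hcb hbd h1 h2
    have h1' : a < n ∧ b < n ∧ pt a ∈ W ∧ pt b ∈ W := by
      rcases h1 with h | h <;> simp [h]
    have h2' : c < n ∧ d < n ∧ pt c ∈ W ∧ pt d ∈ W := by
      rcases h2 with h | h <;> simp [h]
    exact D.not_cross ho.planar hac hcb hbd h2'.2.1 h1'.2.2.1 h1'.2.2.2 h2'.2.2.1 h2'.2.2.2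
      (h1.imp (·.2.2.2.2) (·.2.2.2.2)) (h2.imp (·.2.2.2.2) (·.2.2.2.2))
  have hchord : ∀ k l, D.ladder.X σ k l → vt n pt (σ, k) ∈ W → vt n pt (!σ, l) ∈ W →
      ¬ Separates (pos n (σ, i)) (pos n (τ, j)) (pos n (σ, k)) (pos n (!σ, l)) := by
    intro k l hX hk hl
    have hd := hX.dom
    refine nc.not_separates (.inl ⟨pos_lt hT hi, pos_lt hT hj, huW, hvW, .inr ⟨rfl, rfl⟩⟩) ?_
    rcases hX with hX | hX
    · exact .inl ⟨pos_lt hT hd.1, pos_lt hT hd.2, hk, hl, .inl hX.2.2⟩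
    · exact .inr ⟨pos_lt hT hd.2, pos_lt hT hd.1, hl, hk, .inl hX.2.2⟩
  have poly : D.ladder.IsPoly (fun x => x.2 < len n T x.1 ∧ vt n pt x ∈ W) σ i τ j := by
    refine ⟨fun x hx => hx.1, ⟨hi, huW⟩, ⟨hj, hvW⟩, fun k hk => ge k hk.1 hk.2,
      fun k hk => le k hk.1 hk.2, ?_, ?_, fun y hy h1 => no_in _ hy.2 h1.2.2,
      fun y hy h1 => no_out _ hy.2 h1.2.2, ?_, ?_⟩
    · intro z hz h1 h2
      obtain ⟨w, hw, h3⟩ := exists_in _ hz.2 (fun h => h1 (D.vt_inj hz.1 hi h))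
        (fun h => h2 (D.vt_inj hz.1 hj h))
      obtain ⟨y, hy, rfl⟩ := D.exists_vt w
      exact ⟨y, ⟨hy, hw⟩, hy, hz.1, h3⟩
    · intro z hz h1 h2
      obtain ⟨w, hw, h3⟩ := exists_out _ hz.2 (fun h => h1 (D.vt_inj hz.1 hi h))
        (fun h => h2 (D.vt_inj hz.1 hj h))
      obtain ⟨y, hy, rfl⟩ := D.exists_vt w
      exact ⟨y, ⟨hy, hw⟩, hz.1, hy, h3⟩
    · intro k l hX hk hl
      have h1 := hchord k l hX hk.2 hl.2
      have h2 := ge k hk.1 hk.2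
      have h3 := hk.1
      have h4 := hl.1
      by_contra hno
      refine h1 ?_
      rcases Bool.eq_or_eq_not τ σ with rfl | rfl
      · have h5 := le k hk.1 hk.2
        simp only [true_and, Bool.eq_not_self, false_and, or_false, not_or] at hno
        clear * - hno h2 h3 h4 h5 hi hj hT
        cases τ <;> simp only [Bool.not_true, Bool.not_false, pos_true, pos_false, len_true,
          len_false] at * <;> unfold Separates <;> omega
      · have h5 := le l hl.1 hl.2
        simp only [true_and, Bool.not_eq_self, false_and, false_or, not_or] at hno
        clear * - hno h2 h3 h4 h5 hi hj hT
        cases σ <;> simp only [Bool.not_true, Bool.not_false, pos_true, pos_false, len_true,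
          len_false] at * <;> unfold Separates <;> omega
    · have key : ∀ k l, k < len n T σ → vt n pt (σ, k) ∈ W → l < len n T (!σ) →
          vt n pt (!σ, l) ∈ W →
          Separates (pos n (σ, i)) (pos n (τ, j)) (pos n (σ, k)) (pos n (!σ, l)) →
          ∃ k l, (k < len n T σ ∧ vt n pt (σ, k) ∈ W) ∧ (l < len n T (!σ) ∧ vt n pt (!σ, l) ∈ W) ∧
            i < k ∧ (τ = σ → k < j) ∧ (τ = !σ → l < j) := by
        intro k l hk hkW hl hlW hs
        refine ⟨k, l, ⟨hk, hkW⟩, ⟨hl, hlW⟩, lt_of_le_of_ne (ge k hk hkW) ?_, ?_, ?_⟩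
        · rintro rfl; exact hs.1 rfl
        · rintro rfl
          refine lt_of_le_of_ne (le k hk hkW) ?_
          rintro rfl; exact hs.2.1 rfl
        · rintro rfl
          refine lt_of_le_of_ne (le l hl hlW) ?_
          rintro rfl; exact hs.2.2.2.1 rfl
      obtain ⟨x1, k⟩ := x
      obtain ⟨y1, l⟩ := y
      -- Vertices of one chain cannot lie on different sides of the median, since the polygon has
      -- none below `u` on the chain of `u` and none above `v` on the chain of `v`.
      have same_side : x1 = y1 → False := by
        rintro rfl
        rcases Bool.eq_or_eq_not x1 σ with rfl | rfl
        · have h1 := ge k hx ha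
          have h2 := ge l hy hb
          rcases Bool.eq_or_eq_not τ x1 with rfl | rfl
          · have h3 := le k hx ha
            have h4 := le l hy hb
            clear * - hsep h1 h2 h3 h4 hx hy hi hj hT
            cases τ <;> simp only [pos_true, pos_false, len_true, len_false] at * <;>
              unfold Separates at * <;> omega
          · clear * - hsep h1 h2 hx hy hi hj hT
            cases x1 <;> simp only [Bool.not_true, Bool.not_false, pos_true, pos_false, len_true,
              len_false] at * <;> unfold Separates at * <;> omega
        · rcases Bool.eq_or_eq_not τ σ with rfl | rfl
          · clear * - hsep hx hy hi hj hT
            cases τ <;> simp only [Bool.not_true, Bool.not_false, pos_true, pos_false, len_true,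
              len_false] at * <;> unfold Separates at * <;> omega
          · have h3 := le k hx ha
            have h4 := le l hy hb
            clear * - hsep h3 h4 hx hy hi hj hT
            cases σ <;> simp only [Bool.not_true, Bool.not_false, pos_true, pos_false, len_true,
              len_false] at * <;> unfold Separates at * <;> omega
      rcases Bool.eq_or_eq_not x1 σ with rfl | rfl
      · rcases Bool.eq_or_eq_not y1 x1 with rfl | rfl
        · exact (same_side rfl).elim
        · exact key k l hx ha hy hb hsep
      · rcases Bool.eq_or_eq_not y1 σ with rfl | rfl
        · exact key l k hy hb hx ha (by unfold Separates at *; omega)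
        · exact (same_side rfl).elim
  obtain ⟨lo, hi', rfl, rfl, hb, hsub⟩ := poly.exists_box
  refine ⟨lo, hi', σ, τ, hb, rfl, fun w hw => ?_⟩
  obtain ⟨x, hx, rfl⟩ := D.exists_vt w
  exact (D.vt_mem_boxSet hx).2 (hsub x ⟨hx, hw⟩)

end Drawing

/-! ### The source determines the candidate. -/

namespace Ladder
variable {L : Ladder}

/-- The height `y` is the first one above `i` with an edge across, an edge entering it decides the
kind of the candidate, and all other data are extreme neighbours. -/
lemma Cand.unique {σ τ τ' : Bool} {i : ℕ} {lo hi lo' hi' : Bool → ℕ} (h : L.Cand σ i lo hi τ)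
    (h' : L.Cand σ i lo' hi' τ') : lo = lo' ∧ hi = hi' ∧ τ = τ' := by
  have aux : ∀ {f g : Bool → ℕ}, f σ = g σ → f (!σ) = g (!σ) → f = g := fun h1 h2 =>
    funext (forall_side σ h1 h2)
  have next_le : ∀ {y y' z z' : ℕ}, i < y → (∀ k l, i < k → k < y' → ¬ L.X σ k l) →
      L.X σ y z → y' ≤ y := fun h1 h2 h3 => not_lt.1 fun h4 => h2 _ _ h1 h4 h3
  cases h with
  | mk_same x y z con lo_eq hx max_x hlo min_lo hiy next con_x hz min_z hi_eq len htop max_top =>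
    cases h' with
    | mk_same x' y' z' con' lo_eq' hx' max_x' hlo' min_lo' hiy' next' con_x' hz' min_z' hi_eq'
        len' htop' max_top' =>
      have hyy : y = y' := le_antisymm (next_le (z' := 0) hiy' next (.inr hz')) (next_le (z' := 0) hiy next' (.inr hz))
      subst hyy
      exact ⟨aux (by omega) (le_antisymm (min_lo _ hlo') (min_lo' _ hlo)),
        aux (by omega) (le_antisymm (max_top' _ htop) (max_top _ htop')), rfl⟩
    | mk_opp x' y' z' con' lo_eq' hx' max_x' hlo' min_lo' hiy' next' con_x' no_in hz' min_z' hi_eq'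
        len' htop' max_top' =>
      have hyy : y = y' := le_antisymm (next_le (z' := 0) hiy' next (.inl hz')) (next_le (z' := 0) hiy next' (.inr hz))
      subst hyy
      exact absurd hz (no_in _)
  | mk_opp x y z con lo_eq hx max_x hlo min_lo hiy next con_x no_in hz min_z hi_eq len htop
      max_top =>
    cases h' with
    | mk_same x' y' z' con' lo_eq' hx' max_x' hlo' min_lo' hiy' next' con_x' hz' min_z' hi_eq'
        len' htop' max_top' =>
      have hyy : y = y' := le_antisymm (next_le (z' := 0) hiy' next (.inr hz')) (next_le (z' := 0) hiy next' (.inl hz))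
      subst hyy
      exact absurd hz' (no_in _)
    | mk_opp x' y' z' con' lo_eq' hx' max_x' hlo' min_lo' hiy' next' con_x' no_in' hz' min_z' hi_eq'
        len' htop' max_top' =>
      have hyy : y = y' := le_antisymm (next_le (z' := 0) hiy' next (.inl hz')) (next_le (z' := 0) hiy next' (.inl hz))
      subst hyy
      have hzz : z = z' := le_antisymm (min_z _ hz') (min_z' _ hz)
      subst hzz
      exact ⟨aux (by omega) (le_antisymm (min_lo _ hlo') (min_lo' _ hlo)),
        aux (le_antisymm (max_top' _ htop) (max_top _ htop')) (by omega), rfl⟩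

lemma IsBox.lo_lt_hi {σ τ : Bool} {lo hi : Bool → ℕ} (h : L.IsBox lo hi σ τ) : lo σ < hi σ := by
  rcases Bool.eq_or_eq_not τ σ with h1 | h1
  · have := h.same h1; omega
  · exact (h.opp h1).1

end Ladder

/-! ### Sets on two sides of a line. -/

section Separation

lemma orient_add_smul (a b x : ℝ × ℝ) (ε : ℝ) :
    orient a b (x + ε • (-(b.2 - a.2), b.1 - a.1)) =
      orient a b x + ε * ((b.1 - a.1) ^ 2 + (b.2 - a.2) ^ 2) := by
  simp only [orient, Prod.fst_add, Prod.snd_add, Prod.smul_fst, Prod.smul_snd, smul_eq_mul]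
  ring

/-- A small move in the normal direction changes `orient a b`, so it leaves the line. -/
lemma interior_line_eq_empty {a b : ℝ × ℝ} (hab : a ≠ b) :
    interior {x | orient a b x = 0} = ∅ := by
  rw [Set.eq_empty_iff_forall_notMem]
  intro x hx
  have h1 : 0 < (b.1 - a.1) ^ 2 + (b.2 - a.2) ^ 2 := by
    by_contra h2
    refine hab (Prod.ext ?_ ?_) <;> nlinarith [sq_nonneg (b.1 - a.1), sq_nonneg (b.2 - a.2)]
  have h2 : Filter.Tendsto (fun ε : ℝ => x + ε • (-(b.2 - a.2), b.1 - a.1)) (nhds 0) (nhds x) := by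
    have : Continuous fun ε : ℝ => x + ε • (-(b.2 - a.2), b.1 - a.1) := by fun_prop
    simpa using this.tendsto 0
  have h3 := h2.eventually (mem_interior_iff_mem_nhds.1 hx)
  obtain ⟨ε, h4, h5⟩ := ((h3.filter_mono nhdsWithin_le_nhds).and
    (self_mem_nhdsWithin (a := (0 : ℝ)) (s := Set.Ioi 0))).exists
  have h6 : x ∈ {x | orient a b x = 0} := interior_subset hx
  simp only [Set.mem_ofPred_eq] at h6
  simp only [orient_add_smul, h6, zero_add] at h4
  rcases mul_eq_zero.1 h4 with h7 | h7
  · exact (ne_of_gt h5) h7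
  · exact h1.ne' h7

/-- The common part of the hulls is contained in the line, which has no interior. -/
lemma disjoint_interior_of_line {a b : ℝ × ℝ} (hab : a ≠ b) {s t : Set (ℝ × ℝ)}
    (hs : ∀ x ∈ s, 0 ≤ orient a b x) (ht : ∀ x ∈ t, orient a b x ≤ 0) :
    Disjoint (interior (convexHull ℝ s)) (interior (convexHull ℝ t)) := by
  have hs' : convexHull ℝ s ⊆ {x | 0 ≤ orient a b x} := by
    refine convexHull_min hs ?_
    intro x hx y hy c d hc hd hcd
    simp only [Set.mem_ofPred_eq, orient_combo _ _ _ _ hcd] at *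
    positivity
  have ht' : convexHull ℝ t ⊆ {x | orient a b x ≤ 0} := by
    refine convexHull_min ht ?_
    intro x hx y hy c d hc hd hcd
    simp only [Set.mem_ofPred_eq, orient_combo _ _ _ _ hcd] at *
    nlinarith
  rw [Set.disjoint_iff_inter_eq_empty, ← interior_inter, ← Set.subset_empty_iff,
    ← interior_line_eq_empty hab]
  exact interior_mono fun x hx => le_antisymm (ht' hx.2) (hs' hx.1)

end Separation

/-! ### Maximal st-polygons, their order and their regions. -/

namespace Drawing
variable {V : Type*} [Fintype V] {p : V → ℝ × ℝ} {G : Digraph V} {n T : ℕ} {pt : ℕ → V}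
  (D : Drawing p G n T pt)
include D

/-- Separated boxes have at most one height per side in common, but a box has at least two heights
on the side of its source. -/
lemma cand_not_subset {σ τ σ' τ' : Bool} {i i' : ℕ} {lo hi lo' hi' : Bool → ℕ}
    (h : D.ladder.Cand σ i lo hi τ) (h' : D.ladder.Cand σ' i' lo' hi' τ')
    (hne : (σ, i) ≠ (σ', i')) : ¬ boxSet n T pt lo hi ⊆ boxSet n T pt lo' hi' := by
  intro hsub
  have hb := h.isBox
  have hlt := hb.lo_lt_hi
  have hhi : hi σ < len n T σ := hb.hi_lt σ
  have h1 := (D.vt_mem_boxSet (x := (σ, lo σ)) (hlt.trans hhi)).1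
    (hsub ((D.vt_mem_boxSet (x := (σ, lo σ)) (hlt.trans hhi)).2 ⟨le_rfl, hlt.le⟩))
  have h2 := (D.vt_mem_boxSet (x := (σ, hi σ)) hhi).1
    (hsub ((D.vt_mem_boxSet (x := (σ, hi σ)) hhi).2 ⟨hlt.le, le_rfl⟩))
  simp only at h1 h2
  rcases h.separated h' hne with h3 | h3
  · have := h3 σ; omega
  · have := h3 σ; omega

/-- Every polygon is inside a box, hence inside a candidate; candidates are polygons themselves, and
none contains another. -/
lemma isMaximal_iff {W : Finset V} : IsMaximalSTPolygon p G W ↔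
    ∃ σ i lo hi τ, D.ladder.Cand σ i lo hi τ ∧ W = boxSet n T pt lo hi := by
  have poly : ∀ {σ i lo hi τ}, D.ladder.Cand σ i lo hi τ → IsSTPolygon p G (boxSet n T pt lo hi) :=
    fun h => isSTPolygon_of_addEdge (D.isStrong_of_isBox h.isBox)
  have exists_cand : ∀ {W}, IsSTPolygon p G W →
      ∃ σ i lo hi τ, D.ladder.Cand σ i lo hi τ ∧ W ⊆ boxSet n T pt lo hi := by
    intro W hW
    obtain ⟨u, v, h⟩ := exists_addEdge_of_isSTPolygon hW
    obtain ⟨lo, hi, σ, τ, hb, rfl, hsub⟩ := D.exists_box_of_isStrong h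
    obtain ⟨lo', hi', hc, hle⟩ := hb.exists_cand
    refine ⟨σ, _, lo', hi', τ, hc, fun w hw => ?_⟩
    obtain ⟨x, hx, h1, h2, h3⟩ := mem_boxSet.1 (hsub hw)
    exact mem_boxSet.2 ⟨x, hx, h1, (hle _).1.trans h2, h3.trans (hle _).2⟩
  constructor
  · intro hW
    obtain ⟨σ, i, lo, hi, τ, hc, hsub⟩ := exists_cand hW.prop
    exact ⟨σ, i, lo, hi, τ, hc, hW.eq_of_le (poly hc) hsub⟩
  · rintro ⟨σ, i, lo, hi, τ, hc, rfl⟩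
    refine ⟨poly hc, fun W hW hsub => ?_⟩
    obtain ⟨σ', i', lo', hi', τ', hc', hsub'⟩ := exists_cand hW
    by_cases hne : (σ, i) = (σ', i')
    · obtain ⟨rfl, rfl⟩ := Prod.mk.inj hne
      obtain ⟨rfl, rfl, rfl⟩ := hc.unique hc'
      exact hsub'
    · exact absurd (hsub.trans hsub') (D.cand_not_subset hc hc' hne)

/-- the coordinates of the representative of a piece -/
def IsPieceAt (D : Drawing p G n T pt) (x : Bool × ℕ) : Piece V → Prop
  | .polygon W => ∃ lo hi τ, D.ladder.Cand x.1 x.2 lo hi τ ∧ W = boxSet n T pt lo hi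
  | .free v => v = vt n pt x ∧ x.2 < len n T x.1 ∧
      ∀ σ i lo hi τ, D.ladder.Cand σ i lo hi τ → ¬ (lo x.1 ≤ x.2 ∧ x.2 ≤ hi x.1)

lemma isPiece_iff {P : Piece V} : IsPiece p G P ↔ ∃ x, D.IsPieceAt x P := by
  cases P with
  | polygon W =>
    simp only [IsPiece, D.isMaximal_iff, IsPieceAt]
    exact ⟨fun ⟨σ, i, h⟩ => ⟨(σ, i), h⟩, fun ⟨x, h⟩ => ⟨x.1, x.2, h⟩⟩
  | free v =>
    simp only [IsPiece, IsFreeVertex, D.isMaximal_iff, IsPieceAt]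
    constructor
    · intro h
      obtain ⟨x, hx, rfl⟩ := D.exists_vt v
      exact ⟨x, rfl, hx, fun σ i lo hi τ hc h1 => h _ ⟨σ, i, lo, hi, τ, hc, rfl⟩
        ((D.vt_mem_boxSet hx).2 h1)⟩
    · rintro ⟨x, rfl, hx, h⟩ W ⟨σ, i, lo, hi, τ, hc, rfl⟩ hW
      exact h _ _ _ _ _ hc ((D.vt_mem_boxSet hx).1 hW)

variable {D}

lemma IsPieceAt.dom {x : Bool × ℕ} {P : Piece V} (h : D.IsPieceAt x P) : x.2 < len n T x.1 := by
  cases P with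
  | polygon W =>
    obtain ⟨lo, hi, τ, hc, rfl⟩ := h
    exact (D.ladder.dom hc.isBox.bot).1 |>.trans_le' (by rw [hc.lo_eq])
  | free v => exact h.2.1

lemma IsPieceAt.rep {x : Bool × ℕ} {P : Piece V} (h : D.IsPieceAt x P) {r : V} :
    IsRepresentative G P r ↔ r = vt n pt x := by
  cases P with
  | polygon W =>
    obtain ⟨lo, hi, τ, hc, rfl⟩ := h
    rw [IsRepresentative, D.isSource_boxSet hc.isBox, hc.lo_eq]
  | free v => rw [IsRepresentative, h.1]

lemma IsPieceAt.inj {x : Bool × ℕ} {P Q : Piece V} (h : D.IsPieceAt x P) (h' : D.IsPieceAt x Q) :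
    P = Q := by
  have key : ∀ {W v}, D.IsPieceAt x (.polygon W) → ¬ D.IsPieceAt x (.free v) := by
    rintro W v ⟨lo, hi, τ, hc, rfl⟩ ⟨rfl, _, hno⟩
    have := hc.lo_eq
    exact hno _ _ _ _ _ hc ⟨this.le, by have := hc.isBox.le x.1; omega⟩
  cases P with
  | polygon W =>
    cases Q with
    | polygon W' =>
      obtain ⟨lo, hi, τ, hc, rfl⟩ := h
      obtain ⟨lo', hi', τ', hc', rfl⟩ := h'
      obtain ⟨rfl, rfl, rfl⟩ := hc.unique hc'
      rfl
    | free v => exact absurd h' (key h)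
  | free v =>
    cases Q with
    | polygon W' => exact absurd h (key h')
    | free v => rw [h.1, h'.1]

lemma IsPieceAt.comparable {x y : Bool × ℕ} {P Q : Piece V} (h : D.IsPieceAt x P)
    (h' : D.IsPieceAt y Q) : D.ladder.Reach x y ∨ D.ladder.Reach y x := by
  cases P with
  | free v => exact Ladder.comparable_of_not_cand h.dom h'.dom h.2.2
  | polygon W =>
    cases Q with
    | free v => exact (Ladder.comparable_of_not_cand h'.dom h.dom h'.2.2).symm
    | polygon W' =>
      obtain ⟨lo, hi, τ, hc, rfl⟩ := h
      obtain ⟨lo', hi', τ', hc', rfl⟩ := h'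
      exact hc.comparable hc'

variable (D)

lemma precedes_iff {x y : Bool × ℕ} {P Q : Piece V} (h : D.IsPieceAt x P)
    (h' : D.IsPieceAt y Q) : Precedes G P Q ↔ x ≠ y ∧ D.ladder.Reach x y := by
  rw [Precedes]
  constructor
  · rintro ⟨hne, a, b, ha, hb, hr⟩
    obtain rfl := h.rep.1 ha
    obtain rfl := h'.rep.1 hb
    refine ⟨?_, (D.reach_iff h.dom h'.dom).2 hr⟩
    rintro rfl
    exact hne (h.inj h')
  · rintro ⟨hne, hr⟩
    refine ⟨?_, _, _, h.rep.2 rfl, h'.rep.2 rfl, (D.reach_iff h.dom h'.dom).1 hr⟩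
    rintro rfl
    exact hne (D.vt_inj h.dom h'.dom (h'.rep.1 (h.rep.2 rfl)))

lemma isStrictTotalOrder :
    IsStrictTotalOrder {x : Piece V // IsPiece p G x} (fun x y => Precedes G x y) := by
  have irr : ∀ a : {x : Piece V // IsPiece p G x}, ¬ Precedes G (a : Piece V) a :=
    fun a h => h.1 rfl
  refine { trichotomous := ?_, irrefl := irr, trans := ?_ }
  · rintro ⟨P, hP⟩ ⟨Q, hQ⟩ h1 h2
    obtain ⟨x, hx⟩ := D.isPiece_iff.1 hP
    obtain ⟨y, hy⟩ := D.isPiece_iff.1 hQ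
    simp only [D.precedes_iff hx hy, D.precedes_iff hy hx] at h1 h2
    by_cases hxy : x = y
    · subst hxy
      exact Subtype.ext (hx.inj hy)
    · rcases hx.comparable hy with h | h
      · exact absurd ⟨hxy, h⟩ h1
      · exact absurd ⟨Ne.symm hxy, h⟩ h2
  · rintro ⟨P, hP⟩ ⟨Q, hQ⟩ ⟨S, hS⟩
    obtain ⟨x, hx⟩ := D.isPiece_iff.1 hP
    obtain ⟨y, hy⟩ := D.isPiece_iff.1 hQ
    obtain ⟨z, hz⟩ := D.isPiece_iff.1 hS
    simp only [D.precedes_iff hx hy, D.precedes_iff hy hz, D.precedes_iff hx hz]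
    rintro ⟨h1, h2⟩ ⟨h3, h4⟩
    refine ⟨?_, h2.trans h4⟩
    rintro rfl
    exact h1 (Ladder.reach_antisymm h2 h4)

/-- The line through the top vertices of the lower box on both sides separates: in boundary
positions, the upper box lies between these two vertices and the lower box outside, up to the two
vertices themselves. -/
lemma areaDisjoint_of_le {lo hi lo' hi' : Bool → ℕ} (hhi : ∀ ρ, hi ρ < len n T ρ)
    (h : ∀ ρ, hi ρ ≤ lo' ρ) : AreaDisjoint p (boxSet n T pt lo hi) (boxSet n T pt lo' hi') := by
  have hT := D.lt
  have h1 := hhi false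
  have h2 := hhi true
  have hne : p (pt (hi false)) ≠ p (pt (n - 1 - hi true)) := by
    intro h3
    have := D.inj (i := hi false) (j := n - 1 - hi true) (by simp at h1 h2; omega) (by omega)
      (D.outerplanar.injOn (by simp) (by simp) h3)
    simp at h1 h2; omega
  simp only [len_true, len_false] at h1 h2
  refine disjoint_interior_of_line hne ?_ ?_
  · rintro _ ⟨v, hv, rfl⟩
    obtain ⟨⟨ρ, k⟩, hk, rfl, h3, h4⟩ := mem_boxSet.1 (Finset.mem_coe.1 hv)
    by_cases hq : pos n (ρ, k) = hi false ∨ pos n (ρ, k) = n - 1 - hi true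
    · rcases hq with hq | hq
      · rw [vt, hq, orient_self_left]
      · rw [vt, hq, orient_self_right]
    · refine (D.orient_pos_of_not_between (i := hi false) (j := n - 1 - hi true) (by omega) ?_
        (by omega) (pos_lt hT hk)).le
      cases ρ <;> simp at * <;> omega
  · rintro _ ⟨v, hv, rfl⟩
    obtain ⟨⟨ρ, k⟩, hk, rfl, h3, h4⟩ := mem_boxSet.1 (Finset.mem_coe.1 hv)
    have h5 := h ρ
    by_cases hq : pos n (ρ, k) = hi false ∨ pos n (ρ, k) = n - 1 - hi true
    · rcases hq with hq | hq
      · rw [vt, hq, orient_self_left]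
      · rw [vt, hq, orient_self_right]
    · refine (D.orient_neg_of_between (i := hi false) (j := n - 1 - hi true) ?_ ?_ (by omega)).le
        <;> cases ρ <;> simp at * <;> omega

lemma areaDisjoint {W W' : Finset V} (hW : IsMaximalSTPolygon p G W)
    (hW' : IsMaximalSTPolygon p G W') (hne : W ≠ W') : AreaDisjoint p W W' := by
  obtain ⟨σ, i, lo, hi, τ, hc, rfl⟩ := D.isMaximal_iff.1 hW
  obtain ⟨σ', i', lo', hi', τ', hc', rfl⟩ := D.isMaximal_iff.1 hW'
  by_cases h : (σ, i) = (σ', i')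
  · obtain ⟨rfl, rfl⟩ := Prod.mk.inj h
    obtain ⟨rfl, rfl, rfl⟩ := hc.unique hc'
    exact absurd rfl hne
  · rcases hc.separated hc' h with h1 | h1
    · exact D.areaDisjoint_of_le hc.isBox.hi_lt h1
    · exact (D.areaDisjoint_of_le hc'.isBox.hi_lt h1).symm

end Drawing

/-- the list `b`, read cyclically from position `S` on -/
def cyclicGet {V : Type*} (b : List V) (S : ℕ) (d : V) (q : ℕ) : V := b.getD ((S + q) % b.length) d

/-! ### Drawings from boundary lists with an arbitrary starting point. -/

section
variable {V : Type*} [Fintype V] {p : V → ℝ × ℝ} {b : List V} {d : V} {S : ℕ}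

omit [Fintype V] in
lemma cyclicGet_eq {q : ℕ} (hS : S < b.length) (hq : q < b.length) :
    cyclicGet b S d q = if h : S + q < b.length then b[S + q] else b[S + q - b.length] := by
  rw [cyclicGet]
  split_ifs with h
  · rw [Nat.mod_eq_of_lt h, List.getD_eq_getElem _ _ h]
  · rw [Nat.mod_eq_sub_mod (not_lt.1 h), Nat.mod_eq_of_lt (by omega),
      List.getD_eq_getElem _ _ (by omega)]

lemma IsBoundary.placement (hb : IsBoundary p Finset.univ b) (hS : S < b.length) :
    Placement p b.length (cyclicGet b S d) := by
  refine ⟨fun {i j} hi hj h => ?_, fun v => ?_, fun {i j k} hij hjk hk => ?_⟩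
  · have h2 := fun {i j} hi hj => (hb.nodup.getElem_inj_iff (i := i) (hi := hi) (j := j)
      (hj := hj)).1
    rw [cyclicGet_eq hS hi, cyclicGet_eq hS hj] at h
    split_ifs at h <;> have := h2 _ _ h <;> omega
  · obtain ⟨i, hi, rfl⟩ := List.mem_iff_getElem.1 ((hb.mem_iff v).2 (Finset.mem_univ _))
    by_cases h : S ≤ i
    · refine ⟨i - S, by omega, ?_⟩
      rw [cyclicGet_eq hS (by omega), dif_pos (by omega)]
      congr 1; omega
    · refine ⟨i + b.length - S, by omega, ?_⟩
      rw [cyclicGet_eq hS (by omega), dif_neg (by omega)]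
      congr 1; omega
  · have h2 := List.triplewise_iff_getElem.1 hb.ccw
    rw [cyclicGet_eq hS (by omega), cyclicGet_eq hS (by omega), cyclicGet_eq hS (by omega)]
    by_cases h3 : S + k < b.length
    · rw [dif_pos (by omega), dif_pos (by omega), dif_pos h3]
      exact h2 _ _ _ (by omega) (by omega) _
    rw [dif_neg h3]
    by_cases h4 : S + j < b.length
    · rw [dif_pos (by omega), dif_pos h4, orient_rotate]
      exact h2 _ _ _ (by omega) (by omega) _
    rw [dif_neg h4]
    by_cases h5 : S + i < b.length
    · rw [dif_pos h5, ← orient_rotate]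
      exact h2 _ _ _ (by omega) (by omega) _
    · rw [dif_neg h5]
      exact h2 _ _ _ (by omega) (by omega) _

/-- the drawing given by a boundary list in which `S` is the position of the source and `T'` the
position of the sink -/
lemma IsBoundary.drawing {G : Digraph V} {s t : V} {T' : ℕ} (hb : IsBoundary p Finset.univ b)
    (hG : IsOuterplanarSTDigraph p G Finset.univ s t) (hS : S < b.length) (hT : T' < b.length)
    (hs : b[S] = s) (ht : b[T'] = t) :
    Drawing p G b.length (if T' < S then T' + b.length - S else T' - S) (cyclicGet b S d) := by
  refine ⟨hb.placement hS, by split_ifs <;> omega, ?_⟩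
  have e1 : cyclicGet b S d 0 = s := by
    rw [cyclicGet_eq hS (by omega), dif_pos (by omega), ← hs]; rfl
  have e2 : cyclicGet b S d (if T' < S then T' + b.length - S else T' - S) = t := by
    rw [cyclicGet_eq hS (by split_ifs <;> omega), ← ht]
    split_ifs
    · omega
    · congr 1; omega
    · congr 1; omega
    · omega
  rwa [e1, e2]

end

lemma exists_drawing {V : Type*} [Fintype V] {p : V → ℝ × ℝ} {G : Digraph V} {s t : V}
    (hG : IsOuterplanarSTDigraph p G Finset.univ s t) : ∃ n T pt, Drawing p G n T pt := by
  obtain ⟨b, hb⟩ := hG.convex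
  obtain ⟨S, hS, hs⟩ := List.mem_iff_getElem.1 ((hb.mem_iff s).2 (Finset.mem_univ _))
  obtain ⟨T, hT, ht⟩ := List.mem_iff_getElem.1 ((hb.mem_iff t).2 (Finset.mem_univ _))
  exact ⟨_, _, _, hb.drawing (d := s) hG hS hT hs ht⟩

/-! ## Reasoning about programs -/

/-- The program, started in `σ`, halts within `C` steps in a state that satisfies `Q`. -/
def Exec (B : ℕ) (P : Program) (σ : MachineState) (C : ℕ) (Q : MachineState → Prop) : Prop :=
  ∃ k τ, Runs B P σ k τ ∧ k ≤ C ∧ Q τ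

namespace Exec
variable {B C C₁ C₂ : ℕ} {P P' : Program} {σ : MachineState} {Q R : MachineState → Prop}

lemma mono (h : Exec B P σ C₁ Q) (hC : C₁ ≤ C) (hQ : ∀ τ, Q τ → R τ) : Exec B P σ C R :=
  let ⟨k, τ, h1, h2, h3⟩ := h
  ⟨k, τ, h1, h2.trans hC, hQ τ h3⟩

lemma seq (h : Exec B P σ C₁ Q) (h' : ∀ τ, Q τ → Exec B P' τ C₂ R) (hC : C₁ + C₂ + 1 ≤ C) :
    Exec B (.seq P P') σ C R := by
  obtain ⟨k, τ, h1, h2, h3⟩ := h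
  obtain ⟨l, υ, h4, h5, h6⟩ := h' τ h3
  exact ⟨_, υ, .seq h1 h4, by omega, h6⟩

/-- `Φ` is a potential that pays for each round and its test. The bound for a round may depend on
the state, so expensive rounds can be amortized. -/
lemma whileLt {e₁ e₂ : Expr} {Inv : MachineState → Prop} {Φ : MachineState → ℕ} (hσ : Inv σ)
    (step : ∀ τ, Inv τ → e₁.eval τ < e₂.eval τ → ∃ C, Exec B P τ C fun υ =>
      Inv υ ∧ C + (e₁.cost + e₂.cost + 1) + Φ υ ≤ Φ τ)
    (hC : Φ σ + (e₁.cost + e₂.cost + 1) ≤ C) :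
    Exec B (.whileLt e₁ e₂ P) σ C fun τ => Inv τ ∧ ¬ e₁.eval τ < e₂.eval τ := by
  induction hm : Φ σ using Nat.strong_induction_on generalizing σ C with
  | _ m ih =>
    by_cases h : e₁.eval σ < e₂.eval σ
    · obtain ⟨C', k, τ, h1, h2, h3, h4⟩ := step σ hσ h
      obtain ⟨l, υ, h5, h6, h7⟩ := ih (Φ τ) (by omega) h3 le_rfl rfl
      exact ⟨_, υ, .whileTrue h h1 h5, by omega, h7⟩
    · exact ⟨_, σ, .whileFalse h, by omega, hσ, h⟩

end Exec

namespace Program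

/-- a bound for the number of steps of a program without loops -/
def cost : Program → ℕ
  | .skip => 1
  | .assign _ e => e.cost + 1
  | .write _ i e => i.cost + e.cost + 1
  | .seq P Q => P.cost + Q.cost + 1
  | .ifLt e₁ e₂ P Q => e₁.cost + e₂.cost + max P.cost Q.cost + 1
  | .whileLt _ _ _ => 0

/-- weakest precondition of a program without loops -/
def wp (B : ℕ) : Program → (MachineState → Prop) → MachineState → Prop
  | .skip, Q, σ => Q σ
  | .assign r e, Q, σ => e.eval σ ≤ B ∧ Q (σ.setReg r (e.eval σ))
  | .write a i e, Q, σ => i.eval σ ≤ B ∧ e.eval σ ≤ B ∧ Q (σ.setArr a (i.eval σ) (e.eval σ))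
  | .seq P P', Q, σ => P.wp B (P'.wp B Q) σ
  | .ifLt e₁ e₂ P P', Q, σ =>
    (e₁.eval σ < e₂.eval σ → P.wp B Q σ) ∧ (¬ e₁.eval σ < e₂.eval σ → P'.wp B Q σ)
  | .whileLt _ _ _, _, _ => False

lemma wp.exec {B : ℕ} {P : Program} {Q : MachineState → Prop} {σ : MachineState}
    (h : P.wp B Q σ) : Exec B P σ P.cost Q := by
  induction P generalizing Q σ with
  | skip => exact ⟨_, _, .skip σ, le_rfl, h⟩
  | assign r e => exact ⟨_, _, .assign σ r e h.1, le_rfl, h.2⟩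
  | write a i e => exact ⟨_, _, .write σ a i e h.1 h.2.1, le_rfl, h.2.2⟩
  | seq P P' ih ih' => exact (ih h).seq (fun τ hτ => ih' hτ) le_rfl
  | ifLt e₁ e₂ P P' ih ih' =>
    by_cases hlt : e₁.eval σ < e₂.eval σ
    · obtain ⟨k, τ, h1, h2, h3⟩ := ih (h.1 hlt)
      exact ⟨_, τ, .ifTrue hlt h1, by simp only [cost]; omega, h3⟩
    · obtain ⟨k, τ, h1, h2, h3⟩ := ih' (h.2 hlt)
      exact ⟨_, τ, .ifFalse hlt h1, by simp only [cost]; omega, h3⟩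
  | whileLt => exact h.elim

/-- `for r := 0, 1, …` while `r` is less than the value of `e` -/
def forLt (r : ℕ) (e : Expr) (P : Program) : Program :=
  .seq (.assign r (.const 0))
    (.whileLt (.reg r) e (.seq P (.assign r (.add (.reg r) (.const 1)))))

end Program

namespace MachineState

variable (σ : MachineState)

lemma setReg_reg (r x s : ℕ) : (σ.setReg r x).reg s = if s = r then x else σ.reg s := by
  simp [setReg, Function.update_apply]

@[simp] lemma setReg_arr (r x : ℕ) : (σ.setReg r x).arr = σ.arr := rfl

@[simp] lemma setArr_reg (a i x : ℕ) : (σ.setArr a i x).reg = σ.reg := rfl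

lemma setArr_arr (a i x c j : ℕ) :
    (σ.setArr a i x).arr c j = if c = a ∧ j = i then x else σ.arr c j := by
  simp only [setArr, Function.update_apply]
  by_cases h : c = a <;> by_cases h' : j = i <;> simp [h, h']

/-- `τ` agrees with `σ` except for the arrays in `A` and the registers in `R`. -/
def Same (A R : List ℕ) (σ τ : MachineState) : Prop :=
  (∀ a, a ∉ A → τ.arr a = σ.arr a) ∧ ∀ r, r ∉ R → τ.reg r = σ.reg r

variable {σ}

lemma Same.refl (A R : List ℕ) (σ : MachineState) : Same A R σ σ := ⟨fun _ _ => rfl, fun _ _ => rfl⟩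

lemma Same.trans {A R A' R' : List ℕ} {σ τ υ : MachineState} (h : Same A R σ τ)
    (h' : Same A' R' τ υ) : Same (A ++ A') (R ++ R') σ υ := by
  refine ⟨fun a ha => ?_, fun r hr => ?_⟩
  · rw [List.mem_append, not_or] at ha
    rw [h'.1 a ha.2, h.1 a ha.1]
  · rw [List.mem_append, not_or] at hr
    rw [h'.2 r hr.2, h.2 r hr.1]

lemma Same.mono {A R A' R' : List ℕ} {σ τ : MachineState} (h : Same A R σ τ)
    (hA : A ⊆ A') (hR : R ⊆ R') : Same A' R' σ τ :=
  ⟨fun a ha => h.1 a fun h' => ha (hA h'), fun r hr => h.2 r fun h' => hr (hR h')⟩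

lemma Same.setReg {A R : List ℕ} {σ τ : MachineState} (h : Same A R σ τ) {r : ℕ} (hr : r ∈ R)
    (x : ℕ) : Same A R σ (τ.setReg r x) := by
  refine ⟨h.1, fun s hs => ?_⟩
  rw [setReg_reg, if_neg (by rintro rfl; exact hs hr), h.2 s hs]

lemma Same.setArr {A R : List ℕ} {σ τ : MachineState} (h : Same A R σ τ) {a : ℕ} (ha : a ∈ A)
    (i x : ℕ) : Same A R σ (τ.setArr a i x) := by
  refine ⟨fun c hc => ?_, h.2⟩
  rw [← h.1 c hc, MachineState.setArr]
  exact Function.update_of_ne (by rintro rfl; exact hc ha) _ _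

end MachineState

open MachineState

/-- The body must preserve the counter. A round costs `C` for the body, `4` for the increment, `1`
for sequencing and `e.cost + 2` for the test. -/
lemma Exec.forLt {B C N r : ℕ} {P : Program} {e : Expr} {σ : MachineState}
    (Inv : ℕ → MachineState → Prop) (h0 : Inv 0 (σ.setReg r 0)) (hN : N ≤ B)
    (he : ∀ i τ, Inv i τ → τ.reg r = i → e.eval τ = N)
    (step : ∀ i < N, ∀ τ, Inv i τ → τ.reg r = i →
      Exec B P τ C fun υ => υ.reg r = i ∧ Inv (i + 1) (υ.setReg r (i + 1))) :
    Exec B (Program.forLt r e P) σ (N * (C + e.cost + 7) + e.cost + 5)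
      fun τ => Inv N τ := by
  refine Exec.seq (C₁ := 2) (C₂ := N * (C + e.cost + 7) + (e.cost + 2))
    (Q := fun τ => τ = σ.setReg r 0) ⟨_, _, .assign σ r (.const 0) (Nat.zero_le _), le_rfl, rfl⟩
    ?_ (by omega)
  rintro _ rfl
  refine (Exec.whileLt (Inv := fun τ => Inv (τ.reg r) τ ∧ τ.reg r ≤ N)
    (Φ := fun τ => (N - τ.reg r) * (C + e.cost + 7)) ?_ ?_ ?_).mono le_rfl ?_
  · exact ⟨by simpa [setReg_reg] using h0, by simp [setReg_reg]⟩
  · rintro τ ⟨hI, hle⟩ hlt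
    have e1 := he _ _ hI rfl
    simp only [Expr.eval, e1] at hlt
    refine ⟨C + 5, (step _ hlt τ hI rfl).seq (C₂ := 4) (fun υ hυ => ?_) le_rfl⟩
    refine Program.wp.exec (P := .assign r (.add (.reg r) (.const 1))) ?_
    simp only [Program.wp, Expr.eval, hυ.1]
    refine ⟨by omega, ⟨by simpa [setReg_reg] using hυ.2, by simp [setReg_reg]; omega⟩, ?_⟩
    simp only [setReg_reg, if_true, Expr.cost]
    obtain ⟨d, hd⟩ : ∃ d, N - τ.reg r = d + 1 := ⟨N - τ.reg r - 1, by omega⟩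
    rw [hd, show N - (τ.reg r + 1) = d by omega]
    ring_nf; omega
  · simp only [setReg_reg, if_true, Expr.cost]
    rw [Nat.sub_zero]; omega
  · rintro τ ⟨⟨hI, hle⟩, hlt⟩
    have e1 := he _ _ hI rfl
    simp only [Expr.eval, e1] at hlt
    rwa [show τ.reg r = N by omega] at hI

/-! ## The program -/

namespace Decompose
open MachineState Program

/-- mark the vertices with an in-edge in array 4 and those with an out-edge in array 5 -/
def markEnds : Program := forLt 5 (.reg 1) (.seq
  (.write 4 (.read 2 (.reg 5)) (.const 1))
  (.write 5 (.read 1 (.reg 5)) (.const 1)))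

/-- find the positions on the boundary of the source and the sink -/
def findEnds : Program := forLt 5 (.reg 0) (.seq
  (.ifLt (.read 4 (.read 0 (.reg 5))) (.const 1) (.assign 2 (.reg 5)) .skip)
  (.ifLt (.read 5 (.read 0 (.reg 5))) (.const 1) (.assign 3 (.reg 5)) .skip))

/-- compute the lengths of the two chains -/
def splitEnds : Program := .seq
  (.ifLt (.reg 3) (.reg 2) (.assign 3 (.sub (.add (.reg 3) (.reg 0)) (.reg 2)))
    (.assign 3 (.sub (.reg 3) (.reg 2))))
  (.assign 4 (.sub (.reg 0) (.reg 3)))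

/-- compute the side and the height of each vertex, and list the vertices of each side -/
def place : Program := forLt 5 (.reg 0) (.seq
  (.ifLt (.add (.reg 2) (.reg 5)) (.reg 0) (.assign 6 (.read 0 (.add (.reg 2) (.reg 5))))
    (.assign 6 (.read 0 (.sub (.add (.reg 2) (.reg 5)) (.reg 0)))))
  (.ifLt (.reg 5) (.reg 3)
    (.seq (.write 6 (.reg 6) (.const 0)) (.seq (.write 7 (.reg 6) (.reg 5))
      (.write 8 (.reg 5) (.reg 6))))
    (.seq (.assign 7 (.sub (.sub (.reg 0) (.const 1)) (.reg 5)))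
      (.seq (.write 6 (.reg 6) (.const 1)) (.seq (.write 7 (.reg 6) (.reg 7))
        (.write 9 (.reg 7) (.reg 6)))))))

variable {B n m : ℕ} {σ : MachineState}

lemma markEnds_exec (hm : σ.reg 1 = m) (h1 : ∀ e < m, σ.arr 1 e ≤ B) (h2 : ∀ e < m, σ.arr 2 e ≤ B)
    (h4 : ∀ v, σ.arr 4 v = 0) (h5 : ∀ v, σ.arr 5 v = 0) (hB : m ≤ B) (hB' : 1 ≤ B) :
    Exec B markEnds σ (m * 20 + 10) fun τ => Same [4, 5] [5] σ τ ∧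
      ∀ v, (τ.arr 4 v = 0 ↔ ∀ e < m, σ.arr 2 e ≠ v) ∧
        (τ.arr 5 v = 0 ↔ ∀ e < m, σ.arr 1 e ≠ v) := by
  refine (Exec.forLt (N := m) (C := 12) (fun k τ => Same [4, 5] [5] σ τ ∧
      ∀ v, (τ.arr 4 v = 0 ↔ ∀ e < k, σ.arr 2 e ≠ v) ∧
        (τ.arr 5 v = 0 ↔ ∀ e < k, σ.arr 1 e ≠ v)) ?_ hB ?_ ?_).mono ?_ fun τ h => h
  · exact ⟨(Same.refl _ _ σ).setReg (by simp) _, fun v => by simp [h4, h5]⟩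
  · rintro i τ ⟨h, -⟩ -
    simp [Expr.eval, h.2 1, hm]
  · rintro i hi τ ⟨h, hv⟩ hr
    refine (wp.exec ?_).mono (C₁ := Program.cost _) (by simp [cost, Expr.cost]) fun _ h => h
    have e1 : τ.arr 1 = σ.arr 1 := h.1 1 (by simp)
    have e2 : τ.arr 2 = σ.arr 2 := h.1 2 (by simp)
    simp only [wp, Expr.eval, setArr_reg, hr, setArr_arr, e1, e2]
    refine ⟨h2 i hi, hB', by simpa [e1] using h1 i hi, hB', trivial,
      ((h.setArr (by simp) _ _).setArr (by simp) _ _).setReg (by simp) _, fun v => ?_⟩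
    obtain ⟨h3, h3'⟩ := hv v
    simp only [Nat.lt_succ_iff_lt_or_eq, or_imp, forall_and, forall_eq]
    constructor
    · by_cases h4 : v = σ.arr 2 i
      · simp [setArr_arr, h4]
      · simp [setArr_arr, h4, h3, Ne.symm h4]
    · by_cases h4 : v = σ.arr 1 i
      · simp [setArr_arr, h4]
      · simp [setArr_arr, h4, h3', Ne.symm h4]
  · simp only [Expr.cost]; omega

lemma findEnds_exec {S T : ℕ} (hn : σ.reg 0 = n) (hB : n ≤ B) (hS : S < n) (hT : T < n)
    (h4 : ∀ i < n, σ.arr 4 (σ.arr 0 i) = 0 ↔ i = S)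
    (h5 : ∀ i < n, σ.arr 5 (σ.arr 0 i) = 0 ↔ i = T) :
    Exec B findEnds σ (n * 30 + 10) fun τ => Same [] [2, 3, 5] σ τ ∧ τ.reg 2 = S ∧ τ.reg 3 = T := by
  refine (Exec.forLt (N := n) (C := 22) (fun k τ => Same [] [2, 3, 5] σ τ ∧
      (S < k → τ.reg 2 = S) ∧ (T < k → τ.reg 3 = T)) ?_ hB ?_ ?_).mono ?_
      fun τ h => ⟨h.1, h.2.1 hS, h.2.2 hT⟩
  · exact ⟨(Same.refl _ _ σ).setReg (by simp) _, by simp, by simp⟩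
  · rintro i τ ⟨h, -⟩ -
    simp [Expr.eval, h.2 0, hn]
  · rintro i hi τ ⟨h, hv, hv'⟩ hr
    refine (wp.exec ?_).mono (C₁ := Program.cost _) (by simp [cost, Expr.cost]) fun _ h => h
    have e0 : τ.arr 0 = σ.arr 0 := h.1 0 (by simp)
    have e4 : τ.arr 4 = σ.arr 4 := h.1 4 (by simp)
    have e5 : τ.arr 5 = σ.arr 5 := h.1 5 (by simp)
    have hiB : i ≤ B := by omega
    have k4 := h4 i hi
    have k5 := h5 i hi
    have hs : ∀ x, Same [] [2, 3, 5] σ (τ.setReg 2 x) := fun x => h.setReg (by simp) _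
    simp only [wp, Expr.eval, hr, e0, e4, e5, Nat.lt_one_iff, setReg_arr, setReg_reg, k4, k5,
      Nat.reduceEqDiff, if_false, hiB, true_and, if_true]
    refine ⟨fun hiS => ⟨fun hiT => ?_, fun hiT => ?_⟩, fun hiS => ⟨fun hiT => ?_, fun hiT => ?_⟩⟩
    · exact ⟨((hs _).setReg (by simp) _).setReg (by simp) _, fun _ => hiS, fun _ => hiT⟩
    · exact ⟨(hs _).setReg (by simp) _, fun _ => hiS, fun h => hv' (by omega)⟩
    · exact ⟨(h.setReg (by simp) _).setReg (by simp) _, fun h => hv (by omega), fun _ => hiT⟩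
    · exact ⟨h.setReg (by simp) _, fun h => hv (by omega), fun h => hv' (by omega)⟩
  · simp only [Expr.cost]; omega

lemma splitEnds_exec {S T : ℕ} (hn : σ.reg 0 = n) (h2 : σ.reg 2 = S) (h3 : σ.reg 3 = T)
    (hT : T < n) (hB : n ≤ B) :
    Exec B splitEnds σ 20 fun τ => Same [] [3, 4] σ τ ∧
      τ.reg 3 = (if T < S then T + n - S else T - S) ∧
      τ.reg 4 = n - (if T < S then T + n - S else T - S) := by
  rw [splitEnds]
  refine (wp.exec ?_).mono (C₁ := Program.cost _) (by simp [cost, Expr.cost]) fun _ h => h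
  simp only [wp, Expr.eval, hn, h2, h3, setReg_reg, Nat.reduceEqDiff, if_false, if_true]
  refine ⟨fun h => ⟨by omega, by omega, ?_⟩, fun h => ⟨by omega, by omega, ?_⟩⟩
  · refine ⟨((Same.refl _ _ σ).setReg (by simp) _).setReg (by simp) _, ?_⟩
    simp [h]
  · refine ⟨((Same.refl _ _ σ).setReg (by simp) _).setReg (by simp) _, ?_⟩
    simp [h]

/-- `f q` is the name of the vertex at position `q` counted from the source; its injectivity
protects earlier entries from later writes. -/
lemma place_exec {S T : ℕ} {f : ℕ → ℕ} (hn : σ.reg 0 = n) (h2 : σ.reg 2 = S) (h3 : σ.reg 3 = T)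
    (hT : T < n) (hB : n ≤ B)
    (hf : ∀ q < n, f q = if S + q < n then σ.arr 0 (S + q) else σ.arr 0 (S + q - n))
    (hfn : ∀ q < n, f q < n) (hinj : ∀ q < n, ∀ r < n, f q = f r → q = r) :
    Exec B place σ (n * 50 + 10) fun τ => Same [6, 7, 8, 9] [5, 6, 7] σ τ ∧ ∀ q < n,
      τ.arr 6 (f q) = (if q < T then 0 else 1) ∧ τ.arr 7 (f q) = (if q < T then q else n - 1 - q) ∧
      (if q < T then τ.arr 8 q = f q else τ.arr 9 (n - 1 - q) = f q) := by
  refine (Exec.forLt (N := n) (C := 40) (fun k τ => Same [6, 7, 8, 9] [5, 6, 7] σ τ ∧ ∀ q < k,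
      τ.arr 6 (f q) = (if q < T then 0 else 1) ∧ τ.arr 7 (f q) = (if q < T then q else n - 1 - q) ∧
      (if q < T then τ.arr 8 q = f q else τ.arr 9 (n - 1 - q) = f q)) ?_ hB ?_ ?_).mono ?_
      fun τ h => h
  · exact ⟨(Same.refl _ _ σ).setReg (by simp) _, by simp⟩
  · rintro i τ ⟨h, -⟩ -
    simp [Expr.eval, h.2 0, hn]
  · rintro i hi τ ⟨h, hv⟩ hr
    have e0 : τ.arr 0 = σ.arr 0 := h.1 0 (by simp)
    have r0 : τ.reg 0 = n := by rw [h.2 0 (by simp), hn]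
    have r2 : τ.reg 2 = S := by rw [h.2 2 (by simp), h2]
    have r3 : τ.reg 3 = T := by rw [h.2 3 (by simp), h3]
    have hfi := hfn i hi
    refine Exec.seq (C₁ := 16) (C₂ := 23) (Q := fun υ => υ = τ.setReg 6 (f i)) ?_ ?_ le_rfl
    · refine (wp.exec ?_).mono (C₁ := Program.cost _) (by simp [cost, Expr.cost]) fun _ h => h
      simp only [wp, Expr.eval, hr, e0, r0, r2]
      have := hf i hi
      constructor <;> intro hlt <;> simp only [hlt, if_true, if_false] at this <;>
        exact ⟨by omega, by rw [this]⟩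
    · rintro _ rfl
      refine (wp.exec ?_).mono (C₁ := Program.cost _) (by simp [cost, Expr.cost]) fun _ h => h
      simp only [wp, Expr.eval, setReg_reg, setArr_reg, Nat.reduceEqDiff, if_false, if_true, hr, r0,
        r3]
      refine ⟨fun hlt => ⟨by omega, by omega, by omega, by omega, by omega, by omega, trivial, ?_, ?_⟩,
        fun hlt => ⟨by omega, by omega, by omega, by omega, by omega, by omega, by omega, trivial, ?_, ?_⟩⟩
      · exact (((((h.setReg (by simp) _).setArr (by simp) _ _).setArr (by simp) _ _).setArr
          (by simp) _ _).setReg (by simp) _)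
      · intro q hq
        rcases Nat.lt_succ_iff_lt_or_eq.1 hq with hq | rfl
        · have hne : f q ≠ f i := fun h => hq.ne (hinj _ (by omega) _ hi h)
          have := hv q hq
          simp [setArr_arr, hne, hq.ne, this]
        · simp [setArr_arr, hlt]
      · exact ((((((h.setReg (by simp) _).setReg (by simp) _).setArr (by simp) _ _).setArr (by simp) _ _).setArr
          (by simp) _ _).setReg (by simp) _)
      · intro q hq
        rcases Nat.lt_succ_iff_lt_or_eq.1 hq with hq | rfl
        · have hne : f q ≠ f i := fun h => hq.ne (hinj _ (by omega) _ hi h)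
          have := hv q hq
          have hne' : n - 1 - q ≠ n - 1 - i := by omega
          simp [setArr_arr, hne, hne', this]
        · simp [setArr_arr, hlt]
  · simp only [Expr.cost]; omega

end Decompose

/-! ## Sweeping a ladder -/

namespace Ladder

variable {L : Ladder}

/-- `x` is in no maximal box. -/
def Free (L : Ladder) (x : Bool × ℕ) : Prop :=
  x.2 < L.N x.1 ∧ ∀ σ i lo hi τ, L.Cand σ i lo hi τ → ¬ (lo x.1 ≤ x.2 ∧ x.2 ≤ hi x.1)

/-- the vertices of heights `a` to `b - 1` on side `ρ` -/
def chain (ρ : Bool) (a b : ℕ) : List (Bool × ℕ) := (List.range (b - a)).map fun k => (ρ, a + k)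

/-- the vertices of a box with source `(σ, lo σ)`, counterclockwise -/
def outline (σ : Bool) (lo hi : Bool → ℕ) : List (Bool × ℕ) :=
  (if σ then [(true, lo true)] else []) ++ (chain false (lo false) (hi false + 1) ++
    (chain true (lo true + if σ then 1 else 0) (hi true + 1)).reverse)

/-- `l` reports the element of the decomposition that has the representative `x`. -/
def ReportedBy (L : Ladder) (x : Bool × ℕ) (l : List (Bool × ℕ)) : Prop :=
  (∃ lo hi τ, L.Cand x.1 x.2 lo hi τ ∧ l = outline x.1 lo hi) ∨ (L.Free x ∧ l = [x])

lemma Cand.mem_box {σ τ : Bool} {i : ℕ} {lo hi : Bool → ℕ} (h : L.Cand σ i lo hi τ) :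
    lo σ ≤ i ∧ i ≤ hi σ := by
  have := h.lo_eq
  have := h.isBox.le σ
  omega

lemma Cand.dom {σ τ : Bool} {i : ℕ} {lo hi : Bool → ℕ} (h : L.Cand σ i lo hi τ) : i < L.N σ :=
  h.mem_box.2.trans_lt (h.isBox.hi_lt σ)

lemma Cand.reach {σ τ ρ : Bool} {i k : ℕ} {lo hi : Bool → ℕ} (h : L.Cand σ i lo hi τ)
    (h1 : lo ρ ≤ k) (h2 : k ≤ hi ρ) : L.Reach (σ, i) (ρ, k) := by
  rw [← h.lo_eq]
  exact h.isBox.source_reach h1 h2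

lemma Free.not_cand {x : Bool × ℕ} (h : L.Free x) {lo hi : Bool → ℕ} {τ : Bool} :
    ¬ L.Cand x.1 x.2 lo hi τ := fun hc => h.2 _ _ _ _ _ hc hc.mem_box

lemma ReportedBy.dom {x : Bool × ℕ} {l : List (Bool × ℕ)} (h : L.ReportedBy x l) :
    x.2 < L.N x.1 := by
  rcases h with ⟨lo, hi, τ, h, _⟩ | ⟨h, _⟩
  · exact h.dom
  · exact h.1

lemma ReportedBy.comparable {x y : Bool × ℕ} {l l' : List (Bool × ℕ)} (h : L.ReportedBy x l)
    (h' : L.ReportedBy y l') : L.Reach x y ∨ L.Reach y x := by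
  rcases id h with ⟨lo, hi, τ, h1, _⟩ | ⟨h1, _⟩
  · rcases id h' with ⟨lo', hi', τ', h2, _⟩ | ⟨h2, _⟩
    · exact h1.comparable h2
    · exact (comparable_of_not_cand h'.dom h.dom h2.2).symm
  · exact comparable_of_not_cand h.dom h'.dom h1.2

/-- number of words of the output for a list of reports -/
def outputLength (out : List ((Bool × ℕ) × List (Bool × ℕ))) : ℕ :=
  (out.map fun e => e.2.length + 1).sum

/-- The invariant of the sweep: the vertices of height less than `ptr ρ` on side `ρ` have been
visited, `out` lists the representatives and reports of the elements found so far, and `top ρ`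
is `0` or by one more than the top height of the last of the boxes. -/
structure SweepInv (L : Ladder) (ptr top : Bool → ℕ) (out : List ((Bool × ℕ) × List (Bool × ℕ))) :
    Prop where
  le : ∀ ρ, ptr ρ ≤ L.N ρ
  closed : ∀ {x y}, L.E x y → y.2 < ptr y.1 → x.2 < ptr x.1
  mem : ∀ e, e ∈ out ↔ L.ReportedBy e.1 e.2 ∧ e.1.2 < ptr e.1.1
  pairwise : out.Pairwise fun e f => e.1 ≠ f.1 ∧ L.Reach e.1 f.1
  lt_top : ∀ {σ i lo hi τ}, L.Cand σ i lo hi τ → i < ptr σ → ∀ ρ, hi ρ < top ρ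
  top_eq : (∀ ρ, top ρ = 0) ∨ ∃ σ i lo hi τ, L.Cand σ i lo hi τ ∧ i < ptr σ ∧ ∀ ρ, top ρ = hi ρ + 1
  length : outputLength out ≤ 5 * (ptr false + ptr true) + (top false + top true)

namespace SweepInv

variable {ptr top : Bool → ℕ} {out : List ((Bool × ℕ) × List (Bool × ℕ))}

lemma start : L.SweepInv (fun _ => 0) (fun _ => 0) [] := by
  refine ⟨by simp, by simp, by simp, by simp, by simp, by simp, by simp [outputLength]⟩

variable (h : L.SweepInv ptr top out)
include h

lemma closed_reach {x y : Bool × ℕ} (hxy : L.Reach x y) (hy : y.2 < ptr y.1) : x.2 < ptr x.1 := by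
  induction hxy using ReflTransGen.head_induction_on with
  | refl => exact hy
  | head hab _ ih => exact h.closed hab ih

lemma top_le (ρ : Bool) : top ρ ≤ L.N ρ := by
  rcases h.top_eq with h0 | ⟨σ, i, lo, hi, τ, hc, -, ht⟩
  · rw [h0]; omega
  · rw [ht]; exact hc.isBox.hi_lt ρ

/-- This is what remains of `length` when both pointers and both covered heights are bounded by the
numbers of vertices; it bounds addresses as well as running time. -/
lemma outputLength_le {n : ℕ} (hn : L.N false + L.N true = n) : outputLength out ≤ 6 * n := by
  have h1 := h.length
  have h2 := h.le
  have h3 := h.top_le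
  have := h2 false
  have := h2 true
  have := h3 false
  have := h3 true
  omega

variable {ρ : Bool} (hρ : ptr ρ < L.N ρ) (hin : ∀ x, L.E x (ρ, ptr ρ) → x.2 < ptr x.1)

lemma not_reach {σ : Bool} {i : ℕ} (hi : i < ptr σ) : ¬ L.Reach (ρ, ptr ρ) (σ, i) := fun hr =>
  absurd (h.closed_reach hr hi) (lt_irrefl _)

omit h in
lemma lt_update_iff {x : Bool × ℕ} : x.2 < Function.update ptr ρ (ptr ρ + 1) x.1 ↔
    x.2 < ptr x.1 ∨ x = (ρ, ptr ρ) := by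
  obtain ⟨σ, i⟩ := x
  by_cases hσ : σ = ρ
  · subst hσ
    simp [Nat.le_iff_lt_or_eq]
  · simp [hσ]

omit h in
lemma sum_update (f : Bool → ℕ) (a : ℕ) : Function.update f ρ a false + Function.update f ρ a true +
    f ρ = f false + f true + a := by
  cases ρ <;> simp <;> omega

/-- Representatives are comparable, and a new one cannot reach a visited one because the visited set
is closed under predecessors. So appending keeps the order. -/
lemma pairwise_append {l : List (Bool × ℕ)} (hl : L.ReportedBy (ρ, ptr ρ) l) :
    (out ++ [((ρ, ptr ρ), l)]).Pairwise fun e f => e.1 ≠ f.1 ∧ L.Reach e.1 f.1 := by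
  refine List.pairwise_append.2 ⟨h.pairwise, by simp, fun e he f hf => ?_⟩
  obtain rfl := List.mem_singleton.1 hf
  obtain ⟨h1, h2⟩ := (h.mem e).1 he
  refine ⟨?_, (h1.comparable hl).resolve_right (h.not_reach h2)⟩
  rintro h3
  rw [h3] at h2
  exact absurd h2 (lt_irrefl _)

include hin in
lemma closed_update {x y : Bool × ℕ} (hxy : L.E x y)
    (hy : y.2 < Function.update ptr ρ (ptr ρ + 1) y.1) :
    x.2 < Function.update ptr ρ (ptr ρ + 1) x.1 := by
  rw [lt_update_iff] at hy ⊢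
  rcases hy with hy | rfl
  · exact .inl (h.closed hxy hy)
  · exact .inl (hin _ hxy)

include hρ in
lemma le_update (σ : Bool) : Function.update ptr ρ (ptr ρ + 1) σ ≤ L.N σ := by
  by_cases hσ : σ = ρ
  · subst hσ; simpa using hρ
  · simpa [hσ] using h.le σ

lemma mem_append (hu : ∀ {l l'}, L.ReportedBy (ρ, ptr ρ) l → L.ReportedBy (ρ, ptr ρ) l' → l = l')
    {l : List (Bool × ℕ)} (hl : L.ReportedBy (ρ, ptr ρ) l) (e : (Bool × ℕ) × List (Bool × ℕ)) :
    e ∈ out ++ [((ρ, ptr ρ), l)] ↔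
      L.ReportedBy e.1 e.2 ∧ e.1.2 < Function.update ptr ρ (ptr ρ + 1) e.1.1 := by
  rw [List.mem_append, h.mem, lt_update_iff, List.mem_singleton]
  constructor
  · rintro (⟨h1, h2⟩ | rfl)
    · exact ⟨h1, .inl h2⟩
    · exact ⟨hl, .inr rfl⟩
  · rintro ⟨h1, h2 | h2⟩
    · exact .inl ⟨h1, h2⟩
    · obtain ⟨x, l'⟩ := e
      obtain rfl : x = _ := h2
      exact .inr (congrArg _ (hu h1 hl))

/-- The last box is separated from the new one. It cannot be the upper one, since then the new
source would reach its source, which has been visited. -/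
lemma top_le_lo {lo hi : Bool → ℕ} {τ : Bool} (hc : L.Cand ρ (ptr ρ) lo hi τ) (κ : Bool) :
    top κ ≤ lo κ + 1 := by
  rcases h.top_eq with h0 | ⟨σ', i', lo', hi', τ', hc', hi'', ht⟩
  · rw [h0]; omega
  · rw [ht]
    have hne : (σ', i') ≠ (ρ, ptr ρ) := by
      rintro h3
      obtain ⟨rfl, rfl⟩ := Prod.mk.inj h3
      exact absurd hi'' (lt_irrefl _)
    rcases hc'.separated hc hne with h1 | h1
    · have := h1 κ; omega
    · refine absurd (h.not_reach (ρ := ρ) hi'') (not_not.2 ?_)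
      have h2 := h1 σ'
      rw [hc'.lo_eq] at h2
      exact (hc.reach (hc.isBox.le σ') le_rfl).trans (L.tot h2 hc'.dom)

include hin hρ

lemma emit_box {lo hi : Bool → ℕ} {τ : Bool} (hc : L.Cand ρ (ptr ρ) lo hi τ) :
    L.SweepInv (Function.update ptr ρ (ptr ρ + 1)) (fun κ => hi κ + 1)
      (out ++ [((ρ, ptr ρ), outline ρ lo hi)]) := by
  have hl : L.ReportedBy (ρ, ptr ρ) (outline ρ lo hi) := .inl ⟨lo, hi, τ, hc, rfl⟩
  have htop := h.top_le_lo hc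
  refine ⟨h.le_update hρ, h.closed_update hin, h.mem_append ?_ hl, h.pairwise_append hl,
    ?_, .inr ⟨ρ, ptr ρ, lo, hi, τ, hc, by simp, fun _ => rfl⟩, ?_⟩
  · have key : ∀ {l}, L.ReportedBy (ρ, ptr ρ) l → l = outline ρ lo hi := by
      rintro l (⟨lo', hi', τ', hc', rfl⟩ | ⟨h1, rfl⟩)
      · obtain ⟨rfl, rfl, -⟩ := hc.unique hc'
        rfl
      · exact absurd hc h1.not_cand
    intro l l' h1 h2
    rw [key h1, key h2]
  · intro σ' i' lo' hi' τ' hc' hi'' κ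
    rcases (lt_update_iff (x := (σ', i'))).1 hi'' with h1 | h1
    · have h2 := h.lt_top hc' h1 κ
      have h3 := htop κ
      have h4 := hc.isBox.le κ
      omega
    · obtain ⟨rfl, rfl⟩ := Prod.mk.inj h1
      obtain ⟨rfl, rfl, -⟩ := hc.unique hc'
      exact Nat.lt_succ_self _
  -- As the new box starts at most one height below the covered part on each side, its report with
  -- the length word is longer than the increase of `top` by at most `3`; the `5` per visit covers
  -- this.
  · have h1 := h.length
    have h2 := sum_update (ρ := ρ) ptr (ptr ρ + 1)
    have h3 := htop false
    have h4 := htop true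
    have h5 := hc.isBox.le false
    have h6 := hc.isBox.le true
    have h7 : (outline ρ lo hi).length = hi false + 1 - lo false + (hi true + 1 - lo true) := by
      cases ρ <;> simp [outline, chain]
      omega
    simp only [outputLength, List.map_append, List.sum_append, List.map_singleton,
      List.sum_singleton] at h1 ⊢
    omega

omit hρ hin in
-- If free, the vertex would be below the last box, on the side opposite to its source, and
-- comparable to the source. It cannot reach the visited source, so the source reaches it. But this
-- needs an edge across that ends below the bottom edge, against noncrossing or the minimality of
-- `lo`.
lemma not_free (hlt : ptr ρ < top ρ) : ¬ L.Free (ρ, ptr ρ) := by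
  intro hf
  rcases h.top_eq with h0 | ⟨σ, i, lo, hi, τ, hc, hi', ht⟩
  · rw [h0] at hlt; omega
  have h1 : ptr ρ < lo ρ := by
    have : ¬ (lo ρ ≤ ptr ρ ∧ ptr ρ ≤ hi ρ) := hf.2 _ _ _ _ _ hc
    have := ht ρ
    omega
  rcases Bool.eq_or_eq_not ρ σ with rfl | rfl
  · rw [hc.lo_eq] at h1
    omega
  · have h2 := (comparable_of_not_cand hf.1 hc.dom hf.2).resolve_left (h.not_reach hi')
    obtain ⟨a, b, h3, h4, h5⟩ := exists_cross h2
    rcases h3.lt_or_eq with h3 | rfl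
    · have h6 := hc.isBox.bot
      rw [hc.lo_eq] at h6
      have := L.nc (.inl h6) (.inl h4) h3
      omega
    · have h6 : lo (!σ) ≤ b := by
        cases hc <;> apply_assumption <;> assumption
      omega

omit hρ hin in
lemma lt_top_update (hno : ∀ lo hi τ, ¬ L.Cand ρ (ptr ρ) lo hi τ) {σ τ : Bool} {i : ℕ}
    {lo hi : Bool → ℕ} (hc : L.Cand σ i lo hi τ)
    (hi' : i < Function.update ptr ρ (ptr ρ + 1) σ) (κ : Bool) : hi κ < top κ := by
  refine h.lt_top hc (((lt_update_iff (x := (σ, i))).1 hi').resolve_right ?_) κ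
  rintro h1
  obtain ⟨rfl, rfl⟩ := Prod.mk.inj h1
  exact hno _ _ _ hc

omit hρ hin in
lemma top_eq_update : (∀ κ, top κ = 0) ∨ ∃ σ i lo hi τ, L.Cand σ i lo hi τ ∧
    i < Function.update ptr ρ (ptr ρ + 1) σ ∧ ∀ κ, top κ = hi κ + 1 := by
  refine h.top_eq.imp id ?_
  rintro ⟨σ, i, lo, hi, τ, hc, hi', ht⟩
  exact ⟨σ, i, lo, hi, τ, hc, (lt_update_iff (x := (σ, i))).2 (.inl hi'), ht⟩

omit hρ in
-- A box that contains the vertex would have another source with a path to it. All predecessors of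
-- the vertex have been visited, hence also that source, so the box is below `top`.
lemma free (hno : ∀ lo hi τ, ¬ L.Cand ρ (ptr ρ) lo hi τ) (hρ : ptr ρ < L.N ρ)
    (hle : top ρ ≤ ptr ρ) : L.Free (ρ, ptr ρ) := by
  refine ⟨hρ, fun σ i lo hi τ hc hm => ?_⟩
  have hr := hc.reach hm.1 hm.2
  rcases ReflTransGen.cases_tail hr with h1 | ⟨z, hz, hz'⟩
  · obtain ⟨rfl, rfl⟩ := Prod.mk.inj h1
    exact hno _ _ _ hc
  · have := h.lt_top hc (h.closed_reach hz (hin _ hz')) ρ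
    exact absurd hm.2 (by simp only; omega)

lemma emit_free (hno : ∀ lo hi τ, ¬ L.Cand ρ (ptr ρ) lo hi τ) (hle : top ρ ≤ ptr ρ) :
    L.SweepInv (Function.update ptr ρ (ptr ρ + 1)) top (out ++ [((ρ, ptr ρ), [(ρ, ptr ρ)])]) := by
  have hl : L.ReportedBy (ρ, ptr ρ) [(ρ, ptr ρ)] := .inr ⟨h.free hin hno hρ hle, rfl⟩
  refine ⟨h.le_update hρ, h.closed_update hin, h.mem_append ?_ hl, h.pairwise_append hl, ?_, ?_, ?_⟩
  · rintro l l' (⟨lo, hi, τ, hc, -⟩ | ⟨-, rfl⟩) (⟨lo, hi, τ, hc, -⟩ | ⟨-, rfl⟩)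
    exacts [absurd hc (hno _ _ _), absurd hc (hno _ _ _), absurd hc (hno _ _ _), rfl]
  · exact h.lt_top_update hno
  · exact h.top_eq_update
  · have h1 := h.length
    have h2 := sum_update (ρ := ρ) ptr (ptr ρ + 1)
    simp only [outputLength, List.map_append, List.sum_append, List.map_singleton,
      List.sum_singleton, List.length_singleton] at h1 ⊢
    omega

lemma skip (hno : ∀ lo hi τ, ¬ L.Cand ρ (ptr ρ) lo hi τ) (hlt : ptr ρ < top ρ) :
    L.SweepInv (Function.update ptr ρ (ptr ρ + 1)) top out := by
  have hnr : ∀ l, ¬ L.ReportedBy (ρ, ptr ρ) l := by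
    rintro l (⟨lo, hi, τ, hc, -⟩ | ⟨hf, -⟩)
    · exact hno _ _ _ hc
    · exact h.not_free hlt hf
  refine ⟨h.le_update hρ, h.closed_update hin, fun e => ?_, h.pairwise, ?_, ?_, ?_⟩
  · rw [h.mem, lt_update_iff]
    refine ⟨fun ⟨h1, h2⟩ => ⟨h1, .inl h2⟩, fun ⟨h1, h2⟩ => ⟨h1, h2.resolve_right ?_⟩⟩
    rintro h3
    rw [h3] at h1
    exact hnr _ h1
  · exact h.lt_top_update hno
  · exact h.top_eq_update
  · have h1 := h.length
    have h2 := sum_update (ρ := ρ) ptr (ptr ρ + 1)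
    omega

end SweepInv

end Ladder

/-! ### Choice of the next vertex to visit, and tests that exclude a candidate. -/

namespace Ladder

variable {L : Ladder}

lemma ready_true {ptr : Bool → ℕ}
    (h : ∀ j, L.E (false, j) (true, ptr true) → j < ptr false) {x : Bool × ℕ}
    (hx : L.E x (true, ptr true)) : x.2 < ptr x.1 := by
  obtain ⟨_ | _, j⟩ := x
  · exact h j hx
  · exact lt_of_E hx

/-- The two front vertices cannot wait for each other's side: if the left one has an unvisited
predecessor on the right, an unvisited left predecessor of the right one would complete a cycle. -/
lemma ready_false {ptr : Bool → ℕ} (hle : ∀ ρ, ptr ρ ≤ L.N ρ)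
    (hlt : ptr false + ptr true < L.N false + L.N true)
    (h : ¬ (ptr true < L.N true ∧ ∀ j, L.E (false, j) (true, ptr true) → j < ptr false)) :
    ptr false < L.N false ∧ ∀ x, L.E x (false, ptr false) → x.2 < ptr x.1 := by
  by_cases h1 : ptr true < L.N true
  · simp only [h1, true_and, not_forall, not_lt] at h
    obtain ⟨j, hj, hj'⟩ := h
    have hjN := (L.dom hj).1
    refine ⟨hj'.trans_lt hjN, ?_⟩
    rintro ⟨_ | _, k⟩ hx
    · exact lt_of_E hx
    · by_contra hk
      exact L.acyclic hx (((L.tot hj' hjN).tail hj).trans (L.tot (not_lt.1 hk) (L.dom hx).1))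
  · have := hle true
    refine ⟨by omega, ?_⟩
    rintro ⟨_ | _, k⟩ hx
    · exact lt_of_E hx
    · exact (L.dom hx).1.trans_le (not_lt.1 h1)

lemma Cand.exists_next {σ τ : Bool} {i : ℕ} {lo hi : Bool → ℕ} (h : L.Cand σ i lo hi τ) :
    L.con σ i ∧ (∃ j, L.E (σ, i) (!σ, j)) ∧ ∃ y l, i < y ∧ L.X σ y l := by
  cases h with
  | mk_same x y z con lo_eq hx max_x hlo min_lo hiy next con_x hz =>
    exact ⟨con, ⟨_, hx⟩, y, z, hiy, .inr hz⟩
  | mk_opp x y z con lo_eq hx max_x hlo min_lo hiy next con_x no_in hz =>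
    exact ⟨con, ⟨_, hx⟩, y, z, hiy, .inl hz⟩

section
variable {σ : Bool} {i x y z a l : ℕ} (hx : L.E (σ, i) (!σ, x))
  (max_x : ∀ j, L.E (σ, i) (!σ, j) → j ≤ x)
  (hiy : i < y) (next : ∀ k l, i < k → k < y → ¬ L.X σ k l)
include hx max_x hiy next

/-- A candidate would have the same `x`, `y` and `z`, since these are extreme, so a failed test is
final. -/
lemma not_cand_same (hz : L.E (!σ, z) (σ, y)) (min_z : ∀ j, L.E (!σ, j) (σ, y) → z ≤ j)
    (h : ¬ (i + 2 ≤ y ∧ (x < z → L.con (!σ) x))) {lo hi : Bool → ℕ} {τ : Bool} :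
    ¬ L.Cand σ i lo hi τ := by
  intro hc
  cases hc with
  | mk_same x' y' z' con lo_eq hx' max_x' hlo min_lo hiy' next' con_x hz' min_z' hi_eq len =>
    obtain rfl : y' = y := le_antisymm (not_lt.1 fun h => next' y z hiy h (.inr hz))
      (not_lt.1 fun h => next y' z' hiy' h (.inr hz'))
    obtain rfl : x' = x := le_antisymm (max_x _ hx') (max_x' _ hx)
    obtain rfl : z' = z := le_antisymm (min_z' _ hz) (min_z _ hz')
    exact h ⟨len, con_x⟩
  | mk_opp x' y' z' con lo_eq hx' max_x' hlo min_lo hiy' next' con_x no_in hz' =>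
    obtain rfl : y' = y := le_antisymm (not_lt.1 fun h => next' y z hiy h (.inr hz))
      (not_lt.1 fun h => next y' z' hiy' h (.inl hz'))
    exact no_in _ hz

lemma not_cand_opp (no_in : ∀ j, ¬ L.E (!σ, j) (σ, y)) (hz : L.E (σ, y) (!σ, z))
    (min_z : ∀ j, L.E (σ, y) (!σ, j) → z ≤ j) (ha : L.E (σ, i) (!σ, a))
    (min_a : ∀ j, L.E (σ, i) (!σ, j) → a ≤ j)
    (h : ¬ (a < z ∧ (x < z → L.con (!σ) x))) {lo hi : Bool → ℕ} {τ : Bool} :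
    ¬ L.Cand σ i lo hi τ := by
  intro hc
  cases hc with
  | mk_same x' y' z' con lo_eq hx' max_x' hlo min_lo hiy' next' con_x hz' =>
    obtain rfl : y' = y := le_antisymm (not_lt.1 fun h => next' y z hiy h (.inl hz))
      (not_lt.1 fun h => next y' z' hiy' h (.inr hz'))
    exact no_in _ hz'
  | mk_opp x' y' z' con lo_eq hx' max_x' hlo min_lo hiy' next' con_x no_in hz' min_z' hi_eq len =>
    obtain rfl : y' = y := le_antisymm (not_lt.1 fun h => next' y z hiy h (.inl hz))
      (not_lt.1 fun h => next y' z' hiy' h (.inl hz'))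
    obtain rfl : x' = x := le_antisymm (max_x _ hx') (max_x' _ hx)
    obtain rfl : z' = z := le_antisymm (min_z' _ hz) (min_z _ hz')
    exact h ⟨(min_a _ hlo).antisymm (min_lo _ ha) ▸ len, con_x⟩

end

end Ladder

/-! ## Tabulating the edges -/

namespace Decompose
open MachineState Program

/-- raise the cell `i` of array `a` to the value of `e` -/
def raise (a : ℕ) (i e : Expr) : Program := .ifLt (.read a i) e (.write a i e) .skip

lemma raise_wp {B a : ℕ} {i e : Expr} {σ : MachineState} {Q : MachineState → Prop}
    (hi : i.eval σ ≤ B) (he : e.eval σ ≤ B)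
    (h : ∀ τ : MachineState, τ.reg = σ.reg → (∀ c, c ≠ a → τ.arr c = σ.arr c) →
      (∀ v, τ.arr a v = max (σ.arr a v) (if i.eval σ = v then e.eval σ else 0)) → Q τ) :
    (raise a i e).wp B Q σ := by
  simp only [raise, wp, Expr.eval]
  refine ⟨fun hlt => ⟨hi, he, h _ rfl (fun c hc => ?_) fun v => ?_⟩,
    fun hlt => h _ rfl (fun _ _ => rfl) fun v => ?_⟩
  · funext v; simp [setArr_arr, hc]
  · rw [setArr_arr]
    by_cases hv : v = i.eval σ
    · subst hv; simp [hlt.le]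
    · simp [hv, Ne.symm hv]
  · by_cases hv : i.eval σ = v
    · subst hv; simpa using hlt
    · simp [hv]

/-- mark an edge of array 10 if it joins consecutive vertices of a side -/
def markSame : Program := .ifLt (.read 7 (.reg 7)) (.add (.read 7 (.reg 6)) (.const 2))
  (raise 10 (.reg 6) (.const 1)) .skip

/-- Record every edge: array 10 marks the tails of the edges that join consecutive vertices of a
side; arrays 11 to 14 hold for each vertex the extreme heights of its out- and in-neighbours on the
other side. -/
def scanEdges : Program := forLt 5 (.reg 1) (.seq (.assign 6 (.read 1 (.reg 5)))
  (.seq (.assign 7 (.read 2 (.reg 5)))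
  -- The side bits of the two ends add up to `1` exactly for an edge across.
  (.ifLt (.add (.read 6 (.reg 6)) (.read 6 (.reg 7))) (.const 1) markSame
    (.ifLt (.const 1) (.add (.read 6 (.reg 6)) (.read 6 (.reg 7))) markSame
    (.seq (raise 11 (.reg 6) (.add (.read 7 (.reg 7)) (.const 1)))
    (.seq (raise 12 (.reg 6) (.sub (.reg 0) (.read 7 (.reg 7))))
    (.seq (raise 13 (.reg 7) (.add (.read 7 (.reg 6)) (.const 1)))
    (raise 14 (.reg 7) (.sub (.reg 0) (.read 7 (.reg 6)))))))))))

/-- The arrays 10 to 14 record the first `k` of the edges with the tails `tl` and the heads `hd`,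
where `s` and `h` are the sides and the heights of the vertices. -/
def Tabulated (n : ℕ) (tl hd s h : ℕ → ℕ) (k : ℕ) (τ : MachineState) : Prop := ∀ v,
  τ.arr 10 v = (Finset.range k).sup (fun e =>
    if tl e = v then if s (tl e) = s (hd e) ∧ h (hd e) < h (tl e) + 2 then 1 else 0 else 0) ∧
  τ.arr 11 v = (Finset.range k).sup (fun e =>
    if tl e = v then if s (tl e) = s (hd e) then 0 else h (hd e) + 1 else 0) ∧
  τ.arr 12 v = (Finset.range k).sup (fun e =>
    if tl e = v then if s (tl e) = s (hd e) then 0 else n - h (hd e) else 0) ∧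
  τ.arr 13 v = (Finset.range k).sup (fun e =>
    if hd e = v then if s (tl e) = s (hd e) then 0 else h (tl e) + 1 else 0) ∧
  τ.arr 14 v = (Finset.range k).sup (fun e =>
    if hd e = v then if s (tl e) = s (hd e) then 0 else n - h (tl e) else 0)

variable {B n m : ℕ} {σ : MachineState}

lemma scanEdges_exec {tl hd s h : ℕ → ℕ} (hn : σ.reg 0 = n) (hm : σ.reg 1 = m) (hmB : m ≤ B)
    (hB : n + 1 ≤ B) (e1 : σ.arr 1 = tl) (e2 : σ.arr 2 = hd) (e6 : σ.arr 6 = s) (e7 : σ.arr 7 = h)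
    (htl : ∀ e < m, tl e < n ∧ s (tl e) < 2 ∧ h (tl e) < n)
    (hhd : ∀ e < m, hd e < n ∧ s (hd e) < 2 ∧ h (hd e) < n)
    (h0 : ∀ a ∈ [10, 11, 12, 13, 14], ∀ v, σ.arr a v = 0) :
    Exec B scanEdges σ (m * 150 + 10) fun τ =>
      Same [10, 11, 12, 13, 14] [5, 6, 7] σ τ ∧ Tabulated n tl hd s h m τ := by
  refine (Exec.forLt (N := m) (C := 140)
    (fun k τ => Same [10, 11, 12, 13, 14] [5, 6, 7] σ τ ∧ Tabulated n tl hd s h k τ)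
    ?_ hmB ?_ ?_).mono ?_ fun τ h => h
  · refine ⟨(Same.refl _ _ σ).setReg (by simp) _, fun v => ?_⟩
    simp [h0]
  · rintro i τ ⟨h, -⟩ -
    simp [Expr.eval, h.2 1, hm]
  · rintro i hi τ ⟨hS, hv⟩ hr
    refine (wp.exec ?_).mono (C₁ := Program.cost _)
      (by simp [cost, Expr.cost, raise, markSame]) fun _ h => h
    obtain ⟨ht1, ht2, ht3⟩ := htl i hi
    obtain ⟨hh1, hh2, hh3⟩ := hhd i hi
    have e1 : τ.arr 1 = tl := (hS.1 1 (by simp)).trans e1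
    have e2 : τ.arr 2 = hd := (hS.1 2 (by simp)).trans e2
    have e6 : τ.arr 6 = s := (hS.1 6 (by simp)).trans e6
    have e7 : τ.arr 7 = h := (hS.1 7 (by simp)).trans e7
    have r0 : τ.reg 0 = n := (hS.2 0 (by simp)).trans hn
    set τ' := (τ.setReg 6 (tl i)).setReg 7 (hd i) with hτ'
    have q0 : τ'.reg 0 = n := by simp [hτ', setReg_reg, r0]
    have q5 : τ'.reg 5 = i := by simp [hτ', setReg_reg, hr]
    have q6 : τ'.reg 6 = tl i := by simp [hτ', setReg_reg]
    have q7 : τ'.reg 7 = hd i := by simp [hτ', setReg_reg]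
    have hS' : Same [10, 11, 12, 13, 14] [5, 6, 7] σ τ' :=
      (hS.setReg (by simp) _).setReg (by simp) _
    have hv' : Tabulated n tl hd s h i τ' := hv
    have e7' : τ'.arr 7 = h := e7
    have post : ∀ {υ : MachineState}, υ.reg = τ'.reg →
        (∀ a, a ∉ [10, 11, 12, 13, 14] → υ.arr a = τ'.arr a) →
        Tabulated n tl hd s h (i + 1) υ → υ.reg 5 = i ∧
          Same [10, 11, 12, 13, 14] [5, 6, 7] σ (υ.setReg 5 (i + 1)) ∧
          Tabulated n tl hd s h (i + 1) (υ.setReg 5 (i + 1)) := fun hr ha hT =>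
      ⟨by rw [hr, q5], Same.setReg ⟨fun a h => (ha a h).trans (hS'.1 a h),
        fun r h => (congrFun hr r).trans (hS'.2 r h)⟩ (by simp) _, hT⟩
    have same : s (tl i) = s (hd i) → markSame.wp B (fun υ => υ.reg 5 = i ∧
        Same [10, 11, 12, 13, 14] [5, 6, 7] σ (υ.setReg 5 (i + 1)) ∧
          Tabulated n tl hd s h (i + 1) (υ.setReg 5 (i + 1))) τ' := by
      intro hs
      simp only [markSame, wp, Expr.eval, e7', q6, q7]
      refine ⟨fun hlt => raise_wp ?_ ?_ fun υ k1 k2 k3 => post k1 ?_ fun v => ?_,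
        fun hlt => post rfl (fun _ _ => rfl) fun v => ?_⟩
      · simp only [Expr.eval, q6]; omega
      · simp only [Expr.eval]; omega
      · intro a ha
        exact k2 a fun h => ha (by simp [h])
      · obtain ⟨l0, l1, l2, l3, l4⟩ := hv' v
        rw [k3, k2 11 (by simp), k2 12 (by simp), k2 13 (by simp), k2 14 (by simp)]
        simp [Expr.eval, Finset.range_add_one, q6, hs, l0, l1, l2, l3, l4, hlt, max_comm]
      · obtain ⟨l0, l1, l2, l3, l4⟩ := hv' v
        simp [Finset.range_add_one, hs, l0, l1, l2, l3, l4, hlt]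
    simp only [wp, Expr.eval, hr, e1, e2, setReg_reg, setReg_arr, Nat.reduceEqDiff, if_true,
      if_false, e6]
    refine ⟨by omega, by omega, fun hlt => same (by omega), fun hlt =>
      ⟨fun hlt' => same (by omega), fun hlt' => ?_⟩⟩
    rw [← hτ']
    have hs : s (tl i) ≠ s (hd i) := by omega
    refine raise_wp (by simp only [Expr.eval, q6]; omega)
      (by simp only [Expr.eval, q7, e7']; omega) fun υ1 k1 a1 b1 => ?_
    have c1 := a1 7 (by simp)
    refine raise_wp (by simp only [Expr.eval, k1, q6]; omega)
      (by simp only [Expr.eval, k1, q0]; omega) fun υ2 k2 a2 b2 => ?_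
    have c2 := a2 7 (by simp)
    refine raise_wp (by simp only [Expr.eval, k1, k2, q7]; omega)
      (by simp only [Expr.eval, k1, k2, q6, c1, c2, e7']; omega) fun υ3 k3 a3 b3 => ?_
    have c3 := a3 7 (by simp)
    refine raise_wp (by simp only [Expr.eval, k1, k2, k3, q7]; omega)
      (by simp only [Expr.eval, k1, k2, k3, q0]; omega) fun υ4 k4 a4 b4 => post ?_ ?_ fun v => ?_
    · rw [k4, k3, k2, k1]
    · intro a ha
      simp only [List.mem_cons, List.not_mem_nil, or_false, not_or] at ha
      rw [a4 a (by omega), a3 a (by omega), a2 a (by omega), a1 a (by omega)]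
    · obtain ⟨l0, l1, l2, l3, l4⟩ := hv' v
      simp only [Expr.eval, k1, k2, k3, c1, c2, c3, q0, q6, q7, e7'] at b1 b2 b3 b4
      rw [b4, a4 10 (by simp), a4 11 (by simp), a4 12 (by simp), a4 13 (by simp), b3,
        a3 10 (by simp), a3 11 (by simp), a3 12 (by simp), a3 14 (by simp), b2,
        a2 10 (by simp), a2 11 (by simp), a2 13 (by simp), a2 14 (by simp), b1,
        a1 10 (by simp), a1 12 (by simp), a1 13 (by simp), a1 14 (by simp), l0, l1, l2, l3, l4]
      simp [Finset.range_add_one, hs, max_comm]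
  · simp only [Expr.cost]; omega

end Decompose

/-! ### Tables of the next edge across. -/

namespace Decompose
open MachineState Program

/-- the array that lists the vertices of a side -/
def vertArr (ρ : Bool) : ℕ := if ρ then 9 else 8
/-- the array of the next vertices with edges across -/
def nextArr (ρ : Bool) : ℕ := if ρ then 16 else 15
/-- the register that holds the number of vertices of a side -/
def lenReg (ρ : Bool) : ℕ := if ρ then 4 else 3
/-- the register that holds the height of the first vertex of a side that is not yet visited -/
def ptrReg (ρ : Bool) : ℕ := if ρ then 9 else 8
/-- the register for the height up to which a side is covered by polygons -/
def topReg (ρ : Bool) : ℕ := if ρ then 11 else 10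

/-- find for each vertex of a side the first one from there on that has an edge across -/
def nextCross (ρ : Bool) : Program := forLt 5 (.reg (lenReg ρ))
  (.seq (.assign 6 (.sub (.sub (.reg (lenReg ρ)) (.const 1)) (.reg 5)))
  (.seq (.assign 7 (.read (vertArr ρ) (.reg 6)))
  (.ifLt (.add (.read 11 (.reg 7)) (.read 13 (.reg 7))) (.const 1)
    (.write (nextArr ρ) (.reg 6) (.read (nextArr ρ) (.add (.reg 6) (.const 1))))
    (.write (nextArr ρ) (.reg 6) (.add (.reg 6) (.const 1))))))

/-- `v` encodes the least `y ≥ i` such that `X y`: it is `y + 1`, or `0` if there is none. -/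
def NextSpec (X : ℕ → Prop) (i v : ℕ) : Prop :=
  (v = 0 ∧ ∀ j, i ≤ j → ¬ X j) ∨ ∃ y, v = y + 1 ∧ i ≤ y ∧ X y ∧ ∀ j, i ≤ j → j < y → ¬ X j

variable {B : ℕ} {σ : MachineState}

lemma nextCross_exec {ρ : Bool} {N : ℕ} {X : ℕ → Prop} {v : ℕ → ℕ} (hN : σ.reg (lenReg ρ) = N)
    (hB : N ≤ B) (hv : ∀ i < N, σ.arr (vertArr ρ) i = v i) (hvB : ∀ i < N, v i ≤ B)
    (hX : ∀ i < N, X i ↔ σ.arr 11 (v i) ≠ 0 ∨ σ.arr 13 (v i) ≠ 0) (hXN : ∀ i, X i → i < N)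
    (h0 : ∀ i, σ.arr (nextArr ρ) i = 0) :
    Exec B (nextCross ρ) σ (N * 40 + 10) fun τ => Same [nextArr ρ] [5, 6, 7] σ τ ∧
      ∀ i, NextSpec X i (τ.arr (nextArr ρ) i) := by
  refine (Exec.forLt (N := N) (C := 30) (fun k τ => Same [nextArr ρ] [5, 6, 7] σ τ ∧
    ∀ i, N - k ≤ i → NextSpec X i (τ.arr (nextArr ρ) i)) ?_ hB ?_ ?_).mono ?_
    fun τ h => ⟨h.1, fun i => h.2 i (by omega)⟩
  -- The scan runs from the top down. Cells from `N` on keep their initial `0`, which correctly says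
  -- that nothing follows, and the first round reads cell `N`.
  · refine ⟨(Same.refl _ _ σ).setReg (by simp) _, fun i hi => .inl ⟨h0 i, fun j hj hXj => ?_⟩⟩
    have := hXN j hXj
    omega
  · rintro i τ ⟨h, -⟩ -
    rw [Expr.eval, h.2 _ (by cases ρ <;> simp [lenReg]), hN]
  · rintro k hk τ ⟨h, hI⟩ hr
    refine (wp.exec ?_).mono (C₁ := Program.cost _) (by simp [cost, Expr.cost]) fun _ h => h
    have r : τ.reg (lenReg ρ) = N := (h.2 _ (by cases ρ <;> simp [lenReg])).trans hN
    have e1 : τ.arr (vertArr ρ) = σ.arr (vertArr ρ) := h.1 _ (by cases ρ <;> decide)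
    have e2 : τ.arr 11 = σ.arr 11 := h.1 _ (by cases ρ <;> decide)
    have e3 : τ.arr 13 = σ.arr 13 := h.1 _ (by cases ρ <;> decide)
    have hi : N - 1 - k < N := by omega
    have hnext := hI (N - 1 - k + 1) (by omega)
    have hbound : τ.arr (nextArr ρ) (N - 1 - k + 1) ≤ B := by
      rcases hnext with h | ⟨y, h1, h2, h3, -⟩
      · omega
      · have := hXN y h3; omega
    simp only [wp, Expr.eval, r, hr, setReg_reg, Nat.reduceEqDiff, if_true, if_false, setReg_arr, e1,
      e2, e3, hv _ hi, setArr_reg]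
    refine ⟨by omega, hvB _ hi, fun hlt => ⟨by omega, hbound, trivial, ?_, fun i hi' => ?_⟩,
      fun hlt => ⟨by omega, by omega, trivial, ?_, fun i hi' => ?_⟩⟩
    · exact (((h.setReg (by simp) _).setReg (by simp) _).setArr (by simp) _ _).setReg (by simp) _
    · rw [setArr_arr]
      by_cases hi2 : i = N - 1 - k
      · rw [if_pos ⟨rfl, hi2⟩]
        have hno : ¬ X i := by rw [hi2, hX _ hi]; omega
        have hsucc : ∀ j, i ≤ j → j = i ∨ N - 1 - k + 1 ≤ j := fun j hj => by omega
        rcases hnext with ⟨h1, h2⟩ | ⟨y, h1, h2, h3, h4⟩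
        · refine .inl ⟨h1, fun j hj => ?_⟩
          rcases hsucc j hj with rfl | hj
          · exact hno
          · exact h2 j hj
        · refine .inr ⟨y, h1, by omega, h3, fun j hj hjy => ?_⟩
          rcases hsucc j hj with rfl | hj
          · exact hno
          · exact h4 j hj hjy
      · rw [if_neg (by tauto)]
        exact hI i (by omega)
    · exact (((h.setReg (by simp) _).setReg (by simp) _).setArr (by simp) _ _).setReg (by simp) _
    · rw [setArr_arr]
      by_cases hi2 : i = N - 1 - k
      · rw [if_pos ⟨rfl, hi2⟩]
        refine .inr ⟨i, by omega, le_rfl, ?_, fun j hj hji => by omega⟩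
        rw [hi2, hX _ hi]
        omega
      · rw [if_neg (by tauto)]
        exact hI i (by omega)
  · simp only [Expr.cost]; omega

/-! ## Output -/

/-- append the value of `e` to the output -/
def emit (e : Expr) : Program := .seq (.write 3 (.reg 12) e) (.assign 12 (.add (.reg 12) (.const 1)))

/-- the output consists of the words `l` -/
def OutIs (τ : MachineState) (l : List ℕ) : Prop :=
  τ.reg 12 = l.length ∧ ∀ k (h : k < l.length), τ.arr 3 k = l[k]

lemma OutIs.of_same {A R : List ℕ} {τ υ : MachineState} {l : List ℕ} (h : OutIs τ l)
    (hs : Same A R τ υ) (hA : 3 ∉ A) (hR : 12 ∉ R) : OutIs υ l := by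
  rw [OutIs, hs.1 3 hA, hs.2 12 hR]
  exact h

lemma emit_exec {e : Expr} {l : List ℕ} {x : ℕ} (h : OutIs σ l) (he : e.eval σ = x) (hx : x ≤ B)
    (hl : l.length < B) :
    Exec B (emit e) σ (e.cost + 7) fun τ => Same [3] [12] σ τ ∧ OutIs τ (l ++ [x]) := by
  refine (wp.exec ?_).mono (C₁ := Program.cost _) (by simp [emit, cost, Expr.cost]; omega)
    fun _ h => h
  simp only [emit, wp, Expr.eval, setArr_reg, h.1, he]
  refine ⟨hl.le, hx, hl, ((Same.refl _ _ σ).setArr (by simp) _ _).setReg (by simp) _, ?_, ?_⟩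
  · simp [setReg_reg]
  · intro k hk
    rw [setReg_arr, setArr_arr, List.getElem_append]
    by_cases hk' : k < l.length
    · rw [if_neg (by omega), dif_pos hk', h.2 k hk']
    · simp at hk
      rw [if_pos ⟨rfl, by omega⟩, dif_neg hk']
      simp

/-- append the cells with the addresses `e` of array `a` to the output, as register 21 runs from
`0` to below the value of `cnt` -/
def copy (a : ℕ) (cnt e : Expr) : Program := forLt 21 cnt (emit (.read a e))

/-- The bound and the address are re-evaluated in every round, so they must be insensitive to the
changes made by copying: array 3 and the registers 12 and 21. -/
lemma copy_exec {a N : ℕ} {cnt e : Expr} {l : List ℕ} {f : ℕ → ℕ} (h : OutIs σ l)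
    (hN : N + l.length ≤ B)
    (hcnt : ∀ τ, Same [3] [12, 21] σ τ → cnt.eval τ = N)
    (he : ∀ k < N, ∀ τ, Same [3] [12, 21] σ τ → τ.reg 21 = k → (Expr.read a e).eval τ = f k)
    (hf : ∀ k < N, f k ≤ B) :
    Exec B (copy a cnt e) σ (N * (e.cost + cnt.cost + 15) + cnt.cost + 5) fun τ =>
      Same [3] [12, 21] σ τ ∧ OutIs τ (l ++ (List.range N).map f) := by
  refine (Exec.forLt (N := N) (C := e.cost + 8) (fun k τ => Same [3] [12, 21] σ τ ∧
    OutIs τ (l ++ (List.range k).map f)) ?_ (by omega) ?_ ?_).mono ?_ fun τ h => h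
  · have : Same [3] [12, 21] σ (σ.setReg 21 0) := (Same.refl _ _ σ).setReg (by simp) _
    refine ⟨this, ?_⟩
    simp only [List.range_zero, List.map_nil, List.append_nil]
    exact h.of_same (A := []) (R := [21]) ((Same.refl _ _ σ).setReg (by simp) _) (by simp) (by simp)
  · rintro i τ ⟨h, -⟩ -
    exact hcnt τ h
  · rintro k hk τ ⟨hS, hO⟩ hr
    refine (emit_exec hO (he k hk τ hS hr) (hf k hk) (by simp; omega)).mono
      (by simp only [Expr.cost]; omega) ?_
    rintro υ ⟨h1, h2⟩
    refine ⟨(h1.2 21 (by simp)).trans hr, ?_, ?_⟩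
    · exact ((hS.trans h1).mono (by simp) (by simp)).setReg (by simp) _
    · rw [List.range_succ, List.map_append, ← List.append_assoc]
      exact h2.of_same (A := []) (R := [21]) ((Same.refl _ _ υ).setReg (by simp) _) (by simp)
        (by simp)
  · have : e.cost + 8 + cnt.cost + 7 = e.cost + cnt.cost + 15 := by omega
    rw [this]

end Decompose

/-! ## Recognizing the boxes -/

namespace Program

/-- the registers to which a program assigns -/
def regs : Program → List ℕ
  | .skip => []
  | .assign r _ => [r]
  | .write _ _ _ => []
  | .seq P Q => P.regs ++ Q.regs
  | .ifLt _ _ P Q => P.regs ++ Q.regs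
  | .whileLt _ _ P => P.regs

/-- the arrays to which a program writes -/
def arrs : Program → List ℕ
  | .skip => []
  | .assign _ _ => []
  | .write a _ _ => [a]
  | .seq P Q => P.arrs ++ Q.arrs
  | .ifLt _ _ P Q => P.arrs ++ Q.arrs
  | .whileLt _ _ P => P.arrs

end Program

open MachineState in
-- A frame rule: what a program leaves alone is read off from its text.
lemma Runs.same {B k : ℕ} {P : Program} {σ τ : MachineState} (h : Runs B P σ k τ) :
    Same P.arrs P.regs σ τ := by
  induction h with
  | skip σ => exact .refl _ _ _
  | assign σ r e h => exact (Same.refl _ _ σ).setReg (by simp [Program.regs]) _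
  | write σ a i e hi h => exact (Same.refl _ _ σ).setArr (by simp [Program.arrs]) _ _
  | seq _ _ ih ih' => exact ih.trans ih'
  | ifTrue _ _ ih => exact ih.mono (by simp [Program.arrs]) (by simp [Program.regs])
  | ifFalse _ _ ih => exact ih.mono (by simp [Program.arrs]) (by simp [Program.regs])
  | whileTrue _ _ _ ih ih' =>
    exact (ih.trans ih').mono (by simp [Program.arrs]) (by simp [Program.regs])
  | whileFalse _ => exact .refl _ _ _

lemma Exec.same {B C : ℕ} {P : Program} {σ : MachineState} {Q : MachineState → Prop}
    (h : Exec B P σ C Q) {A R : List ℕ} (hA : P.arrs ⊆ A) (hR : P.regs ⊆ R) :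
    Exec B P σ C fun τ => MachineState.Same A R σ τ ∧ Q τ :=
  let ⟨k, τ, h1, h2, h3⟩ := h
  ⟨k, τ, h1, h2, h1.same.mono hA hR, h3⟩

namespace Decompose
open MachineState Program Ladder

/-- `v` is by one more than the maximum of `P`, or `0` if `P` is empty. -/
def MaxSpec (P : ℕ → Prop) (v : ℕ) : Prop :=
  (v = 0 ∧ ∀ j, ¬ P j) ∨ ∃ x, v = x + 1 ∧ P x ∧ ∀ j, P j → j ≤ x

/-- `v` is the difference of `n` and the minimum of `P`, or `0` if `P` is empty. -/
def MinSpec (n : ℕ) (P : ℕ → Prop) (v : ℕ) : Prop :=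
  (v = 0 ∧ ∀ j, ¬ P j) ∨ ∃ x < n, v = n - x ∧ P x ∧ ∀ j, P j → x ≤ j

/-- The arrays 8 to 16 describe the ladder `L`, where `w` gives the names of the vertices. -/
structure Prepared (L : Ladder) (w : Bool × ℕ → ℕ) (n : ℕ) (σ : MachineState) : Prop where
  reg0 : σ.reg 0 = n
  len : ∀ ρ, σ.reg (lenReg ρ) = L.N ρ
  sum : L.N false + L.N true = n
  vert : ∀ {ρ i}, i < L.N ρ → σ.arr (vertArr ρ) i = w (ρ, i)
  lt : ∀ {ρ i}, i < L.N ρ → w (ρ, i) < n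
  con : ∀ {ρ i}, i < L.N ρ → (σ.arr 10 (w (ρ, i)) ≠ 0 ↔ L.con ρ i)
  maxOut : ∀ {ρ i}, i < L.N ρ → MaxSpec (fun j => L.E (ρ, i) (!ρ, j)) (σ.arr 11 (w (ρ, i)))
  minOut : ∀ {ρ i}, i < L.N ρ → MinSpec n (fun j => L.E (ρ, i) (!ρ, j)) (σ.arr 12 (w (ρ, i)))
  maxIn : ∀ {ρ i}, i < L.N ρ → MaxSpec (fun j => L.E (!ρ, j) (ρ, i)) (σ.arr 13 (w (ρ, i)))
  minIn : ∀ {ρ i}, i < L.N ρ → MinSpec n (fun j => L.E (!ρ, j) (ρ, i)) (σ.arr 14 (w (ρ, i)))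
  next : ∀ ρ i, NextSpec (fun i => ∃ l, L.X ρ i l) i (σ.arr (nextArr ρ) i)

/-- set the flag in register 13 if there is no gap on side `!ρ` between the heights in registers 14
and 18 -/
def checkGap (ρ : Bool) : Program := .ifLt (.reg 14) (.reg 18)
  (.ifLt (.const 0) (.read 10 (.read (vertArr !ρ) (.reg 14))) (.assign 13 (.const 1)) .skip)
  (.assign 13 (.const 1))

/-- look for a box with both source and sink on side `ρ` -/
def findSame (ρ : Bool) : Program := .seq (.assign 18 (.sub (.reg 0) (.read 14 (.reg 17))))
  (.seq (.assign 19 (.reg 16)) (.seq (.assign 20 (.sub (.read 13 (.reg 17)) (.const 1)))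
  (.ifLt (.add (.reg (ptrReg ρ)) (.const 1)) (.reg 16) (checkGap ρ) .skip)))

/-- look for a box with the source on side `ρ` and the sink on the other side -/
def findOpp (ρ : Bool) : Program := .seq (.assign 18 (.sub (.reg 0) (.read 12 (.reg 17))))
  (.seq (.assign 19 (.sub (.read 13 (.read (vertArr !ρ) (.reg 18))) (.const 1)))
  (.seq (.assign 20 (.reg 18)) (.ifLt (.reg 15) (.reg 18) (checkGap ρ) .skip)))

/-- Set the flag in register 13 if the next vertex of side `ρ` is the source of a maximal box; then
compute its bottom height on the other side in register 15, and its top heights on this and the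
other side in registers 19 and 20. -/
def findBox (ρ : Bool) : Program := .seq (.assign 13 (.const 0))
  (.seq (.assign 6 (.read (vertArr ρ) (.reg (ptrReg ρ))))
  (.ifLt (.const 0) (.read 10 (.reg 6)) (.ifLt (.const 0) (.read 11 (.reg 6))
    (.seq (.assign 14 (.sub (.read 11 (.reg 6)) (.const 1)))
    (.seq (.assign 15 (.sub (.reg 0) (.read 12 (.reg 6))))
    (.seq (.assign 16 (.read (nextArr ρ) (.add (.reg (ptrReg ρ)) (.const 1))))
    (.ifLt (.const 0) (.reg 16) (.seq (.assign 16 (.sub (.reg 16) (.const 1)))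
      (.seq (.assign 17 (.read (vertArr ρ) (.reg 16)))
      (.ifLt (.const 0) (.read 13 (.reg 17)) (findSame ρ) (findOpp ρ)))) .skip)))) .skip) .skip))

variable {B n : ℕ} {σ : MachineState} {L : Ladder} {w : Bool × ℕ → ℕ}

/-- the outcome of `findBox` -/
def Found (L : Ladder) (ρ : Bool) (i : ℕ) (τ : MachineState) : Prop :=
  (τ.reg 13 = 1 ∧ ∃ κ, L.Cand ρ i (sides ρ i (τ.reg 15)) (sides ρ (τ.reg 19) (τ.reg 20)) κ) ∨
    (τ.reg 13 = 0 ∧ ∀ lo hi κ, ¬ L.Cand ρ i lo hi κ)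

lemma checkGap_wp {ρ : Bool} {x z : ℕ} {Q : MachineState → Prop} (h : Prepared L w n σ) (hB : 1 ≤ B)
    (hx : σ.reg 14 = x) (hz : σ.reg 18 = z) (hxN : x < L.N !ρ)
    (h1 : (x < z → L.con (!ρ) x) → Q (σ.setReg 13 1)) (h2 : ¬ (x < z → L.con (!ρ) x) → Q σ) :
    (checkGap ρ).wp B Q σ := by
  simp only [checkGap, wp, Expr.eval, hx, hz, h.vert hxN, Nat.pos_iff_ne_zero, h.con hxN]
  exact ⟨fun hlt => ⟨fun hc => ⟨hB, h1 fun _ => hc⟩, fun hc => h2 fun h => hc (h hlt)⟩,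
    fun hlt => ⟨hB, h1 fun h => absurd h hlt⟩⟩

lemma Prepared.setReg (h : Prepared L w n σ) {r : ℕ} (h0 : r ≠ 0) (h3 : r ≠ 3) (h4 : r ≠ 4) (x : ℕ) :
    Prepared L w n (σ.setReg r x) := by
  refine ⟨?_, fun ρ => ?_, h.sum, h.vert, h.lt, h.con, h.maxOut, h.minOut, h.maxIn, h.minIn, h.next⟩
  · rw [setReg_reg, if_neg h0.symm, h.reg0]
  · rw [setReg_reg, if_neg (by cases ρ <;> simp [lenReg, h3.symm, h4.symm]), h.len]

/-- Registers 18, 19 and 20 receive `z`, the sink height `y` and the highest in-neighbour of the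
sink, as in `Cand.mk_same`; if a test fails, `not_cand_same` applies. -/
lemma findSame_wp {ρ : Bool} {i x y a : ℕ} (h : Prepared L w n σ) (hB : n < B)
    (h13 : σ.reg 13 = 0) (h14 : σ.reg 14 = x) (h15 : σ.reg 15 = a) (h16 : σ.reg 16 = y)
    (h17 : σ.reg 17 = w (ρ, y)) (hp : σ.reg (ptrReg ρ) = i) (con : L.con ρ i)
    (hx : L.E (ρ, i) (!ρ, x)) (max_x : ∀ j, L.E (ρ, i) (!ρ, j) → j ≤ x)
    (ha : L.E (ρ, i) (!ρ, a)) (min_a : ∀ j, L.E (ρ, i) (!ρ, j) → a ≤ j)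
    (hiy : i < y) (next : ∀ k l, i < k → k < y → ¬ L.X ρ k l) (hy : y < L.N ρ)
    (hne : σ.arr 13 (w (ρ, y)) ≠ 0) : (findSame ρ).wp B (Found L ρ i) σ := by
  have hs := h.sum
  have hyn : y < n := by cases ρ <;> omega
  obtain ⟨v, hv, hv', max_v⟩ := (h.maxIn hy).resolve_left fun h => hne h.1
  obtain ⟨z, hzn, hz, hz', min_z⟩ := (h.minIn hy).resolve_left fun h => h.2 _ hv'
  have p18 : ptrReg ρ ≠ 18 := by cases ρ <;> decide
  have p19 : ptrReg ρ ≠ 19 := by cases ρ <;> decide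
  have p20 : ptrReg ρ ≠ 20 := by cases ρ <;> decide
  have hvn : v < n := by have := (L.dom hv').1; cases ρ <;> simp at this <;> omega
  -- Minima are stored as `n` minus the height, hence the decoding by a second subtraction from `n`.
  simp only [findSame, wp, Expr.eval, setReg_reg, setReg_arr, Nat.reduceEqDiff, if_false,
    h.reg0, h17, hz, hv, h16, hp, p18, p19, p20, show n - (n - z) = z by omega,
    Nat.add_sub_cancel]
  have hP := ((h.setReg (r := 18) (by simp) (by simp) (by simp) z).setReg (r := 19) (by simp)
    (by simp) (by simp) y).setReg (r := 20) (by simp) (by simp) (by simp) v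
  refine ⟨by omega, by omega, by omega, fun hlt => checkGap_wp (x := x) (z := z) hP (by omega)
    (by simp [setReg_reg, h14]) (by simp [setReg_reg]) (L.dom hx).2 (fun hc => .inl ?_)
    (fun hc => .inr ?_), fun hlt => .inr ?_⟩
  · simp only [setReg_reg, Nat.reduceEqDiff, if_true, if_false, h15, true_and]
    exact ⟨ρ, .mk_same x y z con (by simp) hx max_x (by simpa) (by simpa) hiy next hc hz' min_z
      (by simp) hlt (by simpa) (by simpa)⟩
  · simp only [setReg_reg, Nat.reduceEqDiff, if_false, h13, true_and]
    exact fun _ _ _ => not_cand_same hx max_x hiy next hz' min_z fun h => hc h.2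
  · simp only [setReg_reg, Nat.reduceEqDiff, if_false, h13, true_and]
    exact fun _ _ _ => not_cand_same hx max_x hiy next hz' min_z fun h => hlt h.1

lemma findOpp_wp {ρ : Bool} {i x y a : ℕ} (h : Prepared L w n σ) (hB : n < B)
    (h13 : σ.reg 13 = 0) (h14 : σ.reg 14 = x) (h15 : σ.reg 15 = a)
    (h17 : σ.reg 17 = w (ρ, y)) (con : L.con ρ i)
    (hx : L.E (ρ, i) (!ρ, x)) (max_x : ∀ j, L.E (ρ, i) (!ρ, j) → j ≤ x)
    (ha : L.E (ρ, i) (!ρ, a)) (min_a : ∀ j, L.E (ρ, i) (!ρ, j) → a ≤ j)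
    (hiy : i < y) (next : ∀ k l, i < k → k < y → ¬ L.X ρ k l) (hy : y < L.N ρ)
    {l : ℕ} (hl : L.X ρ y l) (heq : σ.arr 13 (w (ρ, y)) = 0) :
    (findOpp ρ).wp B (Found L ρ i) σ := by
  have hs := h.sum
  have no_in := ((h.maxIn hy).resolve_right fun ⟨x, h, _⟩ => by omega).2
  obtain ⟨z, hzn, hz, hz', min_z⟩ := (h.minOut hy).resolve_left fun h =>
    (hl.elim (h.2 l) (no_in l))
  have hzN := (L.dom hz').2
  obtain ⟨v, hv, hv', max_v⟩ := (h.maxIn hzN).resolve_left fun h => h.2 y (by simpa)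
  rw [Bool.not_not] at hv'
  simp only [Bool.not_not] at max_v
  have hvn : v < n := by have := (L.dom hv').1; cases ρ <;> simp at this <;> omega
  simp only [findOpp, wp, Expr.eval, setReg_reg, setReg_arr, Nat.reduceEqDiff, if_true, if_false,
    h.reg0, h17, hz, show n - (n - z) = z by omega, h.vert hzN, hv, h15, Nat.add_sub_cancel]
  have hP := ((h.setReg (r := 18) (by simp) (by simp) (by simp) z).setReg (r := 19) (by simp)
    (by simp) (by simp) v).setReg (r := 20) (by simp) (by simp) (by simp) z
  refine ⟨by omega, by omega, by omega, fun hlt => checkGap_wp (x := x) (z := z) hP (by omega)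
    (by simp [setReg_reg, h14]) (by simp [setReg_reg]) (L.dom hx).2 (fun hc => .inl ?_)
    (fun hc => .inr ?_), fun hlt => .inr ?_⟩
  · simp only [setReg_reg, Nat.reduceEqDiff, if_true, if_false, h15, true_and]
    exact ⟨!ρ, .mk_opp x y z con (by simp) hx max_x (by simpa) (by simpa) hiy next hc no_in hz'
      min_z (by simp) (by simpa) (by simpa) (by simpa)⟩
  · simp only [setReg_reg, Nat.reduceEqDiff, if_false, h13, true_and]
    exact fun _ _ _ => not_cand_opp hx max_x hiy next no_in hz' min_z ha min_a fun h => hc h.2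
  · simp only [setReg_reg, Nat.reduceEqDiff, if_false, h13, true_and]
    exact fun _ _ _ => not_cand_opp hx max_x hiy next no_in hz' min_z ha min_a fun h => hlt h.1

lemma findBox_exec {ρ : Bool} {i : ℕ} (h : Prepared L w n σ) (hB : n < B)
    (hp : σ.reg (ptrReg ρ) = i) (hi : i < L.N ρ) :
    Exec B (findBox ρ) σ 100 fun τ => Same [] [6, 13, 14, 15, 16, 17, 18, 19, 20] σ τ ∧
      Found L ρ i τ := by
  refine Exec.same ((wp.exec ?_).mono (C₁ := Program.cost _)
    (by cases ρ <;> simp [findBox, findSame, findOpp, checkGap, cost, Expr.cost]) fun _ h => h)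
    (by cases ρ <;> decide) (by cases ρ <;> decide)
  have hs := h.sum
  have p6 : ptrReg ρ ≠ 6 := by cases ρ <;> decide
  have p13 : ptrReg ρ ≠ 13 := by cases ρ <;> decide
  have p14 : ptrReg ρ ≠ 14 := by cases ρ <;> decide
  have p15 : ptrReg ρ ≠ 15 := by cases ρ <;> decide
  have p16 : ptrReg ρ ≠ 16 := by cases ρ <;> decide
  have p17 : ptrReg ρ ≠ 17 := by cases ρ <;> decide
  have hwn := h.lt hi
  have hout : ∀ x, L.E (ρ, i) (!ρ, x) → x < n := fun x hx => by
    have := (L.dom hx).2; cases ρ <;> simp at this <;> omega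
  have hnext : σ.arr (nextArr ρ) (i + 1) ≤ n := by
    rcases h.next ρ (i + 1) with h1 | ⟨y, h1, h2, ⟨l, h3⟩, -⟩
    · omega
    · have := h3.dom.1; cases ρ <;> omega
  have hout' : σ.arr 11 (w (ρ, i)) ≤ n := by
    rcases h.maxOut hi with h1 | ⟨x, h1, h2, -⟩
    · omega
    · have := hout x h2; omega
  simp only [findBox, wp, Expr.eval, setReg_reg, setReg_arr, Nat.reduceEqDiff, if_true, if_false,
    p6, p13, p14, p15, hp, h.vert hi, h.reg0, Nat.pos_iff_ne_zero, h.con hi]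
  -- The three outer tests are the necessary conditions of `Cand.exists_next`; each failure rules
  -- out every candidate.
  refine ⟨by omega, by omega, fun hcon => ⟨fun hne => ⟨by omega, by omega, by omega, fun hne' =>
    ⟨by omega, ?_⟩, fun hno => .inr ⟨by simp [setReg_reg], fun _ _ _ hc => ?_⟩⟩,
    fun hno => .inr ⟨by simp [setReg_reg], fun _ _ _ hc => ?_⟩⟩,
    fun hno => .inr ⟨by simp [setReg_reg], fun _ _ _ hc => ?_⟩⟩
  · obtain ⟨x, hx, hx', max_x⟩ := (h.maxOut hi).resolve_left fun h => hne h.1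
    obtain ⟨a, han, ha, ha', min_a⟩ := (h.minOut hi).resolve_left fun h => h.2 _ hx'
    obtain ⟨y, hy, hiy, ⟨l, hl⟩, next⟩ := (h.next ρ (i + 1)).resolve_left fun h => hne' h.1
    have next' : ∀ k l, i < k → k < y → ¬ L.X ρ k l := fun k l h1 h2 h3 => next k h1 h2 ⟨l, h3⟩
    have hyN := hl.dom.1
    simp only [hy, Nat.add_sub_cancel, h.vert hyN, hx, ha, show n - (n - a) = a by omega]
    have hP := ((((((h.setReg (r := 13) (by simp) (by simp) (by simp) 0).setReg
      (r := 6) (by simp) (by simp) (by simp) (w (ρ, i))).setReg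
      (r := 14) (by simp) (by simp) (by simp) x).setReg
      (r := 15) (by simp) (by simp) (by simp) a).setReg
      (r := 16) (by simp) (by simp) (by simp) (y + 1)).setReg
      (r := 16) (by simp) (by simp) (by simp) y).setReg
      (r := 17) (by simp) (by simp) (by simp) (w (ρ, y))
    refine ⟨by have := h.lt hyN; omega, fun hin => findSame_wp hP hB ?_ ?_ ?_ ?_ ?_ ?_ hcon hx' max_x ha'
      min_a hiy next' hyN hin, fun hin => findOpp_wp hP hB ?_ ?_ ?_ ?_ hcon hx' max_x ha'
      min_a hiy next' hyN hl (not_not.1 hin)⟩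
    all_goals simp [setReg_reg, p6, p13, p14, p15, p16, p17, hp]
  · obtain ⟨-, -, y, l, hy, hX⟩ := hc.exists_next
    rcases h.next ρ (i + 1) with h1 | ⟨y, h1, -⟩
    · exact h1.2 y hy ⟨l, hX⟩
    · exact hno (by omega)
  · obtain ⟨-, ⟨x, hx⟩, -⟩ := hc.exists_next
    rcases h.maxOut hi with h1 | ⟨y, h1, -⟩
    · exact h1.2 x hx
    · exact hno (by omega)
  · exact hno hc.exists_next.1

end Decompose

/-! ## The sweep -/

section
variable {B C k : ℕ} {P P' : Program} {e₁ e₂ : Expr} {σ τ : MachineState} {Q R : MachineState → Prop}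

lemma Runs.seq_exec (h : Runs B P σ k τ) (h' : Exec B P' τ C Q) :
    Exec B (.seq P P') σ (k + C + 1) Q :=
  let ⟨l, υ, h1, h2, h3⟩ := h'
  ⟨_, υ, .seq h h1, by omega, h3⟩

lemma Exec.ifTrue (h : e₁.eval σ < e₂.eval σ) (hP : Exec B P σ C Q) :
    Exec B (.ifLt e₁ e₂ P P') σ (e₁.cost + e₂.cost + C + 1) Q :=
  let ⟨_, τ, h1, h2, h3⟩ := hP
  ⟨_, τ, .ifTrue h h1, by omega, h3⟩

lemma Exec.ifFalse (h : ¬ e₁.eval σ < e₂.eval σ) (hP : Exec B P' σ C Q) :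
    Exec B (.ifLt e₁ e₂ P P') σ (e₁.cost + e₂.cost + C + 1) Q :=
  let ⟨_, τ, h1, h2, h3⟩ := hP
  ⟨_, τ, .ifFalse h h1, by omega, h3⟩

end

namespace Decompose
open MachineState Program Ladder

/-- bottom height on side `κ` of the box with source on side `ρ` that has been found -/
def loE (ρ κ : Bool) : Expr := .reg (if κ = ρ then ptrReg ρ else 15)
/-- top height on side `κ` of the box with source on side `ρ` that has been found -/
def hiE (ρ κ : Bool) : Expr := .reg (if κ = ρ then 19 else 20)

/-- report the box that has been found -/
def emitBox (ρ : Bool) : Program :=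
  .seq (emit (.add (.sub (.add (hiE ρ false) (.const 1)) (loE ρ false))
    (.sub (.add (hiE ρ true) (.const 1)) (loE ρ true))))
  (.seq (if ρ then emit (.read 9 (loE ρ true)) else .skip)
  (.seq (copy 8 (.sub (.add (hiE ρ false) (.const 1)) (loE ρ false))
    (.add (loE ρ false) (.reg 21)))
  (.seq (copy 9 (.sub (.add (hiE ρ true) (.const 1)) (.add (loE ρ true) (.const ρ.toNat)))
    (.sub (hiE ρ true) (.reg 21)))
  (.seq (.assign 10 (.add (hiE ρ false) (.const 1))) (.assign 11 (.add (hiE ρ true) (.const 1)))))))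

/-- visit the next vertex of side `ρ` -/
def visit (ρ : Bool) : Program := .seq (findBox ρ) (.seq
  (.ifLt (.const 0) (.reg 13) (emitBox ρ) (.ifLt (.reg (ptrReg ρ)) (.reg (topReg ρ)) .skip
    (.seq (emit (.const 1)) (emit (.read (vertArr ρ) (.reg (ptrReg ρ)))))))
  (.assign (ptrReg ρ) (.add (.reg (ptrReg ρ)) (.const 1))))

/-- visit all vertices in a topological order -/
def sweep : Program := .whileLt (.add (.reg 8) (.reg 9)) (.reg 0)
  -- Array 13 holds the highest in-neighbour plus one, so the inner test asks whether the left front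
  -- vertex has an unvisited predecessor on the right.
  (.ifLt (.reg 9) (.reg 4) (.ifLt (.reg 8) (.read 13 (.read 9 (.reg 9))) (visit false) (visit true))
    (visit false))

variable {B n : ℕ} {σ : MachineState} {L : Ladder} {w : Bool × ℕ → ℕ}

lemma Prepared.of_same (h : Prepared L w n σ) {R : List ℕ} {τ : MachineState}
    (hs : Same [3] R σ τ) (hR : ∀ r ∈ [0, 3, 4], r ∉ R) : Prepared L w n τ := by
  have h0 : ∀ ρ, vertArr ρ ∉ [3] := by decide
  have h1 : ∀ ρ, nextArr ρ ∉ [3] := by decide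
  refine ⟨?_, fun ρ => ?_, h.sum, fun hi => ?_, h.lt, fun hi => ?_, fun hi => ?_, fun hi => ?_,
    fun hi => ?_, fun hi => ?_, fun ρ i => ?_⟩
  · rw [hs.2 0 (hR 0 (by simp)), h.reg0]
  · rw [hs.2 _ (hR _ (by cases ρ <;> simp [lenReg])), h.len]
  · rw [hs.1 _ (h0 _), h.vert hi]
  · rw [hs.1 10 (by decide), h.con hi]
  · rw [hs.1 11 (by decide)]; exact h.maxOut hi
  · rw [hs.1 12 (by decide)]; exact h.minOut hi
  · rw [hs.1 13 (by decide)]; exact h.maxIn hi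
  · rw [hs.1 14 (by decide)]; exact h.minIn hi
  · rw [hs.1 _ (h1 _)]; exact h.next ρ i

lemma chain_map (ρ : Bool) (a b : ℕ) :
    (chain ρ a b).map w = (List.range (b - a)).map fun k => w (ρ, a + k) := by
  simp [chain, Function.comp_def]

lemma chain_reverse_map (ρ : Bool) (a b : ℕ) :
    (chain ρ a (b + 1)).reverse.map w = (List.range (b + 1 - a)).map fun k => w (ρ, b - k) := by
  refine List.ext_getElem (by simp [chain]) fun k h1 h2 => ?_
  simp [chain] at h1 h2 ⊢
  congr 2
  omega

lemma length_outline {ρ : Bool} {lo hi : Bool → ℕ} (hle : ∀ κ, lo κ ≤ hi κ) :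
    (outline ρ lo hi).length = hi false + 1 - lo false + (hi true + 1 - lo true) := by
  have := hle true
  cases ρ <;> simp [outline, chain]
  omega

lemma emitBox_exec {ρ : Bool} {lo hi : Bool → ℕ} {l : List ℕ} (h : Prepared L w n σ)
    (hlo : ∀ κ, (loE ρ κ).eval σ = lo κ) (hhi : ∀ κ, (hiE ρ κ).eval σ = hi κ)
    (hle : ∀ κ, lo κ ≤ hi κ) (hN : ∀ κ, hi κ < L.N κ) (hl : OutIs σ l)
    (hB : l.length + n + 2 ≤ B) :
    Exec B (emitBox ρ) σ (60 * (outline ρ lo hi).length + 100) fun τ =>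
      Same [3] [10, 11, 12, 21] σ τ ∧
      OutIs τ (l ++ (outline ρ lo hi).length :: (outline ρ lo hi).map w) ∧
      ∀ κ, τ.reg (topReg κ) = hi κ + 1 := by
  have hlen := length_outline (ρ := ρ) hle
  have hs := h.sum
  have h1 := hle false
  have h2 := hle true
  have h3 := hN false
  have h4 := hN true
  have d1 : ∀ ρ κ : Bool, (if κ = ρ then ptrReg ρ else 15) ∉ [12, 21] := by decide
  have d2 : ∀ ρ κ : Bool, (if κ = ρ then 19 else 20) ∉ [12, 21] := by decide
  have ev : ∀ {R : List ℕ} {τ : MachineState}, Same [3] R σ τ → R ⊆ [12, 21] →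
      ∀ κ, (loE ρ κ).eval τ = lo κ ∧ (hiE ρ κ).eval τ = hi κ := by
    intro R τ hS hR κ
    rw [← hlo, ← hhi]
    simp only [loE, hiE, Expr.eval]
    exact ⟨hS.2 _ fun hm => d1 _ _ (hR hm), hS.2 _ fun hm => d2 _ _ (hR hm)⟩
  have cl : ∀ κ, (loE ρ κ).cost = 1 := fun _ => rfl
  have ch : ∀ κ, (hiE ρ κ).cost = 1 := fun _ => rfl
  refine Exec.same (Exec.seq (C₁ := 18) (C₂ := 60 * (outline ρ lo hi).length + 81)
    ((emit_exec (x := (outline ρ lo hi).length) hl ?_ ?_ ?_).mono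
      (by simp [Expr.cost, cl, ch]) fun _ h => h) ?_ (by omega)) ?_ ?_
  · simp only [Expr.eval, (ev (.refl _ [] σ) (by simp) _).1, (ev (.refl _ [] σ) (by simp) _).2]
    exact hlen.symm
  · omega
  · omega
  · rintro τ₁ ⟨s1, o1⟩
    refine Exec.seq (C₁ := 9) (C₂ := 60 * (outline ρ lo hi).length + 71)
      (Q := fun τ => Same [3] [12] σ τ ∧ OutIs τ (l ++ [(outline ρ lo hi).length] ++
        (if ρ then [(true, lo true)] else []).map w)) ?_ ?_ (by omega)
    · cases ρ with
      | false => exact ⟨_, τ₁, .skip _, by omega, s1, by simpa using o1⟩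
      | true =>
        refine (emit_exec (x := w (true, lo true)) o1 ?_ ?_ ?_).mono le_rfl fun τ h' =>
          ⟨(s1.trans h'.1).mono (by simp) (by simp), by simpa using h'.2⟩
        · simp only [Expr.eval, (ev s1 (by simp) _).1, s1.1 9 (by simp)]
          exact h.vert (ρ := true) (by omega)
        · have := h.lt (ρ := true) (i := lo true) (by omega)
          omega
        · simp; omega
    rintro τ₂ ⟨s2, o2⟩
    have hout : ∀ b : Bool, ((if b then [(true, lo true)] else []).map w).length ≤ 1 := by
      intro b; cases b <;> simp
    have hout' := hout ρ
    refine Exec.seq (C₁ := 25 * (hi false + 1 - lo false) + 15)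
      (C₂ := 30 * (hi true + 1 - lo true) + 50)
      ((copy_exec (N := hi false + 1 - lo false) (f := fun k => w (false, lo false + k)) o2
        ?_ ?_ ?_ ?_).mono (by simp only [Expr.cost, cl, ch]; omega) fun _ h => h) ?_ (by omega)
    · simp only [List.length_append, List.length_singleton] at hout' ⊢
      omega
    · intro τ hS
      have hS' := (s2.trans hS).mono (A' := [3]) (R' := [12, 21]) (by simp) (by simp)
      simp only [Expr.eval, (ev hS' (by simp) _).1, (ev hS' (by simp) _).2]
    · intro k hk τ hS hr
      have hS' := (s2.trans hS).mono (A' := [3]) (R' := [12, 21]) (by simp) (by simp)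
      simp only [Expr.eval, (ev hS' (by simp) _).1, hr, hS'.1 8 (by simp)]
      exact h.vert (ρ := false) (by omega)
    · intro k hk
      have := h.lt (ρ := false) (i := lo false + k) (by omega)
      omega
    rintro τ₃ ⟨s3, o3⟩
    have s3' := (s2.trans s3).mono (A' := [3]) (R' := [12, 21]) (by simp) (by simp)
    have hρ : ρ.toNat ≤ 1 := Bool.toNat_le ρ
    -- A source on the left side has already been written, so `ρ.toNat` shortens the descending copy
    -- of the left chain by one.
    refine Exec.seq (C₁ := 30 * (hi true + 1 - lo true) + 20) (C₂ := 20)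
      ((copy_exec (N := hi true + 1 - (lo true + ρ.toNat)) (f := fun k => w (true, hi true - k)) o3
        ?_ ?_ ?_ ?_).mono (by simp only [Expr.cost, cl, ch]; omega) fun _ h => h) ?_ (by omega)
    · simp only [List.length_append, List.length_singleton, List.length_map, List.length_range]
        at hout' ⊢
      omega
    · intro τ hS
      have hS' := (s3'.trans hS).mono (A' := [3]) (R' := [12, 21]) (by simp) (by simp)
      simp only [Expr.eval, (ev hS' (by simp) _).1, (ev hS' (by simp) _).2]
    · intro k hk τ hS hr
      have hS' := (s3'.trans hS).mono (A' := [3]) (R' := [12, 21]) (by simp) (by simp)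
      simp only [Expr.eval, (ev hS' (by simp) _).2, hr, hS'.1 9 (by simp)]
      exact h.vert (ρ := true) (by omega)
    · intro k hk
      have := h.lt (ρ := true) (i := hi true - k) (by omega)
      omega
    rintro τ₄ ⟨s4, o4⟩
    have s4' := (s3'.trans s4).mono (A' := [3]) (R' := [12, 21]) (by simp) (by simp)
    have e1 := (ev s4' (by simp) false).2
    have e2 := (ev s4' (by simp) true).2
    refine (wp.exec ?_).mono (C₁ := Program.cost _) (by simp [cost, Expr.cost, ch]) fun _ h => h
    have e3 : (hiE ρ true).eval (τ₄.setReg 10 (hi false + 1)) = hi true := by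
      rw [← e2]; cases ρ <;> simp [hiE, Expr.eval, setReg_reg]
    simp only [wp, Expr.eval, e1, e3]
    refine ⟨by omega, by omega, ?_, fun κ => ?_⟩
    · refine OutIs.of_same (A := []) (R := [10, 11]) (l := _) ?_
        (((Same.refl _ _ τ₄).setReg (by simp) _).setReg (by simp) _) (by simp) (by simp)
      convert o4 using 1
      rw [outline, List.map_append, List.map_append, chain_reverse_map, chain_map]
      cases ρ <;> simp
    · cases κ <;> simp [topReg, setReg_reg]
  · cases ρ <;> decide
  · cases ρ <;> decide

end Decompose

/-! ### The cost of the sweep, amortized over its output. -/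

namespace Decompose
open MachineState Program Ladder

/-- the words that report a list of elements of the decomposition -/
def words (w : Bool × ℕ → ℕ) (out : List ((Bool × ℕ) × List (Bool × ℕ))) : List ℕ :=
  out.flatMap fun e => e.2.length :: e.2.map w

lemma length_words (w : Bool × ℕ → ℕ) (out : List ((Bool × ℕ) × List (Bool × ℕ))) :
    (words w out).length = outputLength out := by
  simp [words, outputLength, List.length_flatMap]

/-- the registers in the state of the sweep given by `ptr`, `top` and `out` -/
structure Registers (L : Ladder) (w : Bool × ℕ → ℕ) (n : ℕ) (ptr top : Bool → ℕ)
    (out : List ((Bool × ℕ) × List (Bool × ℕ))) (τ : MachineState) : Prop where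
  prepared : Prepared L w n τ
  ptr : ∀ ρ, τ.reg (ptrReg ρ) = ptr ρ
  top : ∀ ρ, τ.reg (topReg ρ) = top ρ
  out : OutIs τ (words w out)

variable {B n : ℕ} {σ : MachineState} {L : Ladder} {w : Bool × ℕ → ℕ} {ptr top : Bool → ℕ}
  {out : List ((Bool × ℕ) × List (Bool × ℕ))}

lemma Registers.of_same (h : Registers L w n ptr top out σ) {R : List ℕ} {τ : MachineState}
    (hs : Same [] R σ τ) (hR : ∀ r ∈ [0, 3, 4, 8, 9, 10, 11, 12], r ∉ R) :
    Registers L w n ptr top out τ := by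
  refine ⟨h.prepared.of_same (hs.mono (by simp) (List.Subset.refl _))
    fun r hr => hR r (by simp at hr ⊢; omega), fun ρ => ?_, fun ρ => ?_,
    h.out.of_same hs (by simp) (hR _ (by simp))⟩
  · rw [hs.2 _ (hR _ (by cases ρ <;> simp [ptrReg])), h.ptr]
  · rw [hs.2 _ (hR _ (by cases ρ <;> simp [topReg])), h.top]

lemma Registers.advance (h : Registers L w n ptr top out σ) (ρ : Bool) (hB : ptr ρ < B) :
    Exec B (.assign (ptrReg ρ) (.add (.reg (ptrReg ρ)) (.const 1))) σ 4
      (Registers L w n (Function.update ptr ρ (ptr ρ + 1)) top out) := by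
  refine (wp.exec ?_).mono (C₁ := Program.cost _) (by simp [cost, Expr.cost]) fun _ h => h
  simp only [wp, Expr.eval, h.ptr]
  have hs : Same [3] [ptrReg ρ] σ (σ.setReg (ptrReg ρ) (ptr ρ + 1)) :=
    (Same.refl _ _ σ).setReg (by simp) _
  refine ⟨hB, h.prepared.of_same hs (by cases ρ <;> decide), fun κ => ?_, fun κ => ?_,
    h.out.of_same (A := []) ((Same.refl _ [ptrReg ρ] σ).setReg (by simp) _) (by simp)
      (by cases ρ <;> decide)⟩
  · have := h.ptr κ
    revert this
    cases ρ <;> cases κ <;> simp [setReg_reg, ptrReg]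
  · have := h.top κ
    revert this
    cases ρ <;> cases κ <;> simp [setReg_reg, ptrReg, topReg]

/-- A visit is not of constant cost, but it takes at most `300` steps plus `60` for each word that
it appends. -/
lemma visit_exec {ρ : Bool} (h : Registers L w n ptr top out σ) (hI : L.SweepInv ptr top out)
    (hρ : ptr ρ < L.N ρ) (hin : ∀ x, L.E x (ρ, ptr ρ) → x.2 < ptr x.1) (hB : 7 * n + 3 ≤ B) :
    ∃ C, Exec B (visit ρ) σ C fun τ => ∃ top' out',
      Registers L w n (Function.update ptr ρ (ptr ρ + 1)) top' out' τ ∧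
      L.SweepInv (Function.update ptr ρ (ptr ρ + 1)) top' out' ∧
      C + 60 * outputLength out ≤ 60 * outputLength out' + 300 := by
  have hlen := hI.outputLength_le h.prepared.sum
  have hlen' := length_words w out
  have hNn : L.N ρ ≤ n := by have := h.prepared.sum; cases ρ <;> omega
  obtain ⟨k, τ, hrun, hk, hS, hF⟩ := findBox_exec h.prepared (B := B) (by omega) (h.ptr ρ) hρ
  have hτ := h.of_same hS (by decide)
  rcases hF with ⟨hflag, κ, hc⟩ | ⟨hflag, hno⟩
  · set lo := sides ρ (ptr ρ) (τ.reg 15) with hlo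
    set hi := sides ρ (τ.reg 19) (τ.reg 20) with hhi
    have hE := emitBox_exec (B := B) (ρ := ρ) (lo := lo) (hi := hi) hτ.prepared
      (fun κ => by simp only [loE, Expr.eval, hlo, sides]; split_ifs <;> simp [hτ.ptr])
      (fun κ => by simp only [hiE, Expr.eval, hhi, sides]; split_ifs <;> rfl) hc.isBox.le
      hc.isBox.hi_lt hτ.out (by omega)
    refine ⟨_, hrun.seq_exec (Exec.seq (Exec.ifTrue (by simp [Expr.eval, hflag])
      (hE.mono (R := Registers L w n ptr (fun κ => hi κ + 1)
        (out ++ [((ρ, ptr ρ), outline ρ lo hi)])) le_rfl fun υ hυ => ?_))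
      (fun υ hυ => (hυ.advance ρ (by omega)).mono le_rfl fun υ' hυ' =>
        ⟨_, _, hυ', hI.emit_box hρ hin hc, ?_⟩) le_rfl)⟩
    · refine ⟨hτ.prepared.of_same hυ.1 (by decide), fun κ => ?_, hυ.2.2, ?_⟩
      · rw [hυ.1.2 _ (by revert κ; decide), hτ.ptr]
      · simpa [words] using hυ.2.1
    · simp only [outputLength, List.map_append, List.sum_append, List.map_singleton,
        List.sum_singleton, Expr.cost]
      omega
  · have hflag' : ¬ (Expr.const 0).eval τ < (Expr.reg 13).eval τ := by simp [Expr.eval, hflag]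
    by_cases hlt : ptr ρ < top ρ
    · refine ⟨_, hrun.seq_exec (Exec.seq (C₂ := 4) (Exec.ifFalse (C := 4) hflag'
        (Exec.ifTrue (C := 1) (by simpa only [Expr.eval, hτ.ptr, hτ.top])
          (Q := Registers L w n ptr top out) ⟨_, τ, .skip τ, le_rfl, hτ⟩))
        (fun υ hυ => (hυ.advance ρ (by omega)).mono le_rfl fun υ' hυ' =>
          ⟨_, _, hυ', hI.skip hρ hin hno hlt, ?_⟩) le_rfl)⟩
      simp only [Expr.cost]
      omega
    · refine ⟨_, hrun.seq_exec (Exec.seq (C₂ := 4) (Exec.ifFalse hflag'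
        (Exec.ifFalse (by simpa only [Expr.eval, hτ.ptr, hτ.top])
          (Q := Registers L w n ptr top (out ++ [((ρ, ptr ρ), [(ρ, ptr ρ)])]))
          ((emit_exec hτ.out (x := 1) rfl (by omega) (by omega)).seq (C₂ := 9) (fun υ hυ => ?_)
            le_rfl)))
        (fun υ hυ => (hυ.advance ρ (by omega)).mono le_rfl fun υ' hυ' =>
          ⟨_, _, hυ', hI.emit_free hρ hin hno (not_lt.1 hlt), ?_⟩) le_rfl)⟩
      · have hw := h.prepared.lt hρ
        have h0 : vertArr ρ ∉ [3] := by cases ρ <;> decide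
        have h1 : ptrReg ρ ∉ [12] := by cases ρ <;> decide
        refine (emit_exec (x := w (ρ, ptr ρ)) hυ.2 ?_ (by omega) (by simp; omega)).mono
          le_rfl fun υ' hυ' => ?_
        · simp only [Expr.eval, hυ.1.1 _ h0, hυ.1.2 _ h1, hτ.ptr]
          exact hτ.prepared.vert hρ
        · have hs := (hυ.1.trans hυ'.1).mono (A' := [3]) (R' := [12]) (by simp) (by simp)
          refine ⟨hτ.prepared.of_same hs (by decide), fun κ => ?_, fun κ => ?_, ?_⟩
          · rw [hs.2 _ (by revert κ; decide), hτ.ptr]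
          · rw [hs.2 _ (by revert κ; decide), hτ.top]
          · simpa [words] using hυ'.2
      · simp only [outputLength, List.map_append, List.sum_append, List.map_singleton,
          List.sum_singleton, Expr.cost, List.length_singleton]
        omega

lemma sweep_exec (h : Registers L w n (fun _ => 0) (fun _ => 0) [] σ) (hB : 7 * n + 3 ≤ B) :
    Exec B sweep σ (700 * n + 10) fun τ => ∃ top out, Registers L w n L.N top out τ ∧
      L.SweepInv L.N top out := by
  refine (Exec.whileLt
    (Inv := fun τ => ∃ ptr top out, Registers L w n ptr top out τ ∧ L.SweepInv ptr top out)
    -- Pay `60` for each of the at most `6 * n` output words, and `340` for each vertex: `300` for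
    -- the visit, the rest for the tests of the loop.
    (Φ := fun τ => 60 * (6 * n - τ.reg 12) + 340 * (n - (τ.reg 8 + τ.reg 9)))
    ⟨_, _, _, h, SweepInv.start⟩ ?_ ?_).mono (C₁ := 60 * (6 * n) + 340 * n + 6) (by omega) ?_
  · rintro τ ⟨ptr, top, out, hτ, hI⟩ hlt
    have hsum := hτ.prepared.sum
    have e8 : τ.reg 8 = ptr false := hτ.ptr false
    have e9 : τ.reg 9 = ptr true := hτ.ptr true
    have e4 : τ.reg 4 = L.N true := hτ.prepared.len true
    have hle := hI.le
    simp only [Expr.eval, e8, e9, hτ.prepared.reg0] at hlt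
    have key : ∀ {ρ C υ top' out'}, Registers L w n (Function.update ptr ρ (ptr ρ + 1)) top' out' υ →
        L.SweepInv (Function.update ptr ρ (ptr ρ + 1)) top' out' →
        C + 60 * outputLength out ≤ 60 * outputLength out' + 300 →
        C + 20 + 60 * (6 * n - υ.reg 12) + 340 * (n - (υ.reg 8 + υ.reg 9)) ≤
          60 * (6 * n - τ.reg 12) + 340 * (n - (τ.reg 8 + τ.reg 9)) := by
      intro ρ C υ top' out' h1 h2 h3
      have h4 := hI.outputLength_le hsum
      have h5 := h2.outputLength_le hsum
      have h6 : υ.reg 8 = _ := h1.ptr false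
      have h7 : υ.reg 9 = _ := h1.ptr true
      have h8 := SweepInv.sum_update (ρ := ρ) ptr (ptr ρ + 1)
      rw [h6, h7, e8, e9, h1.out.1, hτ.out.1, length_words, length_words]
      omega
    have run : ∀ ρ, ptr ρ < L.N ρ → (∀ x, L.E x (ρ, ptr ρ) → x.2 < ptr x.1) →
        ∃ C, Exec B (visit ρ) τ C fun υ =>
          (∃ ptr top out, Registers L w n ptr top out υ ∧ L.SweepInv ptr top out) ∧
          C + 20 + 60 * (6 * n - υ.reg 12) + 340 * (n - (υ.reg 8 + υ.reg 9)) ≤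
          60 * (6 * n - τ.reg 12) + 340 * (n - (τ.reg 8 + τ.reg 9)) := by
      intro ρ hρ hin
      obtain ⟨C, hC⟩ := visit_exec hτ hI hρ hin hB
      exact ⟨C, hC.mono le_rfl fun υ ⟨top', out', h1, h2, h3⟩ =>
        ⟨⟨_, top', out', h1, h2⟩, key h1 h2 h3⟩⟩
    by_cases h1 : ptr true < L.N true
    · have hR := hτ.prepared.maxIn h1
      have hv : (Expr.read 13 (.read 9 (.reg 9))).eval τ = τ.arr 13 (w (true, ptr true)) := by
        simp only [Expr.eval, e9]
        rw [← hτ.prepared.vert h1]; rfl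
      have hiff : ¬ ptr false < τ.arr 13 (w (true, ptr true)) ↔
          ∀ j, L.E (false, j) (true, ptr true) → j < ptr false := by
        rcases hR with ⟨h2, h3⟩ | ⟨x, h2, h3, h4⟩
        · exact ⟨fun _ j hj => absurd hj (h3 j), fun _ => by omega⟩
        · rw [h2]
          refine ⟨fun h5 j hj => ?_, fun h5 => ?_⟩
          · have := h4 j hj; omega
          · have := h5 x h3; omega
      by_cases h2 : ptr false < τ.arr 13 (w (true, ptr true))
      · obtain ⟨h3, h4⟩ := ready_false hle (by omega) (fun h => (hiff.2 h.2) h2)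
        obtain ⟨C, hC⟩ := run false h3 h4
        refine ⟨_, (Exec.ifTrue (by simpa only [Expr.eval, e9, e4]) (Exec.ifTrue
          (by rw [hv]; simpa only [Expr.eval, e8]) hC)).mono le_rfl fun υ hυ => ⟨hυ.1, ?_⟩⟩
        have := hυ.2
        simp only [Expr.cost]
        omega
      · obtain ⟨C, hC⟩ := run true h1 fun x => ready_true (hiff.1 h2)
        refine ⟨_, (Exec.ifTrue (by simpa only [Expr.eval, e9, e4]) (Exec.ifFalse
          (by rw [hv]; simpa only [Expr.eval, e8]) hC)).mono le_rfl fun υ hυ => ⟨hυ.1, ?_⟩⟩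
        have := hυ.2
        simp only [Expr.cost]
        omega
    · obtain ⟨h3, h4⟩ := ready_false hle (by omega) (fun h => h1 h.1)
      obtain ⟨C, hC⟩ := run false h3 h4
      refine ⟨_, (Exec.ifFalse (by simpa only [Expr.eval, e9, e4]) hC).mono le_rfl
        fun υ hυ => ⟨hυ.1, ?_⟩⟩
      have := hυ.2
      simp only [Expr.cost]
      omega
  · simp only [Expr.cost]
    omega
  · rintro τ ⟨⟨ptr, top, out, hτ, hI⟩, hlt⟩
    have e8 : τ.reg 8 = ptr false := hτ.ptr false
    have e9 : τ.reg 9 = ptr true := hτ.ptr true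
    have hsum := hτ.prepared.sum
    simp only [Expr.eval, e8, e9, hτ.prepared.reg0] at hlt
    have h1 := hI.le false
    have h2 := hI.le true
    obtain rfl : ptr = L.N := by
      funext ρ
      cases ρ <;> omega
    exact ⟨top, out, hτ, hI⟩

end Decompose

/-! ## The tables describe the ladder -/

namespace Decompose
open MachineState Program Ladder

lemma toNat_injective : ∀ {a b : Bool}, a.toNat = b.toNat → a = b := by decide

/-- The shift by one makes all entries of members positive, so that a supremum `0` signals the empty
set; for minima the same is achieved by `n - j` with `j < n`. -/
lemma maxSpec_sup {P : ℕ → Prop} {m : ℕ} {F : ℕ → ℕ}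
    (h1 : ∀ e < m, F e = 0 ∨ ∃ j, P j ∧ F e = j + 1) (h2 : ∀ j, P j → ∃ e < m, F e = j + 1) :
    MaxSpec P ((Finset.range m).sup F) := by
  have hle : ∀ j, P j → j + 1 ≤ (Finset.range m).sup F := fun j hj => by
    obtain ⟨e, he, h⟩ := h2 j hj
    rw [← h]
    exact Finset.le_sup (f := F) (Finset.mem_range.2 he)
  rcases Nat.eq_zero_or_pos m with rfl | hm
  · exact .inl ⟨rfl, fun j hj => by simpa using hle j hj⟩
  · obtain ⟨e, he, h⟩ := Finset.exists_mem_eq_sup (Finset.range m) ⟨0, by simpa⟩ F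
    rcases h1 e (Finset.mem_range.1 he) with h3 | ⟨x, hx, h3⟩
    · exact .inl ⟨h.trans h3, fun j hj => by have := hle j hj; omega⟩
    · exact .inr ⟨x, h.trans h3, hx, fun j hj => by have := hle j hj; omega⟩

lemma minSpec_sup {P : ℕ → Prop} {m n : ℕ} {F : ℕ → ℕ} (hP : ∀ j, P j → j < n)
    (h1 : ∀ e < m, F e = 0 ∨ ∃ j, P j ∧ F e = n - j) (h2 : ∀ j, P j → ∃ e < m, F e = n - j) :
    MinSpec n P ((Finset.range m).sup F) := by
  have hle : ∀ j, P j → n - j ≤ (Finset.range m).sup F := fun j hj => by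
    obtain ⟨e, he, h⟩ := h2 j hj
    rw [← h]
    exact Finset.le_sup (f := F) (Finset.mem_range.2 he)
  rcases Nat.eq_zero_or_pos m with rfl | hm
  · exact .inl ⟨rfl, fun j hj => by have := hle j hj; have := hP j hj; simp at *; omega⟩
  · obtain ⟨e, he, h⟩ := Finset.exists_mem_eq_sup (Finset.range m) ⟨0, by simpa⟩ F
    rcases h1 e (Finset.mem_range.1 he) with h3 | ⟨x, hx, h3⟩
    · exact .inl ⟨h.trans h3, fun j hj => by have := hle j hj; have := hP j hj; omega⟩
    · have := hP x hx
      exact .inr ⟨x, this, h.trans h3, hx, fun j hj => by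
        have := hle j hj; have := hP j hj; omega⟩

/-- `tl` and `hd` list the `m` edges of `L`, and `s` and `h` are the sides and heights of the
vertices, where `w` gives the names of the vertices. -/
structure Listed (L : Ladder) (w : Bool × ℕ → ℕ) (tl hd s h : ℕ → ℕ) (m : ℕ) : Prop where
  sound : ∀ e < m, ∃ x y, L.E x y ∧ tl e = w x ∧ hd e = w y
  complete : ∀ x y, L.E x y → ∃ e < m, tl e = w x ∧ hd e = w y
  side : ∀ x : Bool × ℕ, x.2 < L.N x.1 → s (w x) = x.1.toNat
  height : ∀ x : Bool × ℕ, x.2 < L.N x.1 → h (w x) = x.2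

namespace Listed
variable {L : Ladder} {w : Bool × ℕ → ℕ} {tl hd s h : ℕ → ℕ} {m n : ℕ} {τ : MachineState}

lemma inj (hL : Listed L w tl hd s h m) {x y : Bool × ℕ} (hx : x.2 < L.N x.1) (hy : y.2 < L.N y.1)
    (hxy : w x = w y) : x = y := by
  refine Prod.ext (toNat_injective ?_) ?_
  · rw [← hL.side x hx, ← hL.side y hy, hxy]
  · rw [← hL.height x hx, ← hL.height y hy, hxy]

variable (hL : Listed L w tl hd s h m) {ρ : Bool} {i : ℕ} (hi : i < L.N ρ)
include hL hi

/-- `g` is the encoding of heights, so the same lemma serves the maxima and the minima. -/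
lemma out_sound {g : ℕ → ℕ} (e : ℕ) (he : e < m) :
    (if tl e = w (ρ, i) then if s (tl e) = s (hd e) then 0 else g (h (hd e)) else 0) = 0 ∨
      ∃ j, L.E (ρ, i) (!ρ, j) ∧
        (if tl e = w (ρ, i) then if s (tl e) = s (hd e) then 0 else g (h (hd e)) else 0) = g j := by
  obtain ⟨x, ⟨κ, j⟩, hxy, h1, h2⟩ := hL.sound e he
  by_cases h3 : tl e = w (ρ, i)
  · obtain rfl := hL.inj (L.dom hxy).1 (y := (ρ, i)) hi (h1.symm.trans h3)
    by_cases h4 : κ = ρ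
    · left
      rw [h1, h2, hL.side _ (L.dom hxy).1, hL.side _ (L.dom hxy).2]
      simp [h4]
    · obtain rfl : κ = !ρ := Bool.eq_not.2 h4
      refine .inr ⟨j, hxy, ?_⟩
      rw [h1, h2, hL.side _ (L.dom hxy).1, hL.side _ (L.dom hxy).2, hL.height _ (L.dom hxy).2]
      cases ρ <;> simp
  · left; rw [if_neg h3]

lemma in_sound {g : ℕ → ℕ} (e : ℕ) (he : e < m) :
    (if hd e = w (ρ, i) then if s (tl e) = s (hd e) then 0 else g (h (tl e)) else 0) = 0 ∨
      ∃ j, L.E (!ρ, j) (ρ, i) ∧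
        (if hd e = w (ρ, i) then if s (tl e) = s (hd e) then 0 else g (h (tl e)) else 0) = g j := by
  obtain ⟨⟨κ, j⟩, y, hxy, h1, h2⟩ := hL.sound e he
  by_cases h3 : hd e = w (ρ, i)
  · obtain rfl := hL.inj (L.dom hxy).2 (y := (ρ, i)) hi (h2.symm.trans h3)
    by_cases h4 : κ = ρ
    · left
      rw [h1, h2, hL.side _ (L.dom hxy).1, hL.side _ (L.dom hxy).2]
      simp [h4]
    · obtain rfl : κ = !ρ := Bool.eq_not.2 h4
      refine .inr ⟨j, hxy, ?_⟩
      rw [h1, h2, hL.side _ (L.dom hxy).1, hL.side _ (L.dom hxy).2, hL.height _ (L.dom hxy).1]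
      cases ρ <;> simp
  · left; rw [if_neg h3]

omit hi in
lemma out_complete {g : ℕ → ℕ} (j : ℕ) (hj : L.E (ρ, i) (!ρ, j)) : ∃ e < m,
    (if tl e = w (ρ, i) then if s (tl e) = s (hd e) then 0 else g (h (hd e)) else 0) = g j := by
  obtain ⟨e, he, h1, h2⟩ := hL.complete _ _ hj
  refine ⟨e, he, ?_⟩
  rw [h1, h2, hL.side _ (L.dom hj).1, hL.side _ (L.dom hj).2, hL.height _ (L.dom hj).2]
  cases ρ <;> simp

omit hi in
lemma in_complete {g : ℕ → ℕ} (j : ℕ) (hj : L.E (!ρ, j) (ρ, i)) : ∃ e < m,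
    (if hd e = w (ρ, i) then if s (tl e) = s (hd e) then 0 else g (h (tl e)) else 0) = g j := by
  obtain ⟨e, he, h1, h2⟩ := hL.complete _ _ hj
  refine ⟨e, he, ?_⟩
  rw [h1, h2, hL.side _ (L.dom hj).1, hL.side _ (L.dom hj).2, hL.height _ (L.dom hj).1]
  cases ρ <;> simp

lemma con_iff (hT : Tabulated n tl hd s h m τ) : τ.arr 10 (w (ρ, i)) ≠ 0 ↔ L.con ρ i := by
  rw [(hT _).1, ← Nat.bot_eq_zero, Ne, Finset.sup_eq_bot_iff]
  simp only [Finset.mem_range, not_forall, exists_prop, Nat.bot_eq_zero]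
  constructor
  · rintro ⟨e, he, h1⟩
    obtain ⟨x, ⟨κ, j⟩, hxy, h2, h3⟩ := hL.sound e he
    split_ifs at h1 with h4 h5
    · obtain rfl := hL.inj (L.dom hxy).1 (y := (ρ, i)) hi (h2.symm.trans h4)
      rw [h2, h3, hL.side _ (L.dom hxy).1, hL.side _ (L.dom hxy).2, hL.height _ (L.dom hxy).1,
        hL.height _ (L.dom hxy).2] at h5
      obtain rfl : ρ = κ := toNat_injective h5.1
      have h6 := lt_of_E hxy
      -- Edges within a side go upwards, so the table's test for a height less than `i + 2` leaves
      -- only `i + 1`.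
      obtain rfl : j = i + 1 := by have := h5.2; simp only at this; omega
      exact hxy
    · exact absurd rfl h1
    · exact absurd rfl h1
  · intro hc
    obtain ⟨e, he, h1, h2⟩ := hL.complete _ _ hc
    refine ⟨e, he, ?_⟩
    rw [h1, h2, hL.side _ (L.dom hc).1, hL.side _ (L.dom hc).2, hL.height _ (L.dom hc).1,
        hL.height _ (L.dom hc).2]
    simp

end Listed

lemma Tabulated.of_same {tl hd s h : ℕ → ℕ} {m n : ℕ} {σ τ : MachineState} {A R : List ℕ}
    (hT : Tabulated n tl hd s h m σ) (hs : Same A R σ τ)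
    (hA : ∀ a ∈ [10, 11, 12, 13, 14], a ∉ A) : Tabulated n tl hd s h m τ := by
  intro v
  rw [hs.1 10 (hA _ (by simp)), hs.1 11 (hA _ (by simp)), hs.1 12 (hA _ (by simp)),
    hs.1 13 (hA _ (by simp)), hs.1 14 (hA _ (by simp))]
  exact hT v

lemma Tabulated.specs {L : Ladder} {w : Bool × ℕ → ℕ} {tl hd s h : ℕ → ℕ} {m n : ℕ}
    {τ : MachineState} (hT : Tabulated n tl hd s h m τ) (hL : Listed L w tl hd s h m)
    (hn : ∀ ρ, L.N ρ ≤ n) {ρ : Bool} {i : ℕ} (hi : i < L.N ρ) :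
    (τ.arr 10 (w (ρ, i)) ≠ 0 ↔ L.con ρ i) ∧
    MaxSpec (fun j => L.E (ρ, i) (!ρ, j)) (τ.arr 11 (w (ρ, i))) ∧
    MinSpec n (fun j => L.E (ρ, i) (!ρ, j)) (τ.arr 12 (w (ρ, i))) ∧
    MaxSpec (fun j => L.E (!ρ, j) (ρ, i)) (τ.arr 13 (w (ρ, i))) ∧
    MinSpec n (fun j => L.E (!ρ, j) (ρ, i)) (τ.arr 14 (w (ρ, i))) := by
  obtain ⟨-, h1, h2, h3, h4⟩ := hT (w (ρ, i))
  refine ⟨hL.con_iff hi hT, ?_, ?_, ?_, ?_⟩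
  · rw [h1]
    exact maxSpec_sup (hL.out_sound hi (g := fun j => j + 1)) (hL.out_complete (g := fun j => j + 1))
  · rw [h2]
    exact minSpec_sup (fun j hj => (L.dom hj).2.trans_le (hn _))
      (hL.out_sound hi (g := fun j => n - j)) (hL.out_complete (g := fun j => n - j))
  · rw [h3]
    exact maxSpec_sup (hL.in_sound hi (g := fun j => j + 1)) (hL.in_complete (g := fun j => j + 1))
  · rw [h4]
    exact minSpec_sup (fun j hj => (L.dom hj).1.trans_le (hn _))
      (hL.in_sound hi (g := fun j => n - j)) (hL.in_complete (g := fun j => n - j))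

end Decompose

/-- A graph on `0, …, n - 1` without crossings, embedded with its vertices in convex position, has
at most `2 * n` edges. -/
lemma Noncrossing.length_le {R : ℕ → ℕ → Prop} (hR : Noncrossing R) {n : ℕ}
    (hlt : ∀ {i j}, R i j → i < n ∧ j < n) (hirr : ∀ i, ¬ R i i)
    (hanti : ∀ i j, R i j → ¬ R j i) {l : List (ℕ × ℕ)} (hl : l.Nodup) (hmem : ∀ e ∈ l, R e.1 e.2) :
    l.length ≤ 2 * n := by
  classical
  let U := Placement.U R
  -- Charge an edge to its lower end if it is the longest upward edge there, and to its upper end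
  -- otherwise. Each vertex is charged at most once in each way.
  let f : ℕ × ℕ → ℕ ⊕ ℕ := fun e =>
    if ∃ k, max e.1 e.2 < k ∧ U (min e.1 e.2) k then .inr (max e.1 e.2) else .inl (min e.1 e.2)
  have hU : ∀ e ∈ l, U (min e.1 e.2) (max e.1 e.2) ∧ min e.1 e.2 < max e.1 e.2 := by
    intro e he
    have h1 := hmem e he
    have h2 : e.1 ≠ e.2 := fun h => hirr e.1 (by rw [h] at h1 ⊢; exact h1)
    rcases lt_or_gt_of_ne h2 with h | h
    · simp only [min_eq_left h.le, max_eq_right h.le]; exact ⟨.inl h1, h⟩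
    · simp only [min_eq_right h.le, max_eq_left h.le]; exact ⟨.inr h1, h⟩
  have hminmax : ∀ e ∈ l, ∀ e' ∈ l, min e.1 e.2 = min e'.1 e'.2 → max e.1 e.2 = max e'.1 e'.2 →
      e = e' := by
    rintro ⟨a, b⟩ he ⟨c, d⟩ he' h1 h2
    simp only at h1 h2
    have h3 := hmem _ he
    have h4 := hmem _ he'
    have : (a = c ∧ b = d) ∨ (a = d ∧ b = c) := by omega
    rcases this with ⟨rfl, rfl⟩ | ⟨rfl, rfl⟩
    · rfl
    · exact absurd h4 (hanti _ _ h3)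
  have hinj : Set.InjOn f (l.toFinset : Set (ℕ × ℕ)) := by
    intro e he e' he' hf
    simp only [List.coe_toFinset, Set.mem_ofPred_eq] at he he'
    obtain ⟨h1, h2⟩ := hU e he
    obtain ⟨h3, h4⟩ := hU e' he'
    simp only [f] at hf
    split_ifs at hf with h5 h6 h6
    · simp only [Sum.inr.injEq] at hf
      refine hminmax e he e' he' ?_ hf
      obtain ⟨k, hk, hk'⟩ := h5
      obtain ⟨k', hk2, hk2'⟩ := h6
      -- Of two edges with the same upper end, the inner one starts at a vertex with a longer edge,
      -- and that one crosses the outer edge.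
      rcases lt_trichotomy (min e.1 e.2) (min e'.1 e'.2) with h | h | h
      · exact (hR _ _ _ _ h (hf ▸ h4) hk2 (hf ▸ h1) hk2').elim
      · exact h
      · exact (hR _ _ _ _ h (hf ▸ h2) hk (hf ▸ h3) hk').elim
    · simp only [Sum.inl.injEq] at hf
      refine hminmax e he e' he' hf ?_
      simp only [not_exists, not_and] at h5 h6
      rw [hf] at h5 h1
      exact le_antisymm (not_lt.1 fun h => h6 _ h h1) (not_lt.1 fun h => h5 _ h h3)
  have hmaps : ∀ e ∈ l.toFinset, f e ∈ (Finset.range n).disjSum (Finset.range n) := by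
    intro e he
    have := hlt (hmem e (List.mem_toFinset.1 he))
    simp only [f]
    split_ifs <;> simp <;> omega
  have := Finset.card_le_card_of_injOn f hmaps hinj
  rw [List.toFinset_card_of_nodup hl, Finset.card_disjSum, Finset.card_range] at this
  omega

/-! ## Reports -/

namespace Drawing
open Ladder

section
variable {n T : ℕ}

lemma pairwise_pos {a b c d : ℕ} (hb : b ≤ T) (hd : d ≤ n - T) :
    ((chain false a b ++ (chain true c d).reverse).map (pos n)).Pairwise (· < ·) := by
  rw [List.map_append, List.pairwise_append]
  refine ⟨?_, ?_, ?_⟩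
  · rw [List.pairwise_map, chain, List.pairwise_map]
    exact List.pairwise_lt_range.imp fun h => by simpa using h
  · rw [List.pairwise_map, List.pairwise_reverse, chain, List.pairwise_map]
    refine List.Pairwise.imp_of_mem (fun {i j} hi hj h => ?_) List.pairwise_lt_range
    simp only [List.mem_range, pos_true] at hi hj ⊢
    omega
  · simp only [List.mem_map, chain, List.mem_reverse, List.mem_range]
    rintro _ ⟨_, ⟨k, hk, rfl⟩, rfl⟩ _ ⟨_, ⟨k', hk', rfl⟩, rfl⟩
    simp only [pos_true, pos_false]
    omega

lemma mem_chain {ρ : Bool} {a b : ℕ} {x : Bool × ℕ} :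
    x ∈ chain ρ a b ↔ x.1 = ρ ∧ a ≤ x.2 ∧ x.2 < b := by
  simp only [chain, List.mem_map, List.mem_range]
  constructor
  · rintro ⟨k, hk, rfl⟩
    exact ⟨rfl, Nat.le_add_right _ _, by simp only; omega⟩
  · rintro ⟨rfl, h1, h2⟩
    exact ⟨x.2 - a, by omega, Prod.ext rfl (by simp only; omega)⟩

end

variable {V : Type*} [Fintype V] {p : V → ℝ × ℝ} {G : Digraph V} {n T : ℕ} {pt : ℕ → V}
  (D : Drawing p G n T pt)
include D

lemma isBoundary_chains {lo hi : Bool → ℕ} (hhi : ∀ ρ, hi ρ < len n T ρ) :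
    IsBoundary p (boxSet n T pt lo hi)
      ((chain false (lo false) (hi false + 1) ++
        (chain true (lo true) (hi true + 1)).reverse).map (vt n pt)) := by
  have h1 := hhi false
  have h2 := hhi true
  have hT := D.lt
  simp only [len_true, len_false] at h1 h2
  have hmem : ∀ x : Bool × ℕ, x ∈ chain false (lo false) (hi false + 1) ++
      (chain true (lo true) (hi true + 1)).reverse ↔ lo x.1 ≤ x.2 ∧ x.2 ≤ hi x.1 := by
    rintro ⟨_ | _, i⟩ <;> simp [mem_chain]
  have := D.isBoundary (W := boxSet n T pt lo hi) (pairwise_pos (n := n) (T := T) (a := lo false)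
    (b := hi false + 1) (c := lo true) (d := hi true + 1) h1 h2) ?_ ?_
  · rwa [List.map_map] at this
  · simp only [List.mem_map]
    rintro _ ⟨x, hx, rfl⟩
    exact pos_lt hT (((hmem x).1 hx).2.trans_lt (hhi _))
  · intro v
    rw [List.map_map, List.mem_map, mem_boxSet]
    constructor
    · rintro ⟨x, hx, rfl⟩
      exact ⟨x, ((hmem x).1 hx).2.trans_lt (hhi _), rfl, (hmem x).1 hx⟩
    · rintro ⟨x, -, rfl, hx⟩
      exact ⟨x, (hmem x).2 hx, rfl⟩

/-- Right chain upwards, then left chain downwards, is counterclockwise. A source on the left side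
comes last in this list and is rotated to the front. -/
lemma isBoundary_outline {lo hi : Bool → ℕ} (hhi : ∀ ρ, hi ρ < len n T ρ)
    (hle : lo true ≤ hi true) (σ : Bool) :
    IsBoundary p (boxSet n T pt lo hi) ((outline σ lo hi).map (vt n pt)) := by
  have h := D.isBoundary_chains hhi (lo := lo)
  cases σ with
  | false => simpa [outline] using h
  | true =>
    have e : chain true (lo true) (hi true + 1) =
        (true, lo true) :: chain true (lo true + 1) (hi true + 1) := by
      rw [chain, chain, show hi true + 1 - lo true = hi true + 1 - (lo true + 1) + 1 by omega,
        List.range_succ_eq_map]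
      simp [Function.comp_def, Nat.add_assoc, Nat.add_comm 1]
    rw [e, List.reverse_cons, ← List.append_assoc, List.map_append] at h
    simpa [outline] using Placement.isBoundary_of_rotate h

lemma exists_piece {x : Bool × ℕ} {l : List (Bool × ℕ)} (h : D.ladder.ReportedBy x l) :
    ∃ P, D.IsPieceAt x P ∧ Reports p G P (l.map (vt n pt)) := by
  rcases h with ⟨lo, hi, τ, hc, rfl⟩ | ⟨hf, rfl⟩
  · refine ⟨.polygon (boxSet n T pt lo hi), ⟨lo, hi, τ, hc, rfl⟩,
      D.isBoundary_outline hc.isBox.hi_lt (hc.isBox.le _) _, vt n pt (x.1, lo x.1), ?_,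
      (D.isSource_boxSet hc.isBox).2 rfl⟩
    have := hc.isBox.le false
    obtain ⟨_ | _, i⟩ := x
    · rw [outline, chain, show hi false + 1 - lo false = hi false - lo false + 1 by omega,
        List.range_succ_eq_map]
      simp
    · simp [outline]
  · exact ⟨.free (vt n pt x), ⟨rfl, hf.1, hf.2⟩, rfl⟩

lemma exists_reportedBy {x : Bool × ℕ} {P : Piece V} (h : D.IsPieceAt x P) :
    ∃ l, D.ladder.ReportedBy x l := by
  cases P with
  | polygon W =>
    obtain ⟨lo, hi, τ, hc, -⟩ := h
    exact ⟨_, .inl ⟨lo, hi, τ, hc, rfl⟩⟩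
  | free v => exact ⟨_, .inr ⟨⟨h.2.1, h.2.2⟩, rfl⟩⟩

/-- When both pointers have reached the ends, `mem` says that exactly the pieces have been reported,
and `pairwise` that they are in order. -/
lemma exists_decomposition {top : Bool → ℕ} {out : List ((Bool × ℕ) × List (Bool × ℕ))}
    (h : D.ladder.SweepInv (len n T) top out) :
    ∃ Ps : List (Piece V), IsSTPolygonDecomposition p G Ps ∧
      List.Forall₂ (Reports p G) Ps (out.map fun e => e.2.map (vt n pt)) := by
  have key : ∀ e : {e // e ∈ out}, ∃ P, D.IsPieceAt e.1.1 P ∧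
      Reports p G P (e.1.2.map (vt n pt)) := fun e => D.exists_piece ((h.mem e.1).1 e.2).1
  choose f hf hf' using key
  refine ⟨out.attach.map f, ⟨fun P => ?_, ?_⟩, ?_⟩
  · rw [D.isPiece_iff, List.mem_map]
    constructor
    · rintro ⟨e, -, rfl⟩
      exact ⟨_, hf e⟩
    · rintro ⟨x, hx⟩
      obtain ⟨l, hl⟩ := D.exists_reportedBy hx
      have hmem : (x, l) ∈ out := (h.mem (x, l)).2 ⟨hl, hl.dom⟩
      exact ⟨⟨_, hmem⟩, List.mem_attach _ _, (hf ⟨_, hmem⟩).inj hx⟩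
  · rw [List.pairwise_map]
    have := h.pairwise
    rw [← List.attach_map_subtype_val out, List.pairwise_map] at this
    exact this.imp fun h => (D.precedes_iff (hf _) (hf _)).2 h
  · have e : out.map (fun e => e.2.map (vt n pt)) =
        out.attach.map fun e => e.1.2.map (vt n pt) := by
      conv_lhs => rw [← List.attach_map_subtype_val out, List.map_map]
      rfl
    rw [e, List.forall₂_map_left_iff, List.forall₂_map_right_iff, List.forall₂_same]
    exact fun e _ => hf' e

end Drawing

/-! ## The algorithm -/

namespace Decompose
open MachineState Program Ladder Drawing

/-- the linear-time algorithm -/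
def decompose : Program := .seq markEnds (.seq findEnds (.seq splitEnds (.seq place
  (.seq scanEdges (.seq (nextCross false) (.seq (nextCross true) (.seq sweep
  (.assign 0 (.reg 12)))))))))

variable {n T : ℕ} {p : Fin n → ℝ × ℝ} {G : Digraph (Fin n)} {pt : ℕ → Fin n}

/-- the vertex with the given side and height, as a number -/
def name (n : ℕ) (pt : ℕ → Fin n) (x : Bool × ℕ) : ℕ := (vt n pt x : Fin n)

/-- This makes the loops over the edge list linear in `n`. -/
lemma edges_length_le (D : Drawing p G n T pt) {edges : List (Fin n × Fin n)} (hnd : edges.Nodup)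
    (hE : ∀ x y, (x, y) ∈ edges ↔ G.Adj x y) : edges.length ≤ 2 * n := by
  choose f hf hf' using D.surj
  have hinj : Function.Injective f := fun a b h => by rw [← hf' a, h, hf' b]
  rw [← List.length_map (f := Prod.map f f)]
  refine D.noncrossing.length_le (fun h => ⟨h.1, h.2.1⟩)
    (fun i h => D.acyclic h.2.2 .refl) (fun i j h h' => D.acyclic h.2.2 (.single h'.2.2))
    (hnd.map (hinj.prodMap hinj)) ?_
  rintro _ he
  obtain ⟨⟨x, y⟩, hxy, rfl⟩ := List.mem_map.1 he
  exact ⟨hf x, hf y, by simpa only [Prod.map_apply, hf'] using (hE x y).1 hxy⟩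

variable {b : List (Fin n)} {edges : List (Fin n × Fin n)}

lemma inputState_boundary (hb : b.length = n) {i : ℕ} (hi : i < n) :
    (inputState b edges).arr 0 i = (b[i] : ℕ) := by
  have h : (inputState b edges).arr 0 i = (b.map Fin.val).getD i 0 := by
    simp [inputState, List.map_eq_flatMap]
  have hi' : i < (b.map Fin.val).length := by simpa [hb]
  rw [h, List.getD_eq_getElem _ _ hi', List.getElem_map]

lemma inputState_tail {e : ℕ} (he : e < edges.length) :
    (inputState b edges).arr 1 e = (edges[e].1 : ℕ) := by
  have h : e < (edges.map fun e => (e.1 : ℕ)).length := by simpa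
  exact (List.getD_eq_getElem _ _ h).trans (List.getElem_map ..)

lemma inputState_head {e : ℕ} (he : e < edges.length) :
    (inputState b edges).arr 2 e = (edges[e].2 : ℕ) := by
  have h : e < (edges.map fun e => (e.2 : ℕ)).length := by simpa
  exact (List.getD_eq_getElem _ _ h).trans (List.getElem_map ..)

lemma listed (D : Drawing p G n T pt) (hE : ∀ x y, (x, y) ∈ edges ↔ G.Adj x y) {σ : MachineState}
    (h1 : σ.arr 1 = (inputState b edges).arr 1) (h2 : σ.arr 2 = (inputState b edges).arr 2)
    (hside : ∀ x : Bool × ℕ, x.2 < len n T x.1 → σ.arr 6 (name n pt x) = x.1.toNat)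
    (hheight : ∀ x : Bool × ℕ, x.2 < len n T x.1 → σ.arr 7 (name n pt x) = x.2) :
    Listed D.ladder (name n pt) (σ.arr 1) (σ.arr 2) (σ.arr 6) (σ.arr 7) edges.length := by
  refine ⟨fun e he => ?_, fun x y hxy => ?_, hside, hheight⟩
  · obtain ⟨x, hx, hx'⟩ := D.exists_vt edges[e].1
    obtain ⟨y, hy, hy'⟩ := D.exists_vt edges[e].2
    refine ⟨x, y, D.E_of_adj hx hy ?_, ?_, ?_⟩
    · rw [hx', hy']
      exact (hE _ _).1 (List.getElem_mem he)
    · rw [h1, inputState_tail he, name, hx']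
    · rw [h2, inputState_head he, name, hy']
  · obtain ⟨e, he, hxy'⟩ := List.mem_iff_getElem.1 ((hE _ _).2 hxy.2.2)
    refine ⟨e, he, ?_, ?_⟩
    · rw [h1, inputState_tail he, hxy']; rfl
    · rw [h2, inputState_head he, hxy']; rfl

/-- The continuation `P` matches the right-nested sequence of the whole program, so the
preprocessing can be treated apart from the sweep. -/
lemma prepare_exec (D : Drawing p G n T pt) (hb : b.length = n)
    (hE : ∀ x y, (x, y) ∈ edges ↔ G.Adj x y) (hm : edges.length ≤ 2 * n) {S T' B : ℕ} (hS : S < n)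
    (hT' : T' < n) (hT : T = if T' < S then T' + n - S else T' - S)
    (hpt : ∀ q (_ : q < n), pt q = if h : S + q < n then b[S + q] else b[S + q - n])
    (hs : ∀ i (_ : i < n), (∀ x, ¬ G.Adj x b[i]) ↔ i = S)
    (ht : ∀ i (_ : i < n), (∀ x, ¬ G.Adj b[i] x) ↔ i = T') (hB : 2 * n + 1 ≤ B)
    {P : Program} {C : ℕ} {Q : MachineState → Prop}
    (hP : ∀ τ, Registers D.ladder (name n pt) n (fun _ => 0) (fun _ => 0) [] τ → Exec B P τ C Q) :
    Exec B (.seq markEnds (.seq findEnds (.seq splitEnds (.seq place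
      (.seq scanEdges (.seq (nextCross false) (.seq (nextCross true) P)))))))
      (inputState b edges) (600 * n + 100 + C) Q := by
  have hsum : len n T false + len n T true = n := by
    have := D.lt
    simp only [len_false, len_true]; omega
  have hpos : ∀ q (_ : q < n), (inputState b edges).arr 0 q = (b[q] : ℕ) := fun q hq =>
    inputState_boundary hb hq
  have hmemB : ∀ e < edges.length, (inputState b edges).arr 1 e < n ∧
      (inputState b edges).arr 2 e < n := fun e he => by
    rw [inputState_tail he, inputState_head he]
    exact ⟨Fin.isLt _, Fin.isLt _⟩
  refine (markEnds_exec (B := B) (m := edges.length) rfl (fun e he => by have := hmemB e he; omega)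
    (fun e he => by have := hmemB e he; omega) (fun _ => rfl) (fun _ => rfl) (by omega)
    (by omega)).seq (C₂ := 540 * n + 80 + C) ?_ (by omega)
  rintro τ₁ ⟨s1, h1⟩
  refine (findEnds_exec (B := B) (n := n) (S := S) (T := T') (s1.2 0 (by simp)) (by omega) hS hT'
    (fun i hi => ?_) (fun i hi => ?_)).seq (C₂ := 510 * n + 65 + C) ?_ (by omega)
  · rw [s1.1 0 (by simp), hpos i hi, (h1 _).1, ← hs i hi]
    constructor
    · intro h x hx
      obtain ⟨e, he, hxy⟩ := List.mem_iff_getElem.1 ((hE _ _).2 hx)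
      exact h e he (by rw [inputState_head he, hxy])
    · intro h e he heq
      rw [inputState_head he] at heq
      refine h edges[e].1 ((hE _ _).1 ?_)
      rw [← Fin.ext heq]
      exact List.getElem_mem he
  · rw [s1.1 0 (by simp), hpos i hi, (h1 _).2, ← ht i hi]
    constructor
    · intro h x hx
      obtain ⟨e, he, hxy⟩ := List.mem_iff_getElem.1 ((hE _ _).2 hx)
      exact h e he (by rw [inputState_tail he, hxy])
    · intro h e he heq
      rw [inputState_tail he] at heq
      refine h edges[e].2 ((hE _ _).1 ?_)
      rw [← Fin.ext heq]
      exact List.getElem_mem he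
  rintro τ₂ ⟨s2, r2, r3⟩
  refine (splitEnds_exec (B := B) (n := n) ((s2.2 0 (by simp)).trans (s1.2 0 (by simp))) r2 r3 hT'
    (by omega)).seq (C₂ := 510 * n + 44 + C) ?_ (by omega)
  rw [← hT]
  rintro τ₃ ⟨s3, r3', r4⟩
  have s3' := ((s1.trans s2).trans s3).mono (A' := [4, 5]) (R' := [2, 3, 4, 5]) (by simp) (by simp)
  refine (place_exec (B := B) (n := n) (S := S) (T := T) (f := fun q => (pt q : ℕ))
    (s3'.2 0 (by simp)) ((s3.2 2 (by simp)).trans r2) r3' D.lt (by omega) (fun q hq => ?_)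
    (fun q hq => Fin.isLt _) (fun q hq r hr h => D.inj hq hr (Fin.ext h))).seq
    (C₂ := 460 * n + 33 + C) ?_ (by omega)
  · rw [hpt q hq, s3'.1 0 (by simp)]
    split_ifs with h
    · rw [hpos _ h]
    · rw [hpos _ (by omega)]
  rintro τ₄ ⟨s4, h4⟩
  have s4' := (s3'.trans s4).mono (A' := [4, 5, 6, 7, 8, 9]) (R' := [2, 3, 4, 5, 6, 7]) (by simp)
    (by simp)
  have hplace : ∀ x : Bool × ℕ, x.2 < len n T x.1 → τ₄.arr 6 (name n pt x) = x.1.toNat ∧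
      τ₄.arr 7 (name n pt x) = x.2 ∧ τ₄.arr (vertArr x.1) x.2 = name n pt x := by
    have hTn := D.lt
    rintro ⟨_ | _, i⟩ hx
    · have hx' : i < T := hx
      obtain ⟨k1, k2, k3⟩ := h4 i (by omega)
      rw [if_pos hx'] at k1 k2 k3
      exact ⟨k1, k2, k3⟩
    · have hx' : i < n - T := hx
      obtain ⟨k1, k2, k3⟩ := h4 (n - 1 - i) (by omega)
      rw [if_neg (by omega)] at k1 k2 k3
      rw [show n - 1 - (n - 1 - i) = i by omega] at k2 k3
      exact ⟨k1, k2, k3⟩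
  have hL := listed D hE (s4'.1 1 (by simp)) (s4'.1 2 (by simp)) (fun x hx => (hplace x hx).1)
    fun x hx => (hplace x hx).2.1
  have hN : ∀ ρ, len n T ρ ≤ n := fun ρ => by cases ρ <;> omega
  have hside : ∀ x : Bool × ℕ, x.2 < len n T x.1 → name n pt x < n ∧
      τ₄.arr 6 (name n pt x) < 2 ∧ τ₄.arr 7 (name n pt x) < n := fun x hx => by
    obtain ⟨k1, k2, -⟩ := hplace x hx
    refine ⟨Fin.isLt _, ?_, ?_⟩
    · rw [k1]; have := Bool.toNat_le x.1; omega
    · rw [k2]; exact hx.trans_le (hN _)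
  refine (scanEdges_exec (B := B) (n := n) (m := edges.length) (s4'.2 0 (by simp))
    (s4'.2 1 (by simp)) (by omega) (by omega) rfl rfl rfl rfl (fun e he => ?_) (fun e he => ?_)
    (fun a ha v => ?_)).seq (C₂ := 160 * n + 22 + C) ?_ (by omega)
  · obtain ⟨x, y, hxy, h5, -⟩ := hL.sound e he
    rw [h5]
    exact hside x hxy.1
  · obtain ⟨x, y, hxy, -, h5⟩ := hL.sound e he
    rw [h5]
    exact hside y hxy.2.1
  · simp only [List.mem_cons, List.not_mem_nil, or_false] at ha
    rw [s4'.1 a (by simp; omega)]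
    rcases ha with rfl | rfl | rfl | rfl | rfl <;> rfl
  rintro τ₅ ⟨s5, h5⟩
  have s5' := (s4'.trans s5).mono (A' := [4, 5, 6, 7, 8, 9, 10, 11, 12, 13, 14])
    (R' := [2, 3, 4, 5, 6, 7]) (by simp) (by simp)
  have r35 : τ₅.reg 3 = T := (s5.2 3 (by simp)).trans ((s4.2 3 (by simp)).trans r3')
  have r45 : τ₅.reg 4 = n - T := (s5.2 4 (by simp)).trans ((s4.2 4 (by simp)).trans r4)
  have specs := fun (ρ : Bool) (i : ℕ) (hi : i < len n T ρ) => h5.specs hL hN hi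
  have hX : ∀ ρ, ∀ i < len n T ρ, (∃ l, D.ladder.X ρ i l) ↔
      τ₅.arr 11 (name n pt (ρ, i)) ≠ 0 ∨ τ₅.arr 13 (name n pt (ρ, i)) ≠ 0 := by
    intro ρ i hi
    obtain ⟨-, k1, -, k2, -⟩ := specs ρ i hi
    have aux : ∀ {P : ℕ → Prop} {v}, MaxSpec P v → ((∃ j, P j) ↔ v ≠ 0) := by
      rintro P v (⟨rfl, h⟩ | ⟨x, rfl, h, -⟩)
      · simpa using h
      · simpa using ⟨x, h⟩
    rw [← aux k1, ← aux k2, ← exists_or]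
    rfl
  have hv5 : ∀ ρ i, i < len n T ρ → τ₅.arr (vertArr ρ) i = name n pt (ρ, i) := fun ρ i hi => by
    rw [s5.1 _ (by cases ρ <;> decide)]
    exact (hplace (ρ, i) hi).2.2
  have hB' : ∀ x, name n pt x ≤ B := fun x => by
    have : name n pt x < n := Fin.isLt _
    omega
  have hN0 := hN false
  have hN1 := hN true
  refine (nextCross_exec (B := B) (ρ := false) (N := len n T false)
    (X := fun i => ∃ l, D.ladder.X false i l) (v := fun i => name n pt (false, i)) r35 (by omega)
    (hv5 false) (fun i _ => hB' _) (hX false) (fun i ⟨l, h⟩ => h.dom.1) (fun i => ?_)).seq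
    (C₂ := 80 * n + 11 + C) ?_ (by omega)
  · rw [s5'.1 _ (by decide)]; rfl
  rintro τ₆ ⟨s6, h6⟩
  refine (nextCross_exec (B := B) (ρ := true) (N := len n T true)
    (X := fun i => ∃ l, D.ladder.X true i l) (v := fun i => name n pt (true, i))
    ((s6.2 4 (by simp)).trans r45) (by omega) (fun i hi => ?_) (fun i _ => hB' _) (fun i hi => ?_)
    (fun i ⟨l, h⟩ => h.dom.1) (fun i => ?_)).seq (C₂ := C) ?_ (by omega)
  · rw [s6.1 _ (by decide)]; exact hv5 true i hi
  · rw [s6.1 11 (by decide), s6.1 13 (by decide)]; exact hX true i hi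
  · rw [s6.1 _ (by decide), s5'.1 _ (by decide)]; rfl
  rintro τ₇ ⟨s7, h7⟩
  have s57 := (s6.trans s7).mono (A' := [15, 16]) (R' := [5, 6, 7]) (by decide) (by decide)
  have s7' := (s5'.trans s57).mono (A' := [4, 5, 6, 7, 8, 9, 10, 11, 12, 13, 14, 15, 16])
    (R' := [2, 3, 4, 5, 6, 7]) (by simp) (by simp)
  have h57 := h5.of_same s57 (by decide)
  refine hP τ₇ ⟨⟨s7'.2 0 (by simp), fun ρ => ?_, hsum, fun {ρ i} hi => ?_, fun _ => Fin.isLt _,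
    fun hi => (h57.specs hL hN hi).1, fun hi => (h57.specs hL hN hi).2.1,
    fun hi => (h57.specs hL hN hi).2.2.1, fun hi => (h57.specs hL hN hi).2.2.2.1,
    fun hi => (h57.specs hL hN hi).2.2.2.2, fun ρ i => ?_⟩, fun ρ => ?_, fun ρ => ?_, ?_, ?_⟩
  · cases ρ
    · exact (s57.2 3 (by simp)).trans r35
    · exact (s57.2 4 (by simp)).trans r45
  · rw [s57.1 _ (by cases ρ <;> decide)]
    exact hv5 ρ i hi
  · cases ρ
    · rw [s7.1 _ (by decide)]; exact h6 i
    · exact h7 i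
  · cases ρ
    · exact s7'.2 8 (by simp)
    · exact s7'.2 9 (by simp)
  · cases ρ
    · exact s7'.2 10 (by simp)
    · exact s7'.2 11 (by simp)
  · exact s7'.2 12 (by simp)
  · simp [words]

end Decompose

theorem mainTheorem6 :
    (∀ (n : ℕ) (p : Fin n → ℝ × ℝ) (G : Digraph (Fin n)) (s t : Fin n),
      IsOuterplanarSTDigraph p G Finset.univ s t →
        (∀ W W' : Finset (Fin n), IsMaximalSTPolygon p G W → IsMaximalSTPolygon p G W' →
          W ≠ W' → AreaDisjoint p W W') ∧
        IsStrictTotalOrder {x : Piece (Fin n) // IsPiece p G x} (fun x y => Precedes G x y)) ∧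
    (∃ (P : Program) (c : ℕ),
      ∀ (n : ℕ) (p : Fin n → ℝ × ℝ) (G : Digraph (Fin n)) (s t : Fin n),
      IsOuterplanarSTDigraph p G Finset.univ s t →
        ∀ (b : List (Fin n)) (edges : List (Fin n × Fin n)),
          IsBoundary p Finset.univ b →
          edges.Nodup → (∀ x y, (x, y) ∈ edges ↔ G.Adj x y) →
          ∃ (k : ℕ) (τ : MachineState) (L : List (Piece (Fin n))),
            Runs (c * n) P (inputState b edges) k τ ∧ k ≤ c * n ∧
            IsSTPolygonDecomposition p G L ∧ IsOutput p G L τ) := by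
  refine ⟨fun n p G s t hG => ?_, Decompose.decompose, 2000, fun n p G s t hG b edges hb hnd hE => ?_⟩
  · obtain ⟨_, _, _, D⟩ := exists_drawing hG
    exact ⟨fun W W' h h' hne => D.areaDisjoint h h' hne, D.isStrictTotalOrder⟩
  -- There is a source, so `n` is positive and the additive constants of the step bounds are
  -- absorbed by the factor `2000`.
  have hn : 0 < n := s.pos
  have hlen : b.length = n := by
    rw [← List.toFinset_card_of_nodup hb.nodup, Finset.eq_univ_iff_forall.2 fun v =>
      List.mem_toFinset.2 ((hb.mem_iff v).2 (Finset.mem_univ v)), Finset.card_univ, Fintype.card_fin]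
  obtain ⟨S, hS, hs⟩ := List.mem_iff_getElem.1 ((hb.mem_iff s).2 (Finset.mem_univ s))
  obtain ⟨T', hT', ht⟩ := List.mem_iff_getElem.1 ((hb.mem_iff t).2 (Finset.mem_univ t))
  -- The length is generalized because `n` occurs in the type of the vertices and cannot be
  -- rewritten to `b.length`.
  have hD : ∀ k, b.length = k →
      Drawing p G k (if T' < S then T' + k - S else T' - S) (cyclicGet b S s) := by
    rintro _ rfl
    exact hb.drawing hG hS hT' hs ht
  have D := hD n hlen
  have hm := Decompose.edges_length_le D hnd hE
  have hget : ∀ {i j : ℕ} (hi : i < b.length) (hj : j < b.length), b[i] = b[j] ↔ i = j :=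
    fun _ _ => hb.nodup.getElem_inj_iff
  have hexec := Decompose.prepare_exec D hlen hE hm (S := S) (T' := T') (B := 2000 * n)
    (P := .seq Decompose.sweep (.assign 0 (.reg 12))) (C := 700 * n + 20)
    (Q := fun τ => ∃ top out, D.ladder.SweepInv D.ladder.N top out ∧
      τ.reg 0 = (Decompose.words (Decompose.name n (cyclicGet b S s)) out).length ∧
      ∀ k (h : k < (Decompose.words (Decompose.name n (cyclicGet b S s)) out).length),
        τ.arr 3 k = (Decompose.words (Decompose.name n (cyclicGet b S s)) out)[k])
    (by omega) (by omega) rfl (fun q hq => ?_) (fun i hi => ?_) (fun i hi => ?_) (by omega) ?_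
  · obtain ⟨k, τ, hrun, hk, top, out, hI, hreg, harr⟩ := hexec
    obtain ⟨Ps, hPs, hrep⟩ := D.exists_decomposition hI
    refine ⟨k, τ, Ps, hrun, by omega, hPs, _, hrep, ?_⟩
    have e : (out.map fun e => e.2.map (Drawing.vt n (cyclicGet b S s))).flatMap
        (fun l => l.length :: l.map fun v => (v : ℕ)) =
        Decompose.words (Decompose.name n (cyclicGet b S s)) out := by
      have hmap (l : List (Bool × ℕ)) : l.map (Decompose.name n (cyclicGet b S s)) =
          l.flatMap fun x => [Decompose.name n (cyclicGet b S s) x] := List.map_eq_flatMap ..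
      simp [Decompose.words, List.flatMap_map, hmap, Decompose.name]
    rw [e]
    refine List.ext_getElem (by simp [hreg]) fun k h1 h2 => ?_
    rw [List.getElem_ofFn]
    exact harr k h2
  · rw [cyclicGet_eq hS (by omega)]
    simp only [hlen]
  · rw [← hget (by omega) hS, hs, ← hG.source]
    simp [IsSource]
  · rw [← hget (by omega) hT', ht, ← hG.sink]
    simp [IsSink]
  · intro τ hτ
    refine (Decompose.sweep_exec hτ (by omega)).seq (C₂ := 2) ?_ (by omega)
    rintro υ ⟨top, out, hυ, hI⟩
    have hout := hυ.out
    have hl := Decompose.length_words (Decompose.name n (cyclicGet b S s)) out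
    have hl' := hI.outputLength_le hυ.prepared.sum
    refine ⟨_, _, .assign υ 0 (.reg 12) ?_, le_rfl, top, out, hI, ?_, fun k hk => ?_⟩
    · rw [Expr.eval, hout.1]; omega
    · simp [MachineState.setReg_reg, Expr.eval, hout.1]
    · exact hout.2 k hk
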